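/- **Conventions.** For an entire function $\varphi$ of exponential type, $\tau_\varphi$ is the infimum of the $\tau>0$ with $|\varphi(z)|\le Ce^{\tau|z|}$ for some $C>0$ and all $z$, and its Borel transform $\mathcal B(\varphi)$ is the analytic continuation of $\sum_{n\ge 0}\varphi^{(n)}(0)z^{-n-1}$. For a simply connected domain $\Omega\subset\mathbb C$, $Exp(\Omega)$ is the set of entire functions $\varphi$ of exponential type whose Borel transform continues analytically to the complement of some compact $K\subset\Omega$; $H_1(\varphi)$ is the class of positively oriented rectifiable simple closed curves that enclose the singular set $K$. For $F$ holomorphic on $\Omega$ and $\varphi\in Exp(\Omega)$, $F(\partial_t)\varphi(z):=\int_\gamma e^{sz}F(s)\mathcal B(\varphi)(s)\frac{ds}{2\pi i}$, with $\gamma\in H_1(\varphi)$ contained in $\Omega$. **Setting.** Let $h>1$ and $\Omega=\mathbb C\setminus\{s:\operatorname{Re}s\ge 0,\ |\operatorname{Im}s|=\sqrt{h-1}\}$. Let $0<\delta<r$ and $\pi/2<\psi\le\pi$, and let $\kappa_r$ be the finite angular contour that consists of the segment of the ray $\arg s=-\psi$ from radius $r$ to radius $\delta$, the arc $\delta e^{i\theta}$,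 $-\psi\le\theta\le\psi$, and the segment of the ray $\arg s=\psi$ from radius $\delta$ to radius $r$. Assume that $\kappa_r\subset\Omega$ and that $\zeta(s^2+h)$ has no zero on $\kappa_r$. Let $g:[0,\infty)\to\mathbb C$ be analytic, with Laplace integral absolutely convergent on some half-plane $\operatorname{Re}s>a$, and suppose that its Laplace transform $\mathcal L(g)$ continues analytically to $\{|s|>\delta,\ |\arg s|<\psi\}$ and continuously up to the boundary contour (if $\psi=\pi$, the two sides of the negative axis may carry different boundary values). Put $$g_r(z)=\int_{\kappa_r}e^{sz}\mathcal L(g)(s)\frac{ds}{2\pi i},\qquad (K*\mu_r)(s)=\int_{\kappa_r}\frac{\mathcal L(g)(w)}{s-w}\frac{dw}{2\pi i}.$$ **Theorem.** (1) For every $R\ge r$ (in particular $R=r$) the function $\zeta(s^2+h)$ has finitely many zeros $\tau_1,\dots,\tau_N$ in the closed ball of radius $R$ around $0$, and the solutions $f\in Exp(\Omega)$ of $$\zeta(\partial_t^2+h)f=g_r$$ of exponential type $\tau_f\le R$ are exactly the functions $$f(z)=\int_{\kappa_r}e^{sz}\frac{\mathcal L(g)(s)}{\zeta(s^2+h)}\frac{ds}{2\pi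 i}+\sum_{j=1}^{N}p_j(z)e^{\tau_jz},$$ where $p_1,\dots,p_N$ are arbitrary polynomials with $\deg p_j\le \operatorname{ord}(\tau_j)-1$ (the zero polynomial is allowed). Here $\operatorname{ord}(\tau_j)$ is the order of $\tau_j$ as a zero of $\zeta(s^2+h)$. (2) Let $\gamma'$ be a positively oriented rectifiable simple closed curve that encloses $\kappa_r$ and the zeros of $\zeta(s^2+h)$ in the closed ball of radius $r$, while no other zero of $\zeta(s^2+h)$ lies on it or inside it. Then $$\phi_r(z)=\int_{\gamma'}e^{sz}\frac{(K*\mu_r)(s)}{\zeta(s^2+h)}\frac{ds}{2\pi i}$$ is a solution in $Exp(\Omega)$ of $\zeta(\partial_t^2+h)\phi_r=g_r$, and it has the form in (1) with $R=r$, for suitable polynomials $p_j$. -/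

import Mathlib

namespace ZetaNonlocal

noncomputable section

/-- The integral `∫_γ F(s) ds` along a curve parametrized by `[0, 1]`. -/
def contourInt (γ : ℝ → ℂ) (F : ℂ → ℂ) : ℂ :=
  ∫ t in (0 : ℝ)..1, F (γ t) * deriv γ t

/-- The winding number `(1 / 2πi) ∫_γ ds / (s - w)`. -/
def windingNumber (γ : ℝ → ℂ) (w : ℂ) : ℂ :=
  (2 * Real.pi * Complex.I)⁻¹ * contourInt γ (fun s => (s - w)⁻¹)

/-- A rectifiable simple closed curve. Every rectifiable curve has a Lipschitz parametrization
(proportional to arc length), and this is the parametrization that is used. -/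
structure IsSimpleClosedCurve (γ : ℝ → ℂ) : Prop where
  closed : γ 0 = γ 1
  simple : Set.InjOn γ (Set.Ico 0 1)
  rectifiable : ∃ C, LipschitzOnWith C γ (Set.Icc 0 1)

/-- `w` is not on the curve and the curve winds once, counterclockwise, around `w`; for a simple
closed curve this says that `w` lies in the bounded region and that the curve is positively
oriented. -/
def Encloses (γ : ℝ → ℂ) (w : ℂ) : Prop :=
  w ∉ γ '' Set.Icc 0 1 ∧ windingNumber γ w = 1

/-- `w` is neither on the curve nor enclosed by it. -/
def Excludes (γ : ℝ → ℂ) (w : ℂ) : Prop :=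
  w ∉ γ '' Set.Icc 0 1 ∧ windingNumber γ w = 0

/-- The class `H₁` of positively oriented rectifiable simple closed curves that contain the
(singular) set `K` in their bounded region. -/
def MemH1 (K : Set ℂ) (γ : ℝ → ℂ) : Prop :=
  IsSimpleClosedCurve γ ∧ ∀ w ∈ K, Encloses γ w

/-- `φ` is an entire function of (finite) exponential type. -/
def IsEntireExpType (φ : ℂ → ℂ) : Prop :=
  Differentiable ℂ φ ∧ ∃ τ > 0, ∃ C > 0, ∀ z, ‖φ z‖ ≤ C * Real.exp (τ * ‖z‖)

/-- The exponential type `τ_φ`, the infimum of the positive `τ` with `|φ(z)| ≤ C e^{τ|z|}`. -/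
def expType (φ : ℂ → ℂ) : ℝ :=
  sInf {τ : ℝ | 0 < τ ∧ ∃ C > 0, ∀ z, ‖φ z‖ ≤ C * Real.exp (τ * ‖z‖)}

/-- `B` is an analytic continuation of the Borel transform `∑ φ⁽ⁿ⁾(0) / zⁿ⁺¹` (a series that
converges near infinity) to the complement of `K`. -/
def IsBorelTransform (φ : ℂ → ℂ) (K : Set ℂ) (B : ℂ → ℂ) : Prop :=
  DifferentiableOn ℂ B Kᶜ ∧
    ∃ ρ : ℝ, ∀ z : ℂ, ρ < ‖z‖ → HasSum (fun n : ℕ => iteratedDeriv n φ 0 / z ^ (n + 1)) (B z)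

/-- The space `Exp(Ω)`. An open neighbourhood, in the extended plane, of the complement of `Ω` in
the extended plane is the complement of a compact subset of `Ω`. -/
def MemExp (Ω : Set ℂ) (φ : ℂ → ℂ) : Prop :=
  IsEntireExpType φ ∧ ∃ K B, IsCompact K ∧ K ⊆ Ω ∧ IsBorelTransform φ K B

/-- `f(∂_t) φ = ψ`: there are a continuation `B` of the Borel transform of `φ` and a curve
`γ ∈ H₁(φ)` inside `Ω` with `ψ(z) = ∫_γ e^{sz} f(s) B(s) ds / 2πi`. For `Ω` simply connected, `f`
holomorphic on `Ω` and `φ` in `Exp(Ω)`, the right-hand side does not depend on these choices. -/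
def SymbolActs (Ω : Set ℂ) (f : ℂ → ℂ) (φ ψ : ℂ → ℂ) : Prop :=
  ∃ K B γ, IsCompact K ∧ K ⊆ Ω ∧ IsBorelTransform φ K B ∧
    MemH1 K γ ∧ Set.MapsTo γ (Set.Icc 0 1) Ω ∧
    ∀ z, ψ z = (2 * Real.pi * Complex.I)⁻¹ *
      contourInt γ (fun s => Complex.exp (s * z) * f s * B s)

/-- The symbol `ζ(s² + h)`. -/
def zetaSymbol (h : ℝ) (s : ℂ) : ℂ := riemannZeta (s ^ 2 + h)

/-- The plane slit along the two horizontal half-lines that start at the poles `± i √(h - 1)`. -/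
def Omega (h : ℝ) : Set ℂ :=
  {s : ℂ | 0 ≤ s.re ∧ |s.im| = Real.sqrt (h - 1)}ᶜ

/-- `f ∈ Exp(Ω)` and `ζ(∂_t² + h) f = u`. -/
def IsSolution (h : ℝ) (u f : ℂ → ℂ) : Prop :=
  MemExp (Omega h) f ∧ SymbolActs (Omega h) (zetaSymbol h) f u

/-- The point `t e^{iθ}`. -/
def polar (t θ : ℝ) : ℂ := t * Complex.exp (θ * Complex.I)

/-- The finite angular contour `κ_r`: the arc of radius `δ` around the origin and the two segments
of the rays of arguments `± ψ` between the radii `δ` and `r`. -/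
def kappa (δ ψ r : ℝ) : Set ℂ :=
  {s | ∃ t ∈ Set.Icc δ r, s = polar t ψ ∨ s = polar t (-ψ)} ∪
    {s | ∃ θ ∈ Set.Icc (-ψ) ψ, s = polar δ θ}

/-- `g` is analytic on `[0, ∞)`, its Laplace integral converges absolutely on a half-plane, it
continues to a function `L` that is analytic on the region to the right of the infinite angular
contour, and `L` extends continuously to the contour. The function `G t θ` is the value of
`L` at `t e^{iθ}`, boundary values included; in polar coordinates the two sides of the negative
real axis are kept apart when `ψ = π`. -/
structure IsLaplaceTransform (g : ℝ → ℂ) (δ ψ : ℝ) (G : ℝ → ℝ → ℂ) : Prop where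
  analytic : AnalyticOn ℝ g (Set.Ici 0)
  continuation : ∃ (a : ℝ) (L : ℂ → ℂ),
    (∀ z : ℂ, a < z.re →
      MeasureTheory.IntegrableOn (fun t : ℝ => Complex.exp (-(t * z)) * g t) (Set.Ioi 0)) ∧
    DifferentiableOn ℂ L {z | δ < ‖z‖ ∧ |z.arg| < ψ} ∧
    (∀ z : ℂ, a < z.re → δ < ‖z‖ → |z.arg| < ψ →
      L z = ∫ t in Set.Ioi (0 : ℝ), Complex.exp (-(t * z)) * g t) ∧
    (∀ t θ : ℝ, δ < t → |θ| < ψ → G t θ = L (polar t θ))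
  boundary : ContinuousOn (fun x : ℝ × ℝ => G x.1 x.2) (Set.Ici δ ×ˢ Set.Icc (-ψ) ψ)

/-- `∫_{κ_r} F(s) L(s) ds / 2πi`, where `L(t e^{iθ}) = G t θ`: in along the lower ray,
counterclockwise along the arc, out along the upper ray. -/
def kappaInt (δ ψ r : ℝ) (G : ℝ → ℝ → ℂ) (F : ℂ → ℂ) : ℂ :=
  (2 * Real.pi * Complex.I)⁻¹ *
    (-(∫ t in δ..r, F (polar t (-ψ)) * G t (-ψ) * Complex.exp (-ψ * Complex.I)) +
      (∫ θ in (-ψ)..ψ, F (polar δ θ) * G δ θ * (Complex.I * polar δ θ)) +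
      ∫ t in δ..r, F (polar t ψ) * G t ψ * Complex.exp (ψ * Complex.I))

/-- The truncated source `g_r`. -/
def truncatedSource (δ ψ r : ℝ) (G : ℝ → ℝ → ℂ) (z : ℂ) : ℂ :=
  kappaInt δ ψ r G (fun s => Complex.exp (s * z))

/-- The Borel transform `(K * μ_r)(s) = ∫_{κ_r} L(w) / (s - w) dw / 2πi` of `g_r`. -/
def cauchyTransform (δ ψ r : ℝ) (G : ℝ → ℝ → ℂ) (s : ℂ) : ℂ :=
  kappaInt δ ψ r G (fun w => (s - w)⁻¹)

/-- `∫_{κ_r} e^{sz} L(s) / ζ(s² + h) ds / 2πi + ∑_{τ ∈ Z} p_τ(z) e^{τz}`. -/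
def solutionFormula (h δ ψ r : ℝ) (G : ℝ → ℝ → ℂ) (Z : Finset ℂ) (p : ℂ → Polynomial ℂ)
    (z : ℂ) : ℂ :=
  kappaInt δ ψ r G (fun s => Complex.exp (s * z) / zetaSymbol h s) +
    ∑ τ ∈ Z, (p τ).eval z * Complex.exp (τ * z)

end

end ZetaNonlocal

/-! Every function in play has the form `z ↦ Λ (e^{sz})`, where `Λ` is a linear functional that is
bounded for the supremum norm on functions continuous on a compact set `S`: integration over `κ_r`,
integration over a closed curve, possibly with a weight. Its derivatives at the origin are the
moments `Λ (wⁿ)`, its Borel transform near infinity is `Λ ((z - w)⁻¹)`, and its type is at most the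
largest modulus on `S`. The equation thus becomes a statement about functionals.

Existence (`IsSource.isSolution`): the Borel transform of the proposed `f` is a Cauchy transform
along `κ_r` with weight `1 / ζ(s² + h)`, plus a principal part at the zeros. Multiply by `e^{sz}
ζ(s² + h)` and integrate over a curve in `Ω` around the singularities. By Fubini and Cauchy's
formula the first term returns `g_r`; in the second the zeros of the symbol cancel the poles, so it
contributes nothing. The curve comes from `exists_memH1_Omega`, Cauchy's formula from
`cauchy_integral_formula`.

Uniqueness (`IsSource.exists_formula`): let `Λ` represent the difference between a solution and the
integral over `κ_r`. The equation says that `F ↦ Λ (ζ(s² + h) F)` kills all exponentials, hence all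
monomials, hence all functions holomorphic on a disc around `S`. On `S` the polynomial of the zeros
of the symbol in that disc is the symbol times a function holomorphic on the disc, so `Λ` kills the
multiples of this polynomial. Type at most `R` bounds the moments of `Λ` by multiples of `σⁿ` for
every `σ > R`. A factor `s - τ` with `|τ| > R` would force geometric growth with ratio `τ`, so such
factors can be dropped (`eq_zero_of_zeroPoly_mul`). Only the zeros with `|τ| ≤ R` remain, and
Hermite interpolation of `e^{sz}` at these zeros shows that `Λ (e^{sz})` is an exponential
polynomial with the required degrees (`exists_exponential_polynomial`).

Part (2) uses this last step again: the difference between `φ_r` and the integral over `κ_r` comes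
from a functional that kills the multiples of the polynomial of the zeros inside `γ'`. So `φ_r` has
the form in (1), and by existence it is a solution. -/

namespace ZetaNonlocal

section

open Set Filter Topology MeasureTheory
open scoped NNReal

/-! ### Calculus along Lipschitz curves -/

/-- A Lipschitz curve on `[a, b]` is differentiable at almost every interior point. -/
lemma ae_differentiableAt_of_lipschitzOn {C : ℝ≥0} {f : ℝ → ℂ} {a b : ℝ}
    (hf : LipschitzOnWith C f (Icc a b)) :
    ∀ᵐ t, t ∈ Ioo a b → DifferentiableAt ℝ f t := by
  filter_upwards [hf.ae_differentiableWithinAt_of_mem_real] with t ht htm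
  exact (ht (Ioo_subset_Icc_self htm)).differentiableAt (Icc_mem_nhds htm.1 htm.2)

lemma ae_mem_Ioo_of_mem_uIoc {a b : ℝ} (hab : a ≤ b) : ∀ᵐ t : ℝ, t ∈ uIoc a b → t ∈ Ioo a b := by
  have : ∀ᵐ t : ℝ, t ≠ b := by simp [ae_iff, measure_singleton]
  filter_upwards [this] with t ht htm
  rw [uIoc_of_le hab] at htm
  exact ⟨htm.1, lt_of_le_of_ne htm.2 ht⟩

lemma norm_deriv_le_of_lipschitzOn_Icc {C : ℝ≥0} {f : ℝ → ℂ} {a b t : ℝ}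
    (hf : LipschitzOnWith C f (Icc a b)) (ht : t ∈ Ioo a b) : ‖deriv f t‖ ≤ C :=
  norm_deriv_le_of_lipschitzOn (Icc_mem_nhds ht.1 ht.2) hf

/-- A bounded almost everywhere strongly measurable function is interval integrable. -/
lemma intervalIntegrable_of_bound {f : ℝ → ℂ} {a b : ℝ} (hab : a ≤ b) (M : ℝ)
    (hm : AEStronglyMeasurable f (volume.restrict (Ioc a b)))
    (hb : ∀ t ∈ Ioo a b, ‖f t‖ ≤ M) : IntervalIntegrable f volume a b := by
  rw [intervalIntegrable_iff, uIoc_of_le hab]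
  refine Integrable.of_bound hm M ?_
  rw [ae_restrict_iff' measurableSet_Ioc]
  filter_upwards [ae_mem_Ioo_of_mem_uIoc hab] with t ht htm
  exact hb t (ht (by rwa [uIoc_of_le hab]))

lemma intervalIntegrable_deriv_of_lipschitzOn {C : ℝ≥0} {f : ℝ → ℂ} {a b : ℝ} (hab : a ≤ b)
    (hf : LipschitzOnWith C f (Icc a b)) : IntervalIntegrable (deriv f) volume a b :=
  intervalIntegrable_of_bound hab C (measurable_deriv f).aestronglyMeasurable
    fun _ ht => norm_deriv_le_of_lipschitzOn_Icc hf ht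

/-- The fundamental theorem of calculus for Lipschitz curves in the plane. -/
lemma integral_deriv_of_lipschitzOn {C : ℝ≥0} {f : ℝ → ℂ} {a b : ℝ} (hab : a ≤ b)
    (hf : LipschitzOnWith C f (Icc a b)) : ∫ t in a..b, deriv f t = f b - f a := by
  have hint := intervalIntegrable_deriv_of_lipschitzOn hab hf
  -- The fundamental theorem for absolutely continuous functions is applied to real-valued
  -- functions; the real and imaginary parts then determine the complex integral.
  have key : ∀ (ℓ : ℂ →L[ℝ] ℝ), ℓ (∫ t in a..b, deriv f t) = ℓ (f b) - ℓ (f a) := by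
    intro ℓ
    rw [← ℓ.intervalIntegral_comp_comm hint]
    have hl : LipschitzOnWith (‖ℓ‖₊ * C) (fun t => ℓ (f t)) (uIcc a b) := by
      rw [uIcc_of_le hab]; exact ℓ.lipschitz.comp_lipschitzOnWith hf
    rw [← hl.absolutelyContinuousOnInterval.integral_deriv_eq_sub]
    refine intervalIntegral.integral_congr_ae ?_
    filter_upwards [ae_mem_Ioo_of_mem_uIoc hab, ae_differentiableAt_of_lipschitzOn hf]
      with t h1 h2 h3
    exact ((ℓ.hasFDerivAt.comp_hasDerivAt t (h2 (h1 h3)).hasDerivAt).deriv).symm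
  apply Complex.ext
  · simpa using key Complex.reCLM
  · simpa using key Complex.imCLM

/-- The composition of a holomorphic function with a Lipschitz curve is Lipschitz. -/
lemma exists_lipschitzOnWith_comp {C : ℝ≥0} {γ : ℝ → ℂ} {a b : ℝ} {U : Set ℂ} {F : ℂ → ℂ}
    (hγ : LipschitzOnWith C γ (Icc a b)) (hU : IsOpen U) (hγU : MapsTo γ (Icc a b) U)
    (hF : DifferentiableOn ℂ F U) : ∃ K, LipschitzOnWith K (fun t => F (γ t)) (Icc a b) := by
  apply LocallyLipschitzOn.exists_lipschitzOnWith_of_compact isCompact_Icc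
  intro t ht
  have hA : ContDiffAt ℂ 1 F (γ t) := (hF.analyticAt (hU.mem_nhds (hγU ht))).contDiffAt
  obtain ⟨K, s, hs, hK⟩ := hA.exists_lipschitzOnWith
  have hpre : γ ⁻¹' s ∩ Icc a b ∈ 𝓝[Icc a b] t :=
    inter_mem ((hγ.continuousOn t ht) hs) self_mem_nhdsWithin
  refine ⟨K * C, _, hpre, ?_⟩
  exact hK.comp (hγ.mono inter_subset_right) (fun x hx => hx.1)

/-- The fundamental theorem of calculus along a Lipschitz curve. -/
lemma integral_deriv_comp_of_lipschitzOn {C : ℝ≥0} {γ : ℝ → ℂ} {a b : ℝ} (hab : a ≤ b)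
    {U : Set ℂ} {F F' : ℂ → ℂ}
    (hγ : LipschitzOnWith C γ (Icc a b)) (hU : IsOpen U) (hγU : MapsTo γ (Icc a b) U)
    (hF : ∀ z ∈ U, HasDerivAt F (F' z) z) :
    ∫ t in a..b, F' (γ t) * deriv γ t = F (γ b) - F (γ a) := by
  obtain ⟨K, hK⟩ := exists_lipschitzOnWith_comp hγ hU hγU
    (fun z hz => (hF z hz).differentiableAt.differentiableWithinAt)
  rw [← integral_deriv_of_lipschitzOn hab hK]
  refine intervalIntegral.integral_congr_ae ?_
  filter_upwards [ae_mem_Ioo_of_mem_uIoc hab, ae_differentiableAt_of_lipschitzOn hγ]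
    with t h1 h2 h3
  have h4 := h1 h3
  exact ((hF (γ t) (hγU (Ioo_subset_Icc_self h4))).comp_of_eq t (h2 h4).hasDerivAt rfl).deriv.symm

/-! ### Closed curves and winding numbers -/

/-- A closed curve on `[0, 1]` with a Lipschitz parametrization. -/
structure IsClosedLipschitz (γ : ℝ → ℂ) : Prop where
  closed : γ 0 = γ 1
  lipschitz : ∃ C, LipschitzOnWith C γ (Icc 0 1)

lemma IsSimpleClosedCurve.isClosedLipschitz {γ : ℝ → ℂ} (h : IsSimpleClosedCurve γ) :
    IsClosedLipschitz γ := ⟨h.closed, h.rectifiable⟩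

namespace IsClosedLipschitz

variable {γ : ℝ → ℂ}

lemma continuousOn (h : IsClosedLipschitz γ) : ContinuousOn γ (Icc 0 1) :=
  h.lipschitz.choose_spec.continuousOn

lemma isCompact_image (h : IsClosedLipschitz γ) : IsCompact (γ '' Icc 0 1) :=
  isCompact_Icc.image_of_continuousOn h.continuousOn

/-- The integral of a derivative along a closed curve vanishes. -/
lemma contourInt_deriv (h : IsClosedLipschitz γ) {U : Set ℂ} (hU : IsOpen U)
    (hγU : MapsTo γ (Icc 0 1) U) {F F' : ℂ → ℂ} (hF : ∀ z ∈ U, HasDerivAt F (F' z) z) :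
    contourInt γ F' = 0 := by
  obtain ⟨C, hC⟩ := h.lipschitz
  rw [contourInt, integral_deriv_comp_of_lipschitzOn zero_le_one hC hU hγU hF, h.closed, sub_self]

end IsClosedLipschitz

lemma contourInt_congr {γ : ℝ → ℂ} {F G : ℂ → ℂ} (h : ∀ w ∈ γ '' Icc 0 1, F w = G w) :
    contourInt γ F = contourInt γ G := by
  refine intervalIntegral.integral_congr fun t ht => ?_
  rw [uIcc_of_le zero_le_one] at ht
  simp only [h (γ t) (mem_image_of_mem _ ht)]

/-- The winding number vanishes around the start of a ray that avoids the curve. -/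
lemma windingNumber_eq_zero_of_ray {γ : ℝ → ℂ} (h : IsClosedLipschitz γ) {w d : ℂ} (hd : d ≠ 0)
    (hray : ∀ x : ℝ, 0 ≤ x → w + x * d ∉ γ '' Icc 0 1) : windingNumber γ w = 0 := by
  rw [windingNumber, mul_eq_zero]
  right
  -- The branch cut of this logarithm is exactly the ray, so `(z - w)⁻¹` has a primitive near the
  -- curve.
  refine h.contourInt_deriv (U := {z | (z - w) / (-d) ∈ Complex.slitPlane})
    (F := fun z => Complex.log ((z - w) / (-d))) ?_ ?_ ?_
  · exact Complex.isOpen_slitPlane.preimage (by fun_prop)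
  · intro t ht
    rw [mem_ofPred_eq, Complex.mem_slitPlane_iff_not_le_zero]
    intro hle
    obtain ⟨y, hy, hy'⟩ : ∃ y : ℝ, 0 ≤ y ∧ (γ t - w) / (-d) = -(y : ℂ) := by
      rw [Complex.le_def] at hle
      refine ⟨-((γ t - w) / (-d)).re, by simpa using hle.1, ?_⟩
      apply Complex.ext <;> simp
      simpa using hle.2
    refine hray y hy ⟨t, ht, ?_⟩
    rw [div_eq_iff (neg_ne_zero.2 hd)] at hy'
    linear_combination hy'
  · intro z hz
    have hz0 : (z - w) / (-d) ≠ 0 := Complex.slitPlane_ne_zero hz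
    have hzw : z - w ≠ 0 := fun h0 => hz0 (by simp [h0])
    convert ((((hasDerivAt_id z).sub_const w).div_const (-d)).clog hz) using 1
    simp only [id]
    field_simp
    rw [id, div_self hzw]

/-! ### Bounded functionals on continuous functions -/

/-- A linear functional on functions continuous on `S` that is bounded in the supremum norm. -/
structure IsFunctionalOn (S : Set ℂ) (Λ : (ℂ → ℂ) → ℂ) : Prop where
  add : ∀ F G, ContinuousOn F S → ContinuousOn G S → Λ (fun w => F w + G w) = Λ F + Λ G
  smul : ∀ (c : ℂ) F, ContinuousOn F S → Λ (fun w => c * F w) = c * Λ F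
  bound : ∃ C : ℝ, 0 ≤ C ∧ ∀ F, ContinuousOn F S → ∀ M : ℝ, 0 ≤ M → (∀ w ∈ S, ‖F w‖ ≤ M) →
    ‖Λ F‖ ≤ C * M

namespace IsFunctionalOn

variable {S S' : Set ℂ} {Λ Λ' : (ℂ → ℂ) → ℂ}

lemma sub (h : IsFunctionalOn S Λ) {F G : ℂ → ℂ} (hF : ContinuousOn F S) (hG : ContinuousOn G S) :
    Λ (fun w => F w - G w) = Λ F - Λ G := by
  have h1 := h.add F (fun w => (-1) * G w) hF (continuousOn_const.mul hG)
  rw [h.smul _ _ hG] at h1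
  calc Λ (fun w => F w - G w) = Λ (fun w => F w + (-1) * G w) := by congr 1; ext w; ring
    _ = _ := by rw [h1]; ring

/-- The bound with `M = 0`, applied to `F - G`: the functional sees only the values on `S`. -/
lemma congr (h : IsFunctionalOn S Λ) {F G : ℂ → ℂ} (hF : ContinuousOn F S)
    (hFG : ∀ w ∈ S, F w = G w) : Λ F = Λ G := by
  have hG : ContinuousOn G S := hF.congr fun w hw => (hFG w hw).symm
  obtain ⟨C, -, hb⟩ := h.bound
  have := hb (fun w => F w - G w) (hF.sub hG) 0 le_rfl (fun w hw => by simp [hFG w hw])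
  rw [h.sub hF hG, mul_zero, norm_le_zero_iff, sub_eq_zero] at this
  exact this

lemma mul_const (h : IsFunctionalOn S Λ) {F : ℂ → ℂ} (hF : ContinuousOn F S) (c : ℂ) :
    Λ (fun w => F w * c) = Λ F * c := by
  rw [mul_comm, ← h.smul c F hF]; congr 1; ext w; ring

lemma sum (h : IsFunctionalOn S Λ) {ι : Type*} (s : Finset ι) {F : ι → ℂ → ℂ}
    (hF : ∀ i ∈ s, ContinuousOn (F i) S) : Λ (fun w => ∑ i ∈ s, F i w) = ∑ i ∈ s, Λ (F i) := by
  classical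
  induction s using Finset.induction_on with
  | empty => simpa using h.smul 0 (fun _ => 0) continuousOn_const
  | insert a s ha ih =>
    simp only [Finset.sum_insert ha]
    rw [h.add _ _ (hF a (by simp))
      (continuousOn_finsetSum s fun i hi => hF i (Finset.mem_insert_of_mem hi)),
      ih fun i hi => hF i (Finset.mem_insert_of_mem hi)]

lemma mono (h : IsFunctionalOn S Λ) (hS : S ⊆ S') : IsFunctionalOn S' Λ where
  add F G hF hG := h.add F G (hF.mono hS) (hG.mono hS)
  smul c F hF := h.smul c F (hF.mono hS)
  bound := by
    obtain ⟨C, hC, hb⟩ := h.bound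
    exact ⟨C, hC, fun F hF M hM hFM => hb F (hF.mono hS) M hM fun w hw => hFM w (hS hw)⟩

lemma add_functional (h : IsFunctionalOn S Λ) (h' : IsFunctionalOn S Λ') :
    IsFunctionalOn S (fun F => Λ F + Λ' F) where
  add F G hF hG := by rw [h.add F G hF hG, h'.add F G hF hG]; ring
  smul c F hF := by rw [h.smul c F hF, h'.smul c F hF]; ring
  bound := by
    obtain ⟨C, hC, hb⟩ := h.bound
    obtain ⟨C', hC', hb'⟩ := h'.bound
    refine ⟨C + C', by positivity, fun F hF M hM hFM => ?_⟩
    rw [add_mul]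
    exact (norm_add_le _ _).trans (add_le_add (hb F hF M hM hFM) (hb' F hF M hM hFM))

lemma const_mul (h : IsFunctionalOn S Λ) (a : ℂ) : IsFunctionalOn S (fun F => a * Λ F) where
  add F G hF hG := by rw [h.add F G hF hG]; ring
  smul c F hF := by rw [h.smul c F hF]; ring
  bound := by
    obtain ⟨C, hC, hb⟩ := h.bound
    refine ⟨‖a‖ * C, by positivity, fun F hF M hM hFM => ?_⟩
    rw [norm_mul, mul_assoc]
    exact mul_le_mul_of_nonneg_left (hb F hF M hM hFM) (norm_nonneg _)

lemma sub_functional (h : IsFunctionalOn S Λ) (h' : IsFunctionalOn S Λ') :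
    IsFunctionalOn S (fun F => Λ F - Λ' F) := by
  convert h.add_functional (h'.const_mul (-1)) using 2
  ring

lemma mul_weight (h : IsFunctionalOn S Λ) (hS : IsCompact S) {v : ℂ → ℂ} (hv : ContinuousOn v S) :
    IsFunctionalOn S (fun F => Λ (fun w => F w * v w)) where
  add F G hF hG := by
    rw [← h.add _ _ (hF.fun_mul hv) (hG.fun_mul hv)]; congr 1; ext w; ring
  smul c F hF := by
    rw [← h.smul _ _ (hF.fun_mul hv)]; congr 1; ext w; ring
  bound := by
    obtain ⟨C, hC, hb⟩ := h.bound
    obtain ⟨B, hB⟩ := hS.exists_bound_of_continuousOn hv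
    refine ⟨C * |B|, by positivity, fun F hF M hM hFM => ?_⟩
    rw [mul_assoc]
    refine hb _ (hF.fun_mul hv) _ (by positivity) fun w hw => ?_
    rw [norm_mul, mul_comm]
    exact mul_le_mul ((hB w hw).trans (le_abs_self _)) (hFM w hw) (norm_nonneg _) (abs_nonneg _)

/-- Weierstrass M-test: the supremum norm of the remainder is at most the tail of `u`, which the
bound of `Λ` passes on to the values. -/
lemma hasSum (h : IsFunctionalOn S Λ) {F : ℕ → ℂ → ℂ} {G : ℂ → ℂ} {u : ℕ → ℝ}
    (hF : ∀ n, ContinuousOn (F n) S) (hu : Summable u) (hFu : ∀ n, ∀ w ∈ S, ‖F n w‖ ≤ u n)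
    (hG : ∀ w ∈ S, HasSum (fun n => F n w) (G w)) :
    ContinuousOn G S ∧ HasSum (fun n => Λ (F n)) (Λ G) := by
  have hGc : ContinuousOn G S :=
    (continuousOn_tsum hF hu hFu).congr fun w hw => (hG w hw).tsum_eq.symm
  refine ⟨hGc, ?_⟩
  rcases S.eq_empty_or_nonempty with rfl | ⟨w0, hw0⟩
  · have hz : ∀ F : ℂ → ℂ, Λ F = 0 := fun F => by
      rw [h.congr (G := fun w => 0 * F w) (by simp) (by simp), h.smul 0 F (by simp), zero_mul]
    simp only [hz]; exact hasSum_zero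
  have hu0 : ∀ n, 0 ≤ u n := fun n => (norm_nonneg _).trans (hFu n w0 hw0)
  obtain ⟨C, hC, hb⟩ := h.bound
  rw [HasSum, tendsto_iff_norm_sub_tendsto_zero]
  have hlim : Tendsto (fun s : Finset ℕ => C * (∑' n, u n - ∑ n ∈ s, u n)) atTop (𝓝 0) := by
    have := (tendsto_const_nhds (x := ∑' n, u n)).sub hu.hasSum
    simpa using this.const_mul C
  refine squeeze_zero (fun _ => norm_nonneg _) (fun s => ?_) hlim
  rw [← h.sum s fun i _ => hF i, ← h.sub (continuousOn_finsetSum s fun i _ => hF i) hGc]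
  refine hb _ ((continuousOn_finsetSum s fun i _ => hF i).fun_sub hGc) _ ?_ fun w hw => ?_
  · exact sub_nonneg.2 (hu.sum_le_tsum s fun i _ => hu0 i)
  · have h1 : Summable (fun n => ‖F n w‖) := hu.of_nonneg_of_le (fun _ => norm_nonneg _)
      fun n => hFu n w hw
    rw [norm_sub_rev]
    have h2 := (hG w hw).summable.sum_add_tsum_compl (s := s)
    rw [(hG w hw).tsum_eq] at h2
    rw [← h2, add_sub_cancel_left, ← hu.sum_add_tsum_compl (s := s), add_sub_cancel_left]
    exact tsum_of_norm_bounded (hu.subtype _).hasSum fun n => hFu n w hw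

end IsFunctionalOn

/-! ### Contour integrals as functionals -/

lemma intervalIntegrable_contour {γ : ℝ → ℂ} (h : IsClosedLipschitz γ) {F : ℂ → ℂ}
    (hF : ContinuousOn F (γ '' Icc 0 1)) :
    IntervalIntegrable (fun t => F (γ t) * deriv γ t) volume 0 1 := by
  obtain ⟨C, hC⟩ := h.lipschitz
  refine (intervalIntegrable_deriv_of_lipschitzOn zero_le_one hC).continuousOn_mul ?_
  rw [uIcc_of_le zero_le_one]
  exact hF.comp h.continuousOn (mapsTo_image _ _)

lemma IsClosedLipschitz.isFunctionalOn {γ : ℝ → ℂ} (h : IsClosedLipschitz γ) :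
    IsFunctionalOn (γ '' Icc 0 1) (contourInt γ) where
  add F G hF hG := by
    rw [contourInt, contourInt, contourInt, ← intervalIntegral.integral_add
      (intervalIntegrable_contour h hF) (intervalIntegrable_contour h hG)]
    congr 1; ext t; ring
  smul c F hF := by
    rw [contourInt, contourInt, ← intervalIntegral.integral_const_mul]
    congr 1; ext t; ring
  bound := by
    obtain ⟨C, hC⟩ := h.lipschitz
    refine ⟨C, C.2, fun F hF M hM hFM => ?_⟩
    have := intervalIntegral.norm_integral_le_of_norm_le_const_ae (a := (0 : ℝ)) (b := 1)
      (C := C * M) (f := fun t => F (γ t) * deriv γ t) ?_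
    · simpa [contourInt] using this
    filter_upwards [ae_mem_Ioo_of_mem_uIoc zero_le_one] with t h1 h2
    rw [norm_mul, mul_comm]
    exact mul_le_mul (norm_deriv_le_of_lipschitzOn_Icc hC (h1 h2))
      (hFM _ (mem_image_of_mem _ (Ioo_subset_Icc_self (h1 h2)))) (norm_nonneg _) C.2

lemma continuousOn_inv_sub {S : Set ℂ} {s : ℂ} (hs : s ∉ S) :
    ContinuousOn (fun w => (w - s)⁻¹) S :=
  ContinuousOn.inv₀ (by fun_prop) fun w hw h0 => hs (by rw [← sub_eq_zero.1 h0]; exact hw)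

lemma two_pi_I_ne_zero : (2 * Real.pi * Complex.I : ℂ) ≠ 0 := by
  simp [Real.pi_ne_zero]

lemma contourInt_inv_sub (γ : ℝ → ℂ) (w : ℂ) :
    contourInt γ (fun s => (s - w)⁻¹) = 2 * Real.pi * Complex.I * windingNumber γ w := by
  rw [windingNumber, mul_inv_cancel_left₀ two_pi_I_ne_zero]

/-- The winding number is locally constant off the curve. -/
lemma windingNumber_eventually_eq {γ : ℝ → ℂ} (h : IsClosedLipschitz γ) {w : ℂ}
    (hw : w ∉ γ '' Icc 0 1) : ∀ᶠ s in 𝓝 w, s ∉ γ '' Icc 0 1 ∧ windingNumber γ s =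
      windingNumber γ w := by
  have hcl := h.isCompact_image.isClosed
  obtain ⟨ε, hε, hball⟩ := Metric.isOpen_iff.1 hcl.isOpen_compl w hw
  filter_upwards [Metric.ball_mem_nhds w hε] with s hs
  have hsγ : s ∉ γ '' Icc 0 1 := hball hs
  refine ⟨hsγ, ?_⟩
  rw [windingNumber, windingNumber, ← sub_eq_zero, ← mul_sub, ← h.isFunctionalOn.sub
    (continuousOn_inv_sub hsγ) (continuousOn_inv_sub hw), mul_eq_zero]
  right
  -- The difference of the two kernels has the primitive `log ((z - s) / (z - w))`. On the curve the
  -- quotient is within distance one of `1`, since `|s - w| < ε ≤ |γ t - w|`, and so stays off the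
  -- branch cut.
  refine h.contourInt_deriv (U := {z | z ≠ w ∧ z ≠ s ∧ (z - s) / (z - w) ∈ Complex.slitPlane})
    (F := fun z => Complex.log ((z - s) / (z - w))) ?_ ?_ ?_
  · rw [isOpen_iff_mem_nhds]
    rintro z ⟨h1, h2, h3⟩
    filter_upwards [isOpen_ne.mem_nhds h1, isOpen_ne.mem_nhds h2,
      (ContinuousAt.div (f := fun z => z - s) (g := fun z => z - w) (by fun_prop) (by fun_prop)
        (sub_ne_zero.2 h1)) (Complex.isOpen_slitPlane.mem_nhds h3)] with y hy1 hy2 hy3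
    exact ⟨hy1, hy2, hy3⟩
  · intro t ht
    have h1 : γ t ≠ w := fun h0 => hw ⟨t, ht, h0⟩
    have h2 : γ t ≠ s := fun h0 => hsγ ⟨t, ht, h0⟩
    refine ⟨h1, h2, ?_⟩
    have h1' : γ t - w ≠ 0 := sub_ne_zero.2 h1
    have h3 : ε ≤ ‖γ t - w‖ := by
      by_contra! hlt
      exact hball (by simpa [dist_eq_norm] using hlt) ⟨t, ht, rfl⟩
    have h4 : (γ t - s) / (γ t - w) = 1 + (w - s) / (γ t - w) := by field_simp; ring
    rw [h4]
    apply Complex.mem_slitPlane_of_norm_lt_one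
    rw [norm_div, div_lt_one (by positivity)]
    rw [Metric.mem_ball, dist_comm, dist_eq_norm] at hs
    linarith
  · rintro z ⟨h1, h2, h3⟩
    have h1' : z - w ≠ 0 := sub_ne_zero.2 h1
    have h2' : z - s ≠ 0 := sub_ne_zero.2 h2
    have := ((((hasDerivAt_id' z).sub_const s).fun_div ((hasDerivAt_id' z).sub_const w) h1').clog h3)
    convert this using 1
    field_simp

lemma exists_norm_bound_image {γ : ℝ → ℂ} (h : IsClosedLipschitz γ) :
    ∃ ρ : ℝ, 0 < ρ ∧ ∀ w ∈ γ '' Icc 0 1, ‖w‖ ≤ ρ := by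
  obtain ⟨ρ, hρ⟩ := h.isCompact_image.isBounded.exists_norm_le
  exact ⟨|ρ| + 1, by positivity, fun w hw => (hρ w hw).trans (by linarith [le_abs_self ρ])⟩

/-- The ray from `s` pointing away from the origin leaves the disc that contains the curve. -/
lemma windingNumber_eq_zero_of_norm_lt {γ : ℝ → ℂ} (h : IsClosedLipschitz γ) {ρ : ℝ}
    (hρ : ∀ w ∈ γ '' Icc 0 1, ‖w‖ ≤ ρ) {s : ℂ} (hs : ρ < ‖s‖) : windingNumber γ s = 0 := by
  have h01 : γ 0 ∈ γ '' Icc 0 1 := mem_image_of_mem _ (by simp)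
  have hρ0 : 0 ≤ ρ := (norm_nonneg _).trans (hρ _ h01)
  have hs0 : s ≠ 0 := by rintro rfl; simp at hs; linarith
  refine windingNumber_eq_zero_of_ray h hs0 fun x hx hmem => ?_
  have h1 := hρ _ hmem
  have h2 : s + x * s = ((1 + x : ℝ) : ℂ) * s := by push_cast; ring
  rw [h2, norm_mul, Complex.norm_real, Real.norm_of_nonneg (by linarith)] at h1
  nlinarith [norm_nonneg s]

/-! ### Holomorphic dependence on a parameter -/

/-- The second order Taylor estimate for a bounded holomorphic function on a disc. -/
lemma norm_sub_sub_deriv_mul_le {φ : ℂ → ℂ} {c z : ℂ} {R M : ℝ} (hM : 0 < M)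
    (hφ : DifferentiableOn ℂ φ (Metric.ball c R)) (hb : ∀ w ∈ Metric.ball c R, ‖φ w‖ ≤ M)
    (hz : z ∈ Metric.ball c R) :
    ‖φ z - φ c - deriv φ c * (z - c)‖ ≤ 12 * M / R ^ 2 * ‖z - c‖ ^ 2 := by
  have hR : 0 < R := Metric.pos_of_mem_ball hz
  have hc : c ∈ Metric.ball c R := Metric.mem_ball_self hR
  have hnhds : Metric.ball c R ∈ 𝓝 c := Metric.ball_mem_nhds c hR
  -- The Schwarz lemma is applied twice, to `φ` and then to its difference quotient `dslope φ c`.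
  -- The constants `3` and `12` are generous: `2` and `6` are what the triangle inequality gives.
  have hmaps : MapsTo φ (Metric.ball c R) (Metric.ball (φ c) (3 * M)) := by
    intro w hw
    rw [Metric.mem_ball, dist_eq_norm]
    have := norm_sub_le (φ w) (φ c)
    linarith [hb w hw, hb c hc]
  have h1 : ∀ w ∈ Metric.ball c R, ‖dslope φ c w‖ ≤ 3 * M / R := fun w hw =>
    Complex.norm_dslope_le_div_of_mapsTo_ball hφ (hmaps.mono_right Metric.ball_subset_closedBall) hw
  have hd : DifferentiableOn ℂ (dslope φ c) (Metric.ball c R) :=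
    (Complex.differentiableOn_dslope hnhds).2 hφ
  have hmaps2 : MapsTo (dslope φ c) (Metric.ball c R)
      (Metric.closedBall (dslope φ c c) (12 * M / R)) := by
    intro w hw
    rw [Metric.mem_closedBall, dist_eq_norm]
    have h3 := norm_sub_le (dslope φ c w) (dslope φ c c)
    have h4 : 12 * M / R = 2 * (3 * M / R) + 2 * (3 * M / R) := by ring
    have h5 : 0 ≤ 3 * M / R := by positivity
    linarith [h1 w hw, h1 c hc]
  have h2 := Complex.norm_dslope_le_div_of_mapsTo_ball hd hmaps2 hz
  have e1 : φ z - φ c = (z - c) * dslope φ c z := by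
    have := sub_smul_dslope φ c z
    simpa using this.symm
  have e2 : dslope φ c z - dslope φ c c = (z - c) * dslope (dslope φ c) c z := by
    have := sub_smul_dslope (dslope φ c) c z
    simpa using this.symm
  have e3 : φ z - φ c - deriv φ c * (z - c) = (z - c) ^ 2 * dslope (dslope φ c) c z := by
    rw [← dslope_same φ c, e1]
    linear_combination (z - c) * e2
  rw [e3, norm_mul, norm_pow, mul_comm]
  refine mul_le_mul_of_nonneg_right (h2.trans_eq ?_) (by positivity)
  field_simp

/-- A functional applied to a family that depends holomorphically on a parameter and is locally
bounded is holomorphic in the parameter. -/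
lemma IsFunctionalOn.hasDerivAt {S : Set ℂ} {Λ : (ℂ → ℂ) → ℂ} (h : IsFunctionalOn S Λ)
    {Φ : ℂ → ℂ → ℂ} {c : ℂ} {R M : ℝ} (hR : 0 < R)
    (hcont : ∀ s ∈ Metric.ball c R, ContinuousOn (Φ s) S)
    (hdiff : ∀ w ∈ S, DifferentiableOn ℂ (fun s => Φ s w) (Metric.ball c R))
    (hb : ∀ s ∈ Metric.ball c R, ∀ w ∈ S, ‖Φ s w‖ ≤ M) :
    HasDerivAt (fun s => Λ (Φ s)) (Λ fun w => deriv (fun s => Φ s w) c) c := by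
  wlog hM : 0 < M generalizing M
  · exact this (M := |M| + 1) (fun s hs w hw => (hb s hs w hw).trans
      (by linarith [le_abs_self M])) (by positivity)
  set φ' : ℂ → ℂ := fun w => deriv (fun s => Φ s w) c with hφ'
  set K : ℝ := 12 * M / R ^ 2 with hK
  have hK0 : 0 < K := by positivity
  have hc : c ∈ Metric.ball c R := Metric.mem_ball_self hR
  have hest : ∀ s ∈ Metric.ball c R, ∀ w ∈ S,
      ‖Φ s w - Φ c w - φ' w * (s - c)‖ ≤ K * ‖s - c‖ ^ 2 := fun s hs w hw =>
    norm_sub_sub_deriv_mul_le hM (hdiff w hw) (fun z hz => hb z hz w hw) hs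
  -- By the Taylor estimate the difference quotients with step `η` converge to `φ'` uniformly on
  -- `S`, with error at most `K * η`.
  have hφ'c : ContinuousOn φ' S := by
    refine continuousOn_of_uniform_approx_of_continuousOn fun u hu => ?_
    obtain ⟨ε, hε, hεu⟩ := Metric.mem_uniformity_dist.1 hu
    obtain ⟨η, hη0, hηR, hηε⟩ : ∃ η : ℝ, 0 < η ∧ η < R ∧ K * η < ε := by
      refine ⟨min (R / 2) (ε / (2 * K)), by positivity, ?_, ?_⟩
      · exact (min_le_left _ _).trans_lt (by linarith)
      · calc K * min (R / 2) (ε / (2 * K)) ≤ K * (ε / (2 * K)) := by gcongr; exact min_le_right _ _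
          _ = ε / 2 := by field_simp
          _ < ε := by linarith
    have hmem : c + η ∈ Metric.ball c R := by
      simpa [dist_eq_norm, abs_of_pos hη0] using hηR
    have hη : (η : ℂ) ≠ 0 := by exact_mod_cast hη0.ne'
    refine ⟨fun w => (Φ (c + η) w - Φ c w) / η,
      ((hcont _ hmem).sub (hcont c hc)).div_const _, fun w hw => hεu ?_⟩
    have h1 := hest _ hmem w hw
    have h2 : Φ (c + η) w - Φ c w - φ' w * (c + η - c) =
        -(η * (φ' w - (Φ (c + η) w - Φ c w) / η)) := by field_simp; ring
    rw [h2, norm_neg, norm_mul, add_sub_cancel_left, Complex.norm_real, Real.norm_of_nonneg hη0.le]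
      at h1
    rw [dist_eq_norm]
    have h3 : ‖φ' w - (Φ (c + η) w - Φ c w) / η‖ ≤ K * η := by
      by_contra! hlt
      nlinarith
    exact h3.trans_lt hηε
  obtain ⟨C, hC, hbd⟩ := h.bound
  change HasDerivAt (fun s => Λ (Φ s)) (Λ φ') c
  rw [hasDerivAt_iff_isLittleO]
  -- The Taylor remainder is quadratic uniformly in `w`, so the supremum bound of `Λ` preserves the
  -- rate.
  have hO : (fun s => Λ (Φ s) - Λ (Φ c) - (s - c) • Λ φ') =O[𝓝 c] fun s => ‖s - c‖ ^ 2 := by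
    refine Asymptotics.IsBigO.of_bound (C * K) ?_
    filter_upwards [Metric.ball_mem_nhds c hR] with s hs
    have e : Λ (Φ s) - Λ (Φ c) - (s - c) • Λ φ' =
        Λ (fun w => Φ s w - Φ c w - φ' w * (s - c)) := by
      rw [h.sub (F := fun w => Φ s w - Φ c w) ((hcont s hs).sub (hcont c hc))
        (hφ'c.fun_mul continuousOn_const), h.mul_const hφ'c, h.sub (hcont s hs) (hcont c hc),
        smul_eq_mul, mul_comm (s - c)]
    rw [e, mul_assoc]
    refine (hbd _ (((hcont s hs).sub (hcont c hc)).sub (hφ'c.mul continuousOn_const)) _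
      (by positivity) (hest s hs)).trans_eq ?_
    simp
  refine hO.trans_isLittleO ?_
  have : (fun s : ℂ => ‖s - c‖ ^ 2) =o[𝓝 c] fun s => ‖s - c‖ ^ 1 :=
    Asymptotics.isLittleO_norm_pow_norm_pow (by norm_num) |>.comp_tendsto
      (k := fun s : ℂ => s - c) (by
        have : Tendsto (fun s : ℂ => s - c) (𝓝 c) (𝓝 (c - c)) := by
          exact (continuous_id.sub continuous_const).tendsto c
        simpa using this)
  simpa using this.trans_isBigO (Asymptotics.isBigO_of_le _ (fun s => by simp))

/-- The Cauchy transform of a functional is holomorphic off its support. -/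
lemma IsFunctionalOn.differentiableAt_cauchy {S : Set ℂ} {Λ : (ℂ → ℂ) → ℂ}
    (h : IsFunctionalOn S Λ) (hS : IsClosed S) {c : ℂ} (hc : c ∉ S) :
    DifferentiableAt ℂ (fun s => Λ (fun w => (s - w)⁻¹)) c := by
  obtain ⟨ε, hε, hball⟩ := Metric.isOpen_iff.1 hS.isOpen_compl c hc
  have hsub : ∀ s ∈ Metric.ball c (ε / 2), ∀ w ∈ S, ε / 2 ≤ ‖s - w‖ := by
    intro s hs w hw
    have h1 : ε ≤ dist w c := by
      by_contra! hlt; exact hball hlt hw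
    have h2 := dist_triangle w s c
    rw [Metric.mem_ball] at hs
    rw [← dist_eq_norm, dist_comm]; linarith
  have hne : ∀ s ∈ Metric.ball c (ε / 2), ∀ w ∈ S, s - w ≠ 0 := fun s hs w hw h0 => by
    have := hsub s hs w hw; rw [h0, norm_zero] at this; linarith
  refine (h.hasDerivAt (R := ε / 2) (M := (ε / 2)⁻¹) (by positivity) ?_ ?_ ?_).differentiableAt
  · exact fun s hs => ContinuousOn.inv₀ (by fun_prop) (hne s hs)
  · exact fun w hw => DifferentiableOn.inv (by fun_prop) (fun s hs => hne s hs w hw)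
  · intro s hs w hw
    rw [norm_inv]
    exact inv_anti₀ (by positivity) (hsub s hs w hw)

/-! ### The global Cauchy formula -/

lemma dslope_comm_eq (F : ℂ → ℂ) (z w : ℂ) : dslope F z w = dslope F w z := by
  rcases eq_or_ne z w with rfl | hne
  · rfl
  · rw [dslope_of_ne _ hne.symm, dslope_of_ne _ hne, slope_comm]

/-- `dslope F s w` is symmetric in its two arguments, hence holomorphic in `s`. It remains to bound
it for `s` near `c`, uniformly along the curve. -/
lemma differentiable_contour_dslope {γ : ℝ → ℂ} (h : IsClosedLipschitz γ) {U : Set ℂ}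
    (hU : IsOpen U) (hγU : MapsTo γ (Icc 0 1) U) {F : ℂ → ℂ} (hF : DifferentiableOn ℂ F U)
    {c : ℂ} (hc : c ∈ U) : DifferentiableAt ℂ (fun s => contourInt γ (dslope F s)) c := by
  have hSU : γ '' Icc 0 1 ⊆ U := hγU.image_subset
  obtain ⟨ε, hε, hball⟩ := Metric.isOpen_iff.1 hU c hc
  set B := Metric.closedBall c (ε / 2) with hB
  have hBU : B ⊆ U := (Metric.closedBall_subset_ball (by linarith)).trans hball
  have hBc : IsCompact B := isCompact_closedBall _ _
  obtain ⟨M₁, hM₁⟩ := (hBc.union h.isCompact_image).exists_bound_of_continuousOn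
    (hF.continuousOn.mono (union_subset hBU hSU))
  obtain ⟨M₂, hM₂⟩ := hBc.exists_bound_of_continuousOn ((hF.deriv hU).continuousOn.mono hBU)
  have hsB : ∀ s ∈ Metric.ball c (ε / 4), s ∈ B := fun s hs =>
    Metric.closedBall_subset_closedBall (by linarith) (Metric.ball_subset_closedBall hs)
  -- For `w` in the disc `B` the mean value inequality bounds the quotient by `M₂`. For other `w`
  -- the denominator is at least `ε / 4` and the numerator at most `2 * M₁`, which gives `8 * M₁ /
  -- ε`.
  refine (h.isFunctionalOn.hasDerivAt (R := ε / 4) (M := max (8 * M₁ / ε) M₂)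
    (by positivity) ?_ ?_ ?_).differentiableAt
  · intro s hs
    have hsU := hBU (hsB s hs)
    exact ((continuousOn_dslope (hU.mem_nhds hsU)).2 ⟨hF.continuousOn,
      hF.differentiableAt (hU.mem_nhds hsU)⟩).mono hSU
  · intro w hw
    simp only [fun s => dslope_comm_eq F s w]
    exact ((Complex.differentiableOn_dslope (hU.mem_nhds (hSU hw))).2 hF).mono
      fun s hs => hBU (hsB s hs)
  · intro s hs w hw
    rcases eq_or_ne w s with rfl | hne
    · rw [dslope_same]
      exact (hM₂ _ (hsB w hs)).trans (le_max_right _ _)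
    have hns : 0 < ‖w - s‖ := norm_pos_iff.2 (sub_ne_zero.2 hne)
    rw [dslope_of_ne _ hne, slope_def_field, norm_div, div_le_iff₀ hns]
    by_cases hwB : w ∈ B
    · refine ((convex_closedBall c (ε / 2)).norm_image_sub_le_of_norm_deriv_le
        (fun x hx => hF.differentiableAt (hU.mem_nhds (hBU hx))) hM₂ (hsB s hs) hwB).trans ?_
      exact mul_le_mul_of_nonneg_right (le_max_right _ _) hns.le
    · have h1 : ε / 4 ≤ ‖w - s‖ := by
        rw [hB, Metric.mem_closedBall, not_le] at hwB
        rw [Metric.mem_ball] at hs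
        have := dist_triangle w s c
        rw [← dist_eq_norm]; linarith
      have hM : 0 ≤ M₁ := (norm_nonneg _).trans (hM₁ w (Or.inr hw))
      have h2 := norm_sub_le (F w) (F s)
      have h3 := hM₁ w (Or.inr hw)
      have h4 := hM₁ s (Or.inl (hsB s hs))
      calc ‖F w - F s‖ ≤ 8 * M₁ / ε * (ε / 4) := by field_simp; linarith
        _ ≤ max (8 * M₁ / ε) M₂ * ‖w - s‖ := by
          gcongr
          exact le_max_left _ _

lemma contourInt_dslope {γ : ℝ → ℂ} (h : IsClosedLipschitz γ) {F : ℂ → ℂ}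
    (hF : ContinuousOn F (γ '' Icc 0 1)) {s : ℂ} (hs : s ∉ γ '' Icc 0 1) :
    contourInt γ (dslope F s) = contourInt γ (fun w => F w * (w - s)⁻¹) -
      2 * Real.pi * Complex.I * windingNumber γ s * F s := by
  have hinv := continuousOn_inv_sub hs
  rw [← contourInt_inv_sub, ← h.isFunctionalOn.mul_const hinv,
    ← h.isFunctionalOn.sub (hF.fun_mul hinv) (hinv.fun_mul continuousOn_const)]
  refine contourInt_congr fun w hw => ?_
  have hne : w ≠ s := fun h0 => hs (h0 ▸ hw)
  rw [dslope_of_ne _ hne, slope_def_field]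
  ring

/-- The global Cauchy integral formula, by Dixon's argument. The curve winds `ν` times around
every point outside `U`; if `ν ≠ 0` the function has to vanish at infinity. -/
theorem cauchy_integral_formula {γ : ℝ → ℂ} (h : IsClosedLipschitz γ) {U : Set ℂ}
    (hU : IsOpen U) (hγU : MapsTo γ (Icc 0 1) U) {F : ℂ → ℂ} (hF : DifferentiableOn ℂ F U) {ν : ℂ}
    (hn : ∀ w ∉ U, windingNumber γ w = ν)
    (hν : Tendsto (fun s => ν * F s) (cocompact ℂ) (𝓝 0)) {s : ℂ} (hsU : s ∈ U)
    (hs : s ∉ γ '' Icc 0 1) :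
    contourInt γ (fun w => F w * (w - s)⁻¹) =
      2 * Real.pi * Complex.I * ((windingNumber γ s - ν) * F s) := by
  classical
  have hSU : γ '' Icc 0 1 ⊆ U := hγU.image_subset
  have hFc : ContinuousOn F (γ '' Icc 0 1) := hF.continuousOn.mono hSU
  have hweight := h.isFunctionalOn.mul_weight h.isCompact_image hFc
  have hcau : ∀ c ∉ γ '' Icc 0 1,
      DifferentiableAt ℂ (fun z => contourInt γ (fun w => F w * (w - z)⁻¹)) c := by
    intro c hc
    have := (hweight.differentiableAt_cauchy h.isCompact_image.isClosed hc).neg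
    refine this.congr_of_eventuallyEq ?_
    filter_upwards [windingNumber_eventually_eq h hc] with z hz
    have hzc : ContinuousOn (fun w => (z - w)⁻¹ * F w) (γ '' Icc 0 1) :=
      ((continuousOn_inv_sub hz.1).neg.congr (fun w _ => by
        rw [Pi.neg_apply, ← inv_neg, neg_sub])).mul hFc
    change _ = -contourInt γ (fun w => (z - w)⁻¹ * F w)
    rw [← neg_one_mul, ← h.isFunctionalOn.smul _ _ hzc]
    congr 1; ext w
    rw [← neg_sub z w, inv_neg]; ring
  -- Dixon's function. Near a point outside `U` the winding number is constantly `ν`, so there the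
  -- first formula reduces to the second and the two pieces glue to an entire function. By Liouville
  -- it vanishes once it tends to zero at infinity.
  set X : ℂ → ℂ := fun z => if z ∈ U then
    contourInt γ (dslope F z) + 2 * Real.pi * Complex.I * ν * F z else
    contourInt γ (fun w => F w * (w - z)⁻¹) with hX
  have hXd : Differentiable ℂ X := by
    intro c
    by_cases hc : c ∈ U
    · have h1 : DifferentiableAt ℂ (fun z => contourInt γ (dslope F z) +
          2 * Real.pi * Complex.I * ν * F z) c :=
        (differentiable_contour_dslope h hU hγU hF hc).add
          ((hF.differentiableAt (hU.mem_nhds hc)).const_mul _)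
      refine h1.congr_of_eventuallyEq ?_
      filter_upwards [hU.mem_nhds hc] with z hz
      rw [hX]; simp only [hz, if_true]
    · have hcS : c ∉ γ '' Icc 0 1 := fun hcS => hc (hSU hcS)
      refine (hcau c hcS).congr_of_eventuallyEq ?_
      filter_upwards [windingNumber_eventually_eq h hcS] with z hz
      rw [hX]
      dsimp only
      split_ifs with hzU
      · rw [contourInt_dslope h hFc hz.1, hz.2, hn c hc]; ring
      · rfl
  obtain ⟨ρ, hρ0, hρ⟩ := exists_norm_bound_image h
  have hfar : ∀ z : ℂ, ρ < ‖z‖ → z ∉ γ '' Icc 0 1 := fun z hz hzS => (hρ z hzS).not_gt hz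
  have hlim0 : Tendsto (fun z => contourInt γ (fun w => F w * (w - z)⁻¹)) (cocompact ℂ) (𝓝 0) := by
    obtain ⟨C, hC, hb⟩ := h.isFunctionalOn.bound
    obtain ⟨M, hM⟩ := h.isCompact_image.exists_bound_of_continuousOn hFc
    have hl : Tendsto (fun z : ℂ => C * (|M| * (‖z‖ - ρ)⁻¹)) (cocompact ℂ) (𝓝 0) := by
      have h1 : Tendsto (fun z : ℂ => ‖z‖ - ρ) (cocompact ℂ) atTop :=
        tendsto_atTop_add_const_right _ _ tendsto_norm_cocompact_atTop
      simpa using (h1.inv_tendsto_atTop.const_mul |M|).const_mul C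
    refine squeeze_zero_norm' ?_ hl
    filter_upwards [tendsto_norm_cocompact_atTop.eventually (eventually_gt_atTop ρ)] with z hz
    have hpos : 0 < ‖z‖ - ρ := by linarith
    refine hb _ (hFc.fun_mul (continuousOn_inv_sub (hfar z hz))) _ (by positivity) fun w hw => ?_
    rw [norm_mul, norm_inv]
    have h2 : ‖z‖ - ρ ≤ ‖w - z‖ := by
      have := norm_sub_norm_le z w
      rw [norm_sub_rev]; linarith [hρ w hw]
    gcongr
    exact (hM w hw).trans (le_abs_self M)
  -- Far out the winding number is zero, so the first formula is the Cauchy integral plus `2πi ν F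
  -- z`. A far point outside `U` forces `ν = 0`, so the same expression is valid there.
  have hXlim : Tendsto X (cocompact ℂ) (𝓝 0) := by
    have hsum := hlim0.add (hν.const_mul (2 * Real.pi * Complex.I))
    rw [mul_zero, add_zero] at hsum
    refine hsum.congr' ?_
    filter_upwards [tendsto_norm_cocompact_atTop.eventually (eventually_gt_atTop ρ)] with z hz
    have hn0 := windingNumber_eq_zero_of_norm_lt h hρ hz
    rw [hX]
    dsimp only
    split_ifs with hzU
    · rw [contourInt_dslope h hFc (hfar z hz), hn0]; ring
    · have : ν = 0 := by rw [← hn z hzU, hn0]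
      rw [this]; ring
  have hX0 := hXd.apply_eq_of_tendsto_cocompact s hXlim
  rw [hX] at hX0
  simp only [hsU, if_true] at hX0
  rw [contourInt_dslope h hFc hs] at hX0
  linear_combination hX0

/-! ### Expansions at infinity and growth of Taylor coefficients -/

/-- The series converges absolutely at one real point `x`; for `|z| > x` its terms are at most those
at `x` times `x / |z|`. -/
lemma tendsto_cocompact_zero_of_hasSum {c : ℕ → ℂ} {B : ℂ → ℂ} {ρ : ℝ}
    (h : ∀ z : ℂ, ρ < ‖z‖ → HasSum (fun n : ℕ => c n / z ^ (n + 1)) (B z)) :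
    Tendsto B (cocompact ℂ) (𝓝 0) := by
  set x : ℝ := |ρ| + 1 with hx
  have hx0 : 0 < x := by positivity
  have hs : Summable (fun n : ℕ => ‖c n‖ / x ^ (n + 1)) := by
    have h1 := (h (x : ℂ) (by
      rw [Complex.norm_real, Real.norm_of_nonneg hx0.le]; linarith [le_abs_self ρ])).summable.norm
    simpa [abs_of_pos hx0] using h1
  have hl : Tendsto (fun z : ℂ => (∑' n : ℕ, ‖c n‖ / x ^ (n + 1)) * (x * ‖z‖⁻¹)) (cocompact ℂ)
      (𝓝 0) := by
    have h1 : Tendsto (fun z : ℂ => ‖z‖⁻¹) (cocompact ℂ) (𝓝 0) :=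
      tendsto_inv_atTop_zero.comp tendsto_norm_cocompact_atTop
    simpa using (h1.const_mul x).const_mul (∑' n : ℕ, ‖c n‖ / x ^ (n + 1))
  refine squeeze_zero_norm' ?_ hl
  filter_upwards [tendsto_norm_cocompact_atTop.eventually (eventually_gt_atTop x)] with z hz
  have hz0 : 0 < ‖z‖ := hx0.trans hz
  rw [← (h z (by linarith [le_abs_self ρ])).tsum_eq]
  refine tsum_of_norm_bounded (hs.hasSum.mul_right _) fun n => ?_
  rw [norm_div, norm_pow, div_mul_eq_mul_div, div_le_div_iff₀ (by positivity) (by positivity),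
    pow_succ, pow_succ]
  have h2 : x ^ n ≤ ‖z‖ ^ n := pow_le_pow_left₀ hx0.le hz.le n
  calc ‖c n‖ * (x ^ n * x) ≤ ‖c n‖ * (‖z‖ ^ n * x) := by gcongr
    _ = ‖c n‖ * (x * ‖z‖⁻¹) * (‖z‖ ^ n * ‖z‖) := by field_simp

/-- Multiplying by `z` and moving the constant term across gives a series of the same kind with sum
`-c 0`. Such a sum tends to zero at infinity, so `c 0 = 0`; then induct on the shifted coefficients.
Passing to `max ρ 0` keeps `z ≠ 0`. -/
lemma coeff_eq_zero_of_hasSum_zero (n : ℕ) : ∀ (ρ : ℝ) (c : ℕ → ℂ),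
    (∀ z : ℂ, ρ < ‖z‖ → HasSum (fun n : ℕ => c n / z ^ (n + 1)) 0) → c n = 0 := by
  have key : ∀ (ρ : ℝ) (c : ℕ → ℂ),
      (∀ z : ℂ, ρ < ‖z‖ → HasSum (fun n : ℕ => c n / z ^ (n + 1)) 0) →
      (∀ z : ℂ, max ρ 0 < ‖z‖ → HasSum (fun n : ℕ => c (n + 1) / z ^ (n + 1)) (-c 0)) := by
    intro ρ c hc z hz
    have hz0 : z ≠ 0 := norm_pos_iff.1 ((le_max_right _ _).trans_lt hz)
    have h1 := (hc z ((le_max_left _ _).trans_lt hz)).mul_left z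
    have h2 : HasSum (fun n : ℕ => c n / z ^ n) 0 := by
      rw [mul_zero] at h1
      refine h1.congr_fun fun n => ?_
      rw [pow_succ]; field_simp
    rw [hasSum_nat_add_iff (f := fun n : ℕ => c n / z ^ n) 1]
    simpa using h2
  have hzero : ∀ (ρ : ℝ) (c : ℕ → ℂ),
      (∀ z : ℂ, ρ < ‖z‖ → HasSum (fun n : ℕ => c n / z ^ (n + 1)) 0) → c 0 = 0 := by
    intro ρ c hc
    have h1 := tendsto_cocompact_zero_of_hasSum (key ρ c hc)
    simpa using tendsto_nhds_unique tendsto_const_nhds h1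
  induction n with
  | zero => exact hzero
  | succ n ih =>
    intro ρ c hc
    refine ih (max ρ 0) (fun n => c (n + 1)) fun z hz => ?_
    simpa [hzero ρ c hc] using key ρ c hc z hz

/-- A weak Stirling bound, since `Stirling.stirlingSeq` decreases from its value at `1`; the factor
`√(n + 1)` is weakened to `n + 1`. -/
lemma factorial_succ_le (n : ℕ) :
    ((n + 1).factorial : ℝ) ≤ Real.exp 1 * (n + 1) * ((n + 1) / Real.exp 1) ^ (n + 1) := by
  have h := Stirling.stirlingSeq'_antitone (Nat.zero_le n)
  simp only [Function.comp, Nat.succ_eq_add_one, zero_add, Stirling.stirlingSeq_one] at h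
  rw [Stirling.stirlingSeq, div_le_iff₀ (by positivity)] at h
  push_cast at h
  refine h.trans (le_of_eq_of_le (b := Real.exp 1 * Real.sqrt (n + 1) *
    ((n + 1) / Real.exp 1) ^ (n + 1)) ?_ ?_)
  · rw [Real.sqrt_mul (by norm_num)]
    field_simp
  · gcongr
    rw [Real.sqrt_le_left (by positivity)]
    nlinarith [(Nat.cast_nonneg n : (0 : ℝ) ≤ n)]

lemma coeff_eq_of_hasSum {a b : ℕ → ℂ} {B : ℂ → ℂ} {ρ : ℝ}
    (ha : ∀ z : ℂ, ρ < ‖z‖ → HasSum (fun n : ℕ => a n / z ^ (n + 1)) (B z))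
    (hb : ∀ z : ℂ, ρ < ‖z‖ → HasSum (fun n : ℕ => b n / z ^ (n + 1)) (B z)) (n : ℕ) :
    a n = b n := by
  rw [← sub_eq_zero]
  refine coeff_eq_zero_of_hasSum_zero n ρ (fun n => a n - b n) fun z hz => ?_
  simpa [sub_div] using (ha z hz).sub (hb z hz)

/-! ### Functionals on exponentials and on the Cauchy kernel -/

namespace IsFunctionalOn

variable {S : Set ℂ} {Λ : (ℂ → ℂ) → ℂ} {ρ : ℝ}

/-- The geometric series, integrated term by term. Together with `iteratedDeriv_exp_zero` it
identifies the Borel transform of `z ↦ Λ (e^{wz})`. -/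
lemma hasSum_cauchy (h : IsFunctionalOn S Λ) (hS : ∀ w ∈ S, ‖w‖ ≤ ρ) {z : ℂ} (hz : ρ < ‖z‖) :
    HasSum (fun n : ℕ => Λ (fun w => w ^ n) / z ^ (n + 1)) (Λ fun w => (z - w)⁻¹) := by
  rcases S.eq_empty_or_nonempty with rfl | ⟨w0, hw0⟩
  · have hz : ∀ F : ℂ → ℂ, Λ F = 0 := fun F => by
      rw [h.congr (G := fun w => 0 * F w) (by simp) (by simp), h.smul 0 F (by simp), zero_mul]
    simp only [hz, zero_div]; exact hasSum_zero
  have hρ0 : 0 ≤ ρ := (norm_nonneg _).trans (hS w0 hw0)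
  have hz0 : 0 < ‖z‖ := hρ0.trans_lt hz
  have hz' : z ≠ 0 := norm_pos_iff.1 hz0
  have hr : ρ / ‖z‖ < 1 := (div_lt_one hz0).2 hz
  have := (h.hasSum (F := fun n w => w ^ n * (z ^ (n + 1))⁻¹) (G := fun w => (z - w)⁻¹)
    (u := fun n => (ρ / ‖z‖) ^ n * ‖z‖⁻¹) (fun n => by fun_prop)
    ((summable_geometric_of_lt_one (by positivity) hr).mul_right _) ?_ ?_).2
  · refine this.congr_fun fun n => ?_
    rw [div_eq_mul_inv, h.mul_const (by fun_prop)]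
  · intro n w hw
    rw [norm_mul, norm_inv, norm_pow, norm_pow, pow_succ, mul_inv, div_pow, div_eq_mul_inv,
      mul_assoc]
    gcongr
    exact hS w hw
  · intro w hw
    have h1 : ‖w / z‖ < 1 := by
      rw [norm_div, div_lt_one hz0]; exact (hS w hw).trans_lt hz
    have h2 := (hasSum_geometric_of_norm_lt_one h1).mul_right z⁻¹
    have h3 : (z - w)⁻¹ = (1 - w / z)⁻¹ * z⁻¹ := by
      rw [← mul_inv]; congr 1; field_simp
    simp only [h3]
    refine h2.congr_fun fun n => ?_
    rw [div_pow, pow_succ, mul_inv]; ring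

lemma hasDerivAt_exp (h : IsFunctionalOn S Λ) (hS : ∀ w ∈ S, ‖w‖ ≤ ρ) {v : ℂ → ℂ}
    (hv : ContinuousOn v S) (hSc : IsCompact S) (z : ℂ) :
    HasDerivAt (fun z => Λ fun w => v w * Complex.exp (w * z))
      (Λ fun w => v w * w * Complex.exp (w * z)) z := by
  obtain ⟨M, hM⟩ := hSc.exists_bound_of_continuousOn hv
  have h1 := h.hasDerivAt (Φ := fun z w => v w * Complex.exp (w * z)) (c := z) (R := 1)
    (M := |M| * Real.exp (|ρ| * (‖z‖ + 1))) one_pos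
    (fun s _ => hv.fun_mul (by fun_prop)) (fun w _ => by fun_prop) ?_
  · convert h1 using 2
    ext w
    have h2 : HasDerivAt (fun z => v w * Complex.exp (w * z))
        (v w * (Complex.exp (w * z) * (w * 1))) z :=
      (((hasDerivAt_id' z).const_mul w).cexp).const_mul _
    rw [h2.deriv]; ring
  · intro s hs w hw
    rw [norm_mul]
    have h3 : ‖s‖ ≤ ‖z‖ + 1 := by
      rw [Metric.mem_ball, dist_eq_norm] at hs
      have := norm_sub_norm_le s z
      linarith
    have h4 : ‖w * s‖ ≤ |ρ| * (‖z‖ + 1) := by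
      rw [norm_mul]
      gcongr
      exact (hS w hw).trans (le_abs_self _)
    gcongr
    · exact (hM w hw).trans (le_abs_self _)
    · exact (Complex.norm_exp_le_exp_norm _).trans (Real.exp_le_exp.2 h4)

lemma iteratedDeriv_exp (h : IsFunctionalOn S Λ) (hSc : IsCompact S) (n : ℕ) :
    iteratedDeriv n (fun z => Λ fun w => Complex.exp (w * z)) =
      fun z => Λ fun w => w ^ n * Complex.exp (w * z) := by
  obtain ⟨ρ, hρ⟩ := hSc.isBounded.exists_norm_le
  induction n with
  | zero => simp
  | succ n ih =>
    rw [iteratedDeriv_succ, ih]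
    ext z
    rw [(h.hasDerivAt_exp hρ (v := fun w => w ^ n) (by fun_prop) hSc z).deriv]
    simp only [pow_succ]

lemma iteratedDeriv_exp_zero (h : IsFunctionalOn S Λ) (hSc : IsCompact S) (n : ℕ) :
    iteratedDeriv n (fun z => Λ fun w => Complex.exp (w * z)) 0 = Λ fun w => w ^ n := by
  rw [h.iteratedDeriv_exp hSc]; simp

lemma differentiable_exp (h : IsFunctionalOn S Λ) (hSc : IsCompact S) :
    Differentiable ℂ (fun z => Λ fun w => Complex.exp (w * z)) := by
  obtain ⟨ρ, hρ⟩ := hSc.isBounded.exists_norm_le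
  intro z
  simpa using (h.hasDerivAt_exp hρ (v := fun _ => 1) (by fun_prop) hSc z).differentiableAt

lemma exists_norm_exp_le (h : IsFunctionalOn S Λ) (hS : ∀ w ∈ S, ‖w‖ ≤ ρ) :
    ∃ C > 0, ∀ z, ‖Λ fun w => Complex.exp (w * z)‖ ≤ C * Real.exp (ρ * ‖z‖) := by
  obtain ⟨C, hC, hb⟩ := h.bound
  refine ⟨C + 1, by positivity, fun z => ?_⟩
  refine (hb _ (by fun_prop) (Real.exp (ρ * ‖z‖)) (Real.exp_pos _).le fun w hw => ?_).trans ?_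
  · refine (Complex.norm_exp_le_exp_norm _).trans (Real.exp_le_exp.2 ?_)
    rw [norm_mul]
    exact mul_le_mul_of_nonneg_right (hS w hw) (norm_nonneg _)
  · gcongr
    linarith

/-- A functional on a disc that annihilates the monomials annihilates holomorphic functions. -/
lemma eq_zero_of_monomials (h : IsFunctionalOn S Λ) {R : ℝ} (hS : ∀ w ∈ S, ‖w‖ ≤ ρ) (hρR : ρ < R)
    (h0 : ∀ n : ℕ, Λ (fun w => w ^ n) = 0) {F : ℂ → ℂ}
    (hF : DifferentiableOn ℂ F (Metric.ball 0 R)) : Λ F = 0 := by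
  rcases S.eq_empty_or_nonempty with rfl | ⟨w0, hw0⟩
  · rw [h.congr (G := fun w => 0 * F w) (by simp) (by simp), h.smul 0 F (by simp), zero_mul]
  have hρ0 : 0 ≤ ρ := (norm_nonneg _).trans (hS w0 hw0)
  have hT := fun (z : ℂ) (hz : ‖z‖ < R) =>
    Complex.hasSum_taylorSeries_on_ball hF (z := z) (by simpa using hz)
  set a : ℕ → ℂ := fun n => (n.factorial : ℂ)⁻¹ * iteratedDeriv n F 0 with ha
  have hT' : ∀ z : ℂ, ‖z‖ < R → HasSum (fun n => z ^ n * a n) (F z) := fun z hz => by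
    refine (hT z hz).congr_fun fun n => ?_
    simp only [ha, sub_zero, smul_eq_mul]; ring
  have hsum := (hT' ρ (by simpa [abs_of_nonneg hρ0] using hρR)).summable.norm
  have := (h.hasSum (F := fun n w => w ^ n * a n) (G := F) (fun n => by fun_prop) hsum ?_
    fun w hw => hT' w ((hS w hw).trans_lt hρR)).2
  · refine this.unique ?_
    convert hasSum_zero (α := ℂ) (β := ℕ) using 2 with n
    rw [h.mul_const (by fun_prop), h0, zero_mul]
  · intro n w hw
    simp only [norm_mul, norm_pow, Complex.norm_real, Real.norm_of_nonneg hρ0]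
    gcongr
    exact hS w hw

end IsFunctionalOn

lemma eq_of_iteratedDeriv_eq {f g : ℂ → ℂ} (hf : Differentiable ℂ f) (hg : Differentiable ℂ g)
    (h : ∀ n, iteratedDeriv n f 0 = iteratedDeriv n g 0) : f = g := by
  ext z
  rw [← Complex.taylorSeries_eq_of_entire hf 0 z, ← Complex.taylorSeries_eq_of_entire hg 0 z]
  simp only [h]

/-- Growth of the derivatives at the origin of an entire function of exponential type. -/
lemma exists_norm_iteratedDeriv_le {f : ℂ → ℂ} (hf : Differentiable ℂ f) {σ σ' C : ℝ} (hσ : 0 < σ)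
    (hσ' : σ < σ') (hb : ∀ z, ‖f z‖ ≤ C * Real.exp (σ * ‖z‖)) :
    ∃ C', ∀ n, ‖iteratedDeriv n f 0‖ ≤ C' * σ' ^ n := by
  have hC : 0 ≤ C := by have := (norm_nonneg _).trans (hb 0); simpa using this
  have hσ'0 : 0 < σ' := hσ.trans hσ'
  have h1 : ∀ n : ℕ, ‖iteratedDeriv (n + 1) f 0‖ ≤ C * Real.exp 1 * ((n + 1) * σ ^ (n + 1)) := by
    intro n
    -- The radius that minimizes `e^{σx} / x^{n+1}` in Cauchy's estimate.
    set x : ℝ := (n + 1) / σ with hx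
    have hx0 : 0 < x := by positivity
    have h2 := Complex.norm_iteratedDeriv_le_of_forall_mem_sphere_norm_le (n + 1) hx0
      (hf.diffContOnCl (s := Metric.ball 0 x)) (C := C * Real.exp (n + 1)) (fun z hz => by
        have h3 := hb z
        rw [mem_sphere_zero_iff_norm.1 hz, hx, mul_div_cancel₀ _ hσ.ne'] at h3
        exact h3)
    have h4 := factorial_succ_le n
    refine h2.trans ?_
    rw [div_le_iff₀ (by positivity)]
    calc ((n + 1).factorial : ℝ) * (C * Real.exp (n + 1))
        ≤ (Real.exp 1 * (n + 1) * ((n + 1) / Real.exp 1) ^ (n + 1)) * (C * Real.exp (n + 1)) := by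
          gcongr
      _ = _ := by
          have : Real.exp ((n : ℝ) + 1) = Real.exp 1 ^ (n + 1) := by
            rw [← Real.exp_nat_mul]; push_cast; ring_nf
          rw [this, hx, div_pow, div_pow]
          field_simp
  -- The factor `n + 1` left by the Stirling bound is absorbed by passing from `σ` to the larger
  -- `σ'`.
  have h5 : Tendsto (fun n : ℕ => ((n : ℝ) + 1) * (σ / σ') ^ (n + 1)) atTop (𝓝 0) := by
    have := (tendsto_self_mul_const_pow_of_lt_one (r := σ / σ') (by positivity)
      ((div_lt_one hσ'0).2 hσ')).comp (tendsto_add_atTop_nat 1)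
    simpa [Function.comp_def] using this
  obtain ⟨D, hD⟩ := h5.bddAbove_range
  refine ⟨max ‖iteratedDeriv 0 f 0‖ (C * Real.exp 1 * D), fun n => ?_⟩
  rcases n with _ | n
  · simp
  · refine (h1 n).trans ?_
    have h6 : ((n : ℝ) + 1) * (σ / σ') ^ (n + 1) ≤ D := hD ⟨n, rfl⟩
    calc C * Real.exp 1 * ((n + 1) * σ ^ (n + 1))
        = C * Real.exp 1 * ((n + 1) * (σ / σ') ^ (n + 1)) * σ' ^ (n + 1) := by
          rw [div_pow]; field_simp
      _ ≤ C * Real.exp 1 * D * σ' ^ (n + 1) := by gcongr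
      _ ≤ _ := by gcongr; exact le_max_right _ _

/-! ### Interchanging functionals with contour integrals -/

/-- A functional that may be interchanged with contour integrals. -/
def CommutesWithContours (S : Set ℂ) (Λ : (ℂ → ℂ) → ℂ) : Prop :=
  ∀ (γ : ℝ → ℂ), IsClosedLipschitz γ → ∀ K : ℂ → ℂ → ℂ,
    ContinuousOn (Function.uncurry K) ((γ '' Icc 0 1) ×ˢ S) →
    contourInt γ (fun s => Λ (K s)) = Λ (fun w => contourInt γ (fun s => K s w))

lemma continuousOn_slice_right {T S : Set ℂ} {K : ℂ → ℂ → ℂ}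
    (hK : ContinuousOn (Function.uncurry K) (T ×ˢ S)) {s : ℂ} (hs : s ∈ T) :
    ContinuousOn (K s) S :=
  hK.comp (f := fun w => (s, w)) (by fun_prop) (fun _ hw => ⟨hs, hw⟩)

lemma continuousOn_slice_left {T S : Set ℂ} {K : ℂ → ℂ → ℂ}
    (hK : ContinuousOn (Function.uncurry K) (T ×ˢ S)) {w : ℂ} (hw : w ∈ S) :
    ContinuousOn (fun s => K s w) T :=
  hK.comp (f := fun s => (s, w)) (by fun_prop) (fun _ hs => ⟨hs, hw⟩)

lemma IsFunctionalOn.continuousOn_param {S T : Set ℂ} {Λ : (ℂ → ℂ) → ℂ} (h : IsFunctionalOn S Λ)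
    (hS : IsCompact S) (hT : IsCompact T) {K : ℂ → ℂ → ℂ}
    (hK : ContinuousOn (Function.uncurry K) (T ×ˢ S)) : ContinuousOn (fun s => Λ (K s)) T := by
  obtain ⟨C, hC, hb⟩ := h.bound
  have huc := (hT.prod hS).uniformContinuousOn_of_continuous hK
  rw [Metric.uniformContinuousOn_iff] at huc
  rw [Metric.continuousOn_iff]
  intro s hs ε hε
  obtain ⟨η, hη, hη'⟩ := huc (ε / (C + 1)) (by positivity)
  refine ⟨η, hη, fun t ht hts => ?_⟩
  have ht' := continuousOn_slice_right hK ht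
  have hs' := continuousOn_slice_right hK hs
  rw [dist_eq_norm, ← h.sub ht' hs']
  refine (hb _ (ht'.fun_sub hs') (ε / (C + 1)) (by positivity) fun w hw => ?_).trans_lt ?_
  · have := hη' (t, w) ⟨ht, hw⟩ (s, w) ⟨hs, hw⟩ (by simpa [Prod.dist_eq, hη] using hts)
    rw [dist_eq_norm] at this
    exact this.le
  · rw [← mul_div_assoc, div_lt_iff₀ (by positivity)]
    nlinarith

lemma CommutesWithContours.add {S : Set ℂ} (hS : IsCompact S) {Λ Λ' : (ℂ → ℂ) → ℂ}
    (h : IsFunctionalOn S Λ) (h' : IsFunctionalOn S Λ') (hc : CommutesWithContours S Λ)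
    (hc' : CommutesWithContours S Λ') : CommutesWithContours S (fun F => Λ F + Λ' F) := by
  intro γ hγ K hK
  rw [hγ.isFunctionalOn.add _ _ (h.continuousOn_param hS hγ.isCompact_image hK)
    (h'.continuousOn_param hS hγ.isCompact_image hK), hc γ hγ K hK, hc' γ hγ K hK]

lemma CommutesWithContours.const_mul {S : Set ℂ} (hS : IsCompact S) {Λ : (ℂ → ℂ) → ℂ}
    (h : IsFunctionalOn S Λ) (hc : CommutesWithContours S Λ) (a : ℂ) :
    CommutesWithContours S (fun F => a * Λ F) := by
  intro γ hγ K hK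
  rw [hγ.isFunctionalOn.smul _ _ (h.continuousOn_param hS hγ.isCompact_image hK), hc γ hγ K hK]

/-- Integration along an arc against a continuous weight. -/
noncomputable def arcInt (a b : ℝ) (w η : ℝ → ℂ) (F : ℂ → ℂ) : ℂ := ∫ t in a..b, F (w t) * η t

lemma arcInt_isFunctionalOn {a b : ℝ} (hab : a ≤ b) {w η : ℝ → ℂ} {S : Set ℂ}
    (hw : ContinuousOn w (Icc a b)) (hη : ContinuousOn η (Icc a b)) (hS : MapsTo w (Icc a b) S) :
    IsFunctionalOn S (arcInt a b w η) := by
  have hint : ∀ F : ℂ → ℂ, ContinuousOn F S →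
      IntervalIntegrable (fun t => F (w t) * η t) volume a b := fun F hF => by
    apply ContinuousOn.intervalIntegrable
    rw [uIcc_of_le hab]
    exact (hF.comp hw hS).mul hη
  refine ⟨fun F G hF hG => ?_, fun c F hF => ?_, ?_⟩
  · rw [arcInt, arcInt, arcInt, ← intervalIntegral.integral_add (hint F hF) (hint G hG)]
    congr 1; ext t; ring
  · rw [arcInt, arcInt, ← intervalIntegral.integral_const_mul]
    congr 1; ext t; ring
  · obtain ⟨B, hB⟩ := isCompact_Icc.exists_bound_of_continuousOn hη
    refine ⟨|B| * (b - a), mul_nonneg (abs_nonneg _) (sub_nonneg.2 hab), fun F hF M hM hFM => ?_⟩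
    have := intervalIntegral.norm_integral_le_of_norm_le_const (a := a) (b := b)
      (C := M * |B|) (f := fun t => F (w t) * η t) ?_
    · rw [abs_of_nonneg (sub_nonneg.2 hab)] at this
      rw [arcInt]
      linarith
    · intro t ht
      rw [uIoc_of_le hab] at ht
      have ht' := Ioc_subset_Icc_self ht
      rw [norm_mul]
      exact mul_le_mul (hFM _ (hS ht')) ((hB t ht').trans (le_abs_self _)) (norm_nonneg _) hM

/-- Fubini: the integrand is a continuous function on a compact rectangle times the derivative of
the curve, which is measurable and bounded by the Lipschitz constant on the open interval. -/
lemma arcInt_commutes {a b : ℝ} (hab : a ≤ b) {w η : ℝ → ℂ} {S : Set ℂ}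
    (hw : ContinuousOn w (Icc a b)) (hη : ContinuousOn η (Icc a b)) (hS : MapsTo w (Icc a b) S) :
    CommutesWithContours S (arcInt a b w η) := by
  intro γ hγ K hK
  obtain ⟨C, hC⟩ := hγ.lipschitz
  simp only [arcInt, contourInt, ← intervalIntegral.integral_mul_const]
  simp only [intervalIntegral.integral_of_le zero_le_one, intervalIntegral.integral_of_le hab,
    integral_Ioc_eq_integral_Ioo]
  set k : ℝ × ℝ → ℂ := fun p => K (γ p.1) (w p.2) * η p.2 with hk
  have hkc : ContinuousOn k (Icc 0 1 ×ˢ Icc a b) := by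
    refine (hK.comp (f := fun p : ℝ × ℝ => (γ p.1, w p.2)) ?_ ?_).mul ?_
    · exact (hγ.continuousOn.comp continuousOn_fst fun p hp => hp.1).prodMk
        (hw.comp continuousOn_snd fun p hp => hp.2)
    · exact fun p hp => ⟨mem_image_of_mem _ hp.1, hS hp.2⟩
    · exact hη.comp continuousOn_snd fun p hp => hp.2
  obtain ⟨B, hB⟩ := (isCompact_Icc.prod isCompact_Icc).exists_bound_of_continuousOn hkc
  have hsub : Ioo (0 : ℝ) 1 ×ˢ Ioo a b ⊆ Icc 0 1 ×ˢ Icc a b :=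
    prod_mono Ioo_subset_Icc_self Ioo_subset_Icc_self
  rw [integral_integral_swap]
  · refine integral_congr_ae (Eventually.of_forall fun u => ?_)
    refine integral_congr_ae (Eventually.of_forall fun t => ?_)
    simp only; ring
  · rw [Measure.prod_restrict]
    have hmeas : MeasurableSet (Ioo (0 : ℝ) 1 ×ˢ Ioo a b) := measurableSet_Ioo.prod measurableSet_Ioo
    have : IsFiniteMeasure ((volume.prod volume).restrict (Ioo (0 : ℝ) 1 ×ˢ Ioo a b)) := by
      constructor
      rw [Measure.restrict_apply_univ, Measure.prod_prod]
      simp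
    refine Integrable.of_bound (C := |B| * C) ?_ ?_
    · exact ((hkc.mono hsub).aestronglyMeasurable hmeas).mul
        ((measurable_deriv γ).comp measurable_fst).aestronglyMeasurable
    · rw [ae_restrict_iff' hmeas]
      refine Eventually.of_forall fun p hp => ?_
      change ‖k p * deriv γ p.1‖ ≤ _
      rw [norm_mul]
      exact mul_le_mul ((hB p (hsub hp)).trans (le_abs_self _))
        (norm_deriv_le_of_lipschitzOn_Icc hC hp.1) (norm_nonneg _) (abs_nonneg _)

/-! ### The angular contour -/

lemma continuous_polar : Continuous (fun p : ℝ × ℝ => polar p.1 p.2) := by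
  unfold polar; fun_prop

lemma norm_polar {t : ℝ} (ht : 0 ≤ t) (θ : ℝ) : ‖polar t θ‖ = t := by
  rw [polar, norm_mul, Complex.norm_exp_ofReal_mul_I, mul_one, Complex.norm_real,
    Real.norm_of_nonneg ht]

lemma norm_le_of_mem_kappa {δ ψ r : ℝ} (hδ : 0 < δ) (hδr : δ < r) {s : ℂ}
    (hs : s ∈ kappa δ ψ r) : ‖s‖ ≤ r := by
  rcases hs with ⟨t, ht, rfl | rfl⟩ | ⟨θ, -, rfl⟩
  · rw [norm_polar (hδ.le.trans ht.1)]; exact ht.2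
  · rw [norm_polar (hδ.le.trans ht.1)]; exact ht.2
  · rw [norm_polar hδ.le]; exact hδr.le

lemma isCompact_kappa (δ ψ r : ℝ) : IsCompact (kappa δ ψ r) := by
  have h1 : IsCompact ((fun t => polar t ψ) '' Icc δ r) :=
    isCompact_Icc.image (continuous_polar.comp (by fun_prop : Continuous fun t : ℝ => (t, ψ)))
  have h2 : IsCompact ((fun t => polar t (-ψ)) '' Icc δ r) :=
    isCompact_Icc.image (continuous_polar.comp (by fun_prop : Continuous fun t : ℝ => (t, -ψ)))
  have h3 : IsCompact ((fun θ => polar δ θ) '' Icc (-ψ) ψ) :=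
    isCompact_Icc.image (continuous_polar.comp (by fun_prop : Continuous fun θ : ℝ => (δ, θ)))
  convert (h1.union h2).union h3 using 1
  ext s
  simp only [kappa, mem_union, mem_ofPred_eq, mem_image]
  constructor
  · rintro (⟨t, ht, rfl | rfl⟩ | ⟨θ, hθ, rfl⟩)
    · exact Or.inl (Or.inl ⟨t, ht, rfl⟩)
    · exact Or.inl (Or.inr ⟨t, ht, rfl⟩)
    · exact Or.inr ⟨θ, hθ, rfl⟩
  · rintro ((⟨t, ht, rfl⟩ | ⟨t, ht, rfl⟩) | ⟨θ, hθ, rfl⟩)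
    · exact Or.inl ⟨t, ht, Or.inl rfl⟩
    · exact Or.inl ⟨t, ht, Or.inr rfl⟩
    · exact Or.inr ⟨θ, hθ, rfl⟩

lemma kappaInt_eq_arcInt (δ ψ r : ℝ) (G : ℝ → ℝ → ℂ) (F : ℂ → ℂ) :
    kappaInt δ ψ r G F = (2 * Real.pi * Complex.I)⁻¹ *
      ((-1) * arcInt δ r (fun t => polar t (-ψ))
          (fun t => G t (-ψ) * Complex.exp (-ψ * Complex.I)) F +
        arcInt (-ψ) ψ (fun θ => polar δ θ) (fun θ => G δ θ * (Complex.I * polar δ θ)) F +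
        arcInt δ r (fun t => polar t ψ) (fun t => G t ψ * Complex.exp (ψ * Complex.I)) F) := by
  simp only [kappaInt, arcInt, mul_assoc, neg_one_mul]

lemma kappaInt_functional {δ ψ r : ℝ} (hδr : δ ≤ r) (hψ : 0 ≤ ψ) {G : ℝ → ℝ → ℂ}
    (hG : ContinuousOn (fun x : ℝ × ℝ => G x.1 x.2) (Ici δ ×ˢ Icc (-ψ) ψ)) :
    IsFunctionalOn (kappa δ ψ r) (kappaInt δ ψ r G) ∧
      CommutesWithContours (kappa δ ψ r) (kappaInt δ ψ r G) := by
  have hψ' : -ψ ≤ ψ := by linarith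
  have hS := isCompact_kappa δ ψ r
  have hray : ∀ θ ∈ Icc (-ψ) ψ, ∀ c : ℂ, ContinuousOn (fun t => G t θ * c) (Icc δ r) :=
    fun θ hθ c => (hG.comp (f := fun t : ℝ => (t, θ)) (by fun_prop)
      fun t ht => ⟨ht.1, hθ⟩).mul continuousOn_const
  have hpr : ∀ θ, ContinuousOn (fun t => polar t θ) (Icc δ r) := fun θ =>
    (continuous_polar.comp (by fun_prop : Continuous fun t : ℝ => (t, θ))).continuousOn
  have hpa : Continuous (fun θ => polar δ θ) :=
    continuous_polar.comp (by fun_prop : Continuous fun θ : ℝ => (δ, θ))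
  have harc : ContinuousOn (fun θ => G δ θ * (Complex.I * polar δ θ)) (Icc (-ψ) ψ) :=
    (hG.comp (f := fun θ : ℝ => (δ, θ)) (by fun_prop) fun θ hθ => ⟨mem_Ici.2 le_rfl, hθ⟩).mul
      (hpa.continuousOn.const_mul _)
  have hm1 : MapsTo (fun t => polar t (-ψ)) (Icc δ r) (kappa δ ψ r) :=
    fun t ht => Or.inl ⟨t, ht, Or.inr rfl⟩
  have hm2 : MapsTo (fun θ => polar δ θ) (Icc (-ψ) ψ) (kappa δ ψ r) := fun θ hθ => Or.inr ⟨θ, hθ, rfl⟩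
  have hm3 : MapsTo (fun t => polar t ψ) (Icc δ r) (kappa δ ψ r) :=
    fun t ht => Or.inl ⟨t, ht, Or.inl rfl⟩
  have hc1 := hray (-ψ) ⟨le_rfl, hψ'⟩ (Complex.exp (-ψ * Complex.I))
  have hc3 := hray ψ ⟨hψ', le_rfl⟩ (Complex.exp (ψ * Complex.I))
  have f1 := arcInt_isFunctionalOn hδr (hpr (-ψ)) hc1 hm1
  have f2 := arcInt_isFunctionalOn hψ' hpa.continuousOn harc hm2
  have f3 := arcInt_isFunctionalOn hδr (hpr ψ) hc3 hm3
  have g1 := arcInt_commutes hδr (hpr (-ψ)) hc1 hm1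
  have g2 := arcInt_commutes hψ' hpa.continuousOn harc hm2
  have g3 := arcInt_commutes hδr (hpr ψ) hc3 hm3
  have f12 := (f1.const_mul (-1)).add_functional f2
  have g12 := CommutesWithContours.add hS (f1.const_mul (-1)) f2 (g1.const_mul hS f1 (-1)) g2
  have e : kappaInt δ ψ r G = _ := funext fun F => kappaInt_eq_arcInt δ ψ r G F
  rw [e]
  exact ⟨(f12.add_functional f3).const_mul _, (CommutesWithContours.add hS f12 f3 g12 g3).const_mul
    hS (f12.add_functional f3) _⟩

/-! ### Enclosing curves in the slit plane -/

/-- The circle of radius `M` around the origin, sheared horizontally by `u`. -/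
noncomputable def shearedCircle (M : ℝ) (u : ℝ → ℝ) (t : ℝ) : ℂ :=
  ⟨M * Real.sin (2 * Real.pi * t) + u (-M * Real.cos (2 * Real.pi * t)),
    -M * Real.cos (2 * Real.pi * t)⟩

section shearedCircle

variable {M : ℝ} {u : ℝ → ℝ}

lemma shearedCircle_eq (t : ℝ) :
    ((shearedCircle M u t).re - u (shearedCircle M u t).im) ^ 2 + (shearedCircle M u t).im ^ 2 =
      M ^ 2 := by
  simp only [shearedCircle]
  linear_combination M ^ 2 * Real.sin_sq_add_cos_sq (2 * Real.pi * t)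

lemma shearedCircle_closed : shearedCircle M u 0 = shearedCircle M u 1 := by
  simp [shearedCircle]

lemma shearedCircle_injOn (hM : 0 < M) : InjOn (shearedCircle M u) (Ico 0 1) := by
  intro s hs t ht hst
  have him := congrArg Complex.im hst
  have hre := congrArg Complex.re hst
  simp only [shearedCircle] at him hre
  rw [him] at hre
  have hsin : Real.sin (2 * Real.pi * s) = Real.sin (2 * Real.pi * t) :=
    mul_left_cancel₀ hM.ne' (by linarith)
  have hcos : Real.cos (2 * Real.pi * s) = Real.cos (2 * Real.pi * t) :=
    mul_left_cancel₀ (neg_ne_zero.2 hM.ne') him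
  have hexp : Complex.exp ((2 * Real.pi * s : ℝ) * Complex.I) =
      Complex.exp ((2 * Real.pi * t : ℝ) * Complex.I) := by
    rw [Complex.exp_mul_I, Complex.exp_mul_I, ← Complex.ofReal_cos, ← Complex.ofReal_sin,
      ← Complex.ofReal_cos, ← Complex.ofReal_sin, hsin, hcos]
  obtain ⟨n, hn⟩ := Complex.exp_eq_exp_iff_exists_int.1 hexp
  have h1 : s = t + n := by
    have h2 : (2 * Real.pi * Complex.I) * (s : ℂ) = (2 * Real.pi * Complex.I) * ((t : ℂ) + n) := by
      push_cast at hn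
      linear_combination hn
    exact_mod_cast mul_left_cancel₀ two_pi_I_ne_zero h2
  have h3 : n = 0 := by
    have h4 : (n : ℝ) < 1 := by linarith [hs.2, ht.1]
    have h5 : (-1 : ℝ) < n := by linarith [hs.1, ht.2]
    have h4' : n < 1 := by exact_mod_cast h4
    have h5' : -1 < n := by exact_mod_cast h5
    omega
  rw [h1, h3]; simp

lemma exists_lipschitz_shearedCircle {K : ℝ≥0} (hu : LipschitzWith K u) :
    ∃ C, LipschitzOnWith C (shearedCircle M u) (Icc 0 1) := by
  have hx : ContDiffOn ℝ 1 (fun t => M * Real.sin (2 * Real.pi * t)) (Icc 0 1) := by fun_prop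
  have hy : ContDiffOn ℝ 1 (fun t => -M * Real.cos (2 * Real.pi * t)) (Icc 0 1) := by fun_prop
  obtain ⟨A, hA⟩ := hx.exists_lipschitzOnWith (by decide) (convex_Icc _ _) isCompact_Icc
  obtain ⟨B, hB⟩ := hy.exists_lipschitzOnWith (by decide) (convex_Icc _ _) isCompact_Icc
  have h1 := hA.add (hu.comp_lipschitzOnWith hB)
  have h2 := Complex.isometry_ofReal.lipschitz.comp_lipschitzOnWith h1
  have h3 := (Complex.isometry_ofReal.lipschitz.comp_lipschitzOnWith hB)
  have h4 : LipschitzWith 1 (fun z : ℂ => Complex.I * z) :=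
    LipschitzWith.of_dist_le_mul fun z w => by
      rw [dist_eq_norm, ← mul_sub, norm_mul]; simp [dist_eq_norm]
  have e : shearedCircle M u = fun t => ((M * Real.sin (2 * Real.pi * t) +
      u (-M * Real.cos (2 * Real.pi * t)) : ℝ) : ℂ) +
      Complex.I * ((-M * Real.cos (2 * Real.pi * t) : ℝ) : ℂ) := by
    ext t
    apply Complex.ext <;> simp only [shearedCircle, Complex.add_re, Complex.ofReal_re,
      Complex.mul_re, Complex.I_re, Complex.I_im, Complex.ofReal_im, Complex.add_im,
      Complex.mul_im] <;> ring
  rw [e]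
  exact ⟨_, h2.add (h4.comp_lipschitzOnWith h3)⟩

lemma not_mem_shearedCircle {w : ℂ} (hw : (w.re - u w.im) ^ 2 + w.im ^ 2 < M ^ 2) (S : Set ℝ) :
    w ∉ shearedCircle M u '' S := by
  rintro ⟨t, -, rfl⟩
  exact hw.ne (shearedCircle_eq t)

/-- Cut the curve at its lowest and highest points. At the height of `w` the first half passes to
the right of `w` and the second to the left, so `log (z - w)` and `log (-(z - w))` are primitives on
the halves. The branches differ by `πi` at each cut, with signs that add up to `2πi`. -/
lemma windingNumber_shearedCircle (hM : 0 < M) {K : ℝ≥0} (hu : LipschitzWith K u) {w : ℂ}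
    (hw : (w.re - u w.im) ^ 2 + w.im ^ 2 < M ^ 2) : windingNumber (shearedCircle M u) w = 1 := by
  obtain ⟨C, hC⟩ := exists_lipschitz_shearedCircle (M := M) hu
  set γ := shearedCircle M u with hγ
  have hcl : IsClosedLipschitz γ := ⟨shearedCircle_closed, C, hC⟩
  have hwim : |w.im| < M := abs_lt_of_sq_lt_sq (by nlinarith [sq_nonneg (w.re - u w.im)]) hM.le
  obtain ⟨hwim1, hwim2⟩ := abs_lt.1 hwim
  have hpi := Real.pi_pos
  have hint := intervalIntegrable_contour hcl
    (continuousOn_inv_sub (not_mem_shearedCircle hw (Icc 0 1)))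
  have hsub1 : Icc (0 : ℝ) (1 / 2) ⊆ Icc 0 1 := Icc_subset_Icc_right (by norm_num)
  have hsub2 : Icc (1 / 2 : ℝ) 1 ⊆ Icc 0 1 := Icc_subset_Icc_left (by norm_num)
  have hint1 : IntervalIntegrable (fun t => (γ t - w)⁻¹ * deriv γ t) volume 0 (1 / 2) :=
    hint.mono_set (by rw [uIcc_of_le (by norm_num), uIcc_of_le zero_le_one]; exact hsub1)
  have hint2 : IntervalIntegrable (fun t => (γ t - w)⁻¹ * deriv γ t) volume (1 / 2) 1 :=
    hint.mono_set (by rw [uIcc_of_le (by norm_num), uIcc_of_le zero_le_one]; exact hsub2)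
  have hopen1 : IsOpen {z : ℂ | z - w ∈ Complex.slitPlane} :=
    Complex.isOpen_slitPlane.preimage (by fun_prop)
  have hopen2 : IsOpen {z : ℂ | -(z - w) ∈ Complex.slitPlane} :=
    Complex.isOpen_slitPlane.preimage (by fun_prop)
  have I1 : ∫ t in (0 : ℝ)..(1 / 2), (γ t - w)⁻¹ * deriv γ t =
      Complex.log (γ (1 / 2) - w) - Complex.log (γ 0 - w) := by
    refine integral_deriv_comp_of_lipschitzOn (F := fun z => Complex.log (z - w))
      (F' := fun z => (z - w)⁻¹) (by norm_num) (hC.mono hsub1) hopen1 ?_ ?_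
    · intro t ht
      rw [mem_ofPred_eq, Complex.mem_slitPlane_iff]
      by_contra! hcon
      have hs : 0 ≤ Real.sin (2 * Real.pi * t) :=
        Real.sin_nonneg_of_nonneg_of_le_pi (by have := ht.1; positivity) (by nlinarith [ht.2])
      have him : (γ t).im = w.im := by simpa [sub_eq_zero] using hcon.2
      have hre : (γ t).re - u w.im ≤ w.re - u w.im := by
        have := hcon.1; simp only [Complex.sub_re] at this; linarith
      have hx : (γ t).re - u w.im = M * Real.sin (2 * Real.pi * t) := by
        rw [← him]; simp [hγ, shearedCircle]
      have he := shearedCircle_eq (M := M) (u := u) t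
      rw [← hγ, him] at he
      have : 0 ≤ (γ t).re - u w.im := by rw [hx]; positivity
      nlinarith
    · intro z hz
      simpa using ((hasDerivAt_id' z).sub_const w).clog hz
  have I2 : ∫ t in (1 / 2 : ℝ)..1, (γ t - w)⁻¹ * deriv γ t =
      Complex.log (-(γ 1 - w)) - Complex.log (-(γ (1 / 2) - w)) := by
    refine integral_deriv_comp_of_lipschitzOn (F := fun z => Complex.log (-(z - w)))
      (F' := fun z => (z - w)⁻¹) (by norm_num) (hC.mono hsub2) hopen2 ?_ ?_
    · intro t ht
      rw [mem_ofPred_eq, Complex.mem_slitPlane_iff]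
      by_contra! hcon
      have hs : Real.sin (2 * Real.pi * t) ≤ 0 := by
        have h1 : 0 ≤ Real.sin (2 * Real.pi * t - Real.pi) :=
          Real.sin_nonneg_of_nonneg_of_le_pi (by nlinarith [ht.1]) (by nlinarith [ht.2])
        rw [Real.sin_sub_pi] at h1; linarith
      have him : (γ t).im = w.im := by
        have := hcon.2; simp only [Complex.neg_im, Complex.sub_im] at this; linarith
      have hre : w.re - u w.im ≤ (γ t).re - u w.im := by
        have := hcon.1; simp only [Complex.neg_re, Complex.sub_re] at this; linarith
      have hx : (γ t).re - u w.im = M * Real.sin (2 * Real.pi * t) := by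
        rw [← him]; simp [hγ, shearedCircle]
      have he := shearedCircle_eq (M := M) (u := u) t
      rw [← hγ, him] at he
      have : (γ t).re - u w.im ≤ 0 := by
        rw [hx]; exact mul_nonpos_of_nonneg_of_nonpos hM.le hs
      nlinarith
    · intro z hz
      convert (((hasDerivAt_id' z).sub_const w).fun_neg).clog hz using 1
      have hne : z - w ≠ 0 := by
        rintro h0
        rw [mem_ofPred_eq, h0, neg_zero] at hz
        exact Complex.slitPlane_ne_zero hz rfl
      field_simp
  have hlog1 : Complex.log (-(γ (1 / 2) - w)) = Complex.log (γ (1 / 2) - w) -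
      Real.pi * Complex.I := by
    have him : 0 < (γ (1 / 2) - w).im := by
      have : (γ (1 / 2)).im = M := by
        simp only [hγ, shearedCircle]
        rw [show 2 * Real.pi * (1 / 2) = Real.pi by ring, Real.cos_pi]; ring
      rw [Complex.sub_im, this]; linarith
    rw [Complex.log, Complex.log, norm_neg, Complex.arg_neg_eq_arg_sub_pi_of_im_pos him]
    push_cast; ring
  have hlog2 : Complex.log (-(γ 0 - w)) = Complex.log (γ 0 - w) + Real.pi * Complex.I := by
    have him : (γ 0 - w).im < 0 := by
      have : (γ 0).im = -M := by simp [hγ, shearedCircle]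
      rw [Complex.sub_im, this]; linarith
    rw [Complex.log, Complex.log, norm_neg, Complex.arg_neg_eq_arg_add_pi_of_im_neg him]
    push_cast; ring
  rw [windingNumber, contourInt, ← intervalIntegral.integral_add_adjacent_intervals hint1 hint2,
    I1, I2, hlog1, ← hcl.closed, hlog2, inv_mul_eq_one₀ two_pi_I_ne_zero]
  ring

lemma encloses_shearedCircle (hM : 0 < M) {K : ℝ≥0} (hu : LipschitzWith K u) {w : ℂ}
    (hw : (w.re - u w.im) ^ 2 + w.im ^ 2 < M ^ 2) : Encloses (shearedCircle M u) w :=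
  ⟨not_mem_shearedCircle hw _, windingNumber_shearedCircle hM hu hw⟩

end shearedCircle

/-- Circles around the origin as Lipschitz curves. -/
lemma exists_circle {M : ℝ} (hM : 0 < M) : ∃ γ : ℝ → ℂ, IsClosedLipschitz γ ∧
    (∀ w ∈ γ '' Icc 0 1, ‖w‖ = M) ∧ ∀ w, ‖w‖ < M → Encloses γ w := by
  have hu : LipschitzWith 0 (fun _ : ℝ => (0 : ℝ)) := LipschitzWith.const 0
  refine ⟨shearedCircle M fun _ => 0, ⟨shearedCircle_closed, exists_lipschitz_shearedCircle hu⟩,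
    ?_, fun w hw => encloses_shearedCircle hM hu ?_⟩
  · rintro _ ⟨t, -, rfl⟩
    have := shearedCircle_eq (M := M) (u := fun _ => 0) t
    rw [← sq_eq_sq₀ (norm_nonneg _) hM.le, ← Complex.normSq_eq_norm_sq, Complex.normSq_apply]
    linarith
  · have h1 : ‖w‖ ^ 2 < M ^ 2 := pow_lt_pow_left₀ hw (norm_nonneg _) two_ne_zero
    rw [← Complex.normSq_eq_norm_sq, Complex.normSq_apply] at h1
    linarith

lemma isOpen_Omega (h : ℝ) : IsOpen (Omega h) := by
  rw [Omega, isOpen_compl_iff]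
  exact (isClosed_le continuous_const Complex.continuous_re).inter
    (isClosed_eq (Complex.continuous_im.abs) continuous_const)

/-- Every compact subset of the slit plane is enclosed by a curve in the slit plane. -/
lemma exists_memH1_Omega {h : ℝ} (hh : 1 < h) {K : Set ℂ} (hK : IsCompact K) (hKΩ : K ⊆ Omega h) :
    ∃ γ, MemH1 K γ ∧ MapsTo γ (Icc 0 1) (Omega h) := by
  set c := Real.sqrt (h - 1) with hc
  have hc0 : 0 < c := Real.sqrt_pos.2 (by linarith)
  -- The maximum of `||Im w| - c|` and `-Re w` is positive on the slit plane, hence bounded below on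
  -- `K`; `ε` is half its minimum. Points of `K` near the heights of the slits thus lie well to the
  -- left.
  obtain ⟨ε, hε, hsep⟩ : ∃ ε > 0, ∀ w ∈ K, |(|w.im| - c)| < ε → w.re < -ε := by
    rcases K.eq_empty_or_nonempty with rfl | hne
    · exact ⟨1, one_pos, by simp⟩
    obtain ⟨w0, hw0, hmin⟩ := hK.exists_isMinOn hne
      (f := fun w : ℂ => max |(|w.im| - c)| (-w.re))
      (((Complex.continuous_im.abs.sub continuous_const).abs.max
        Complex.continuous_re.neg).continuousOn)
    have hpos : 0 < max |(|w0.im| - c)| (-w0.re) := by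
      by_contra! hle
      have h1 := (le_max_left _ _).trans hle
      have h2 := (le_max_right _ _).trans hle
      refine hKΩ hw0 ⟨by linarith, ?_⟩
      exact sub_eq_zero.1 (abs_nonpos_iff.1 h1)
    refine ⟨max |(|w0.im| - c)| (-w0.re) / 2, by positivity, fun w hw hlt => ?_⟩
    have h3 : max |(|w0.im| - c)| (-w0.re) ≤ max |(|w.im| - c)| (-w.re) := hmin hw
    rcases le_max_iff.1 h3 with h4 | h4 <;> linarith
  obtain ⟨ρ, hρ⟩ := hK.isBounded.exists_norm_le
  -- Chosen so that `M` exceeds `|ρ|` and `ε`, and `(M - ε)² + ρ² < M²`.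
  set M : ℝ := |ρ| + ε + (ε ^ 2 + ρ ^ 2) / (2 * ε) + 1 with hMdef
  have hM1 : 0 ≤ (ε ^ 2 + ρ ^ 2) / (2 * ε) := by positivity
  have hMρ : |ρ| < M := by linarith
  have hM : 0 < M := (abs_nonneg ρ).trans_lt hMρ
  have hMε : ε < M := by linarith [abs_nonneg ρ]
  have hM2 : ε ^ 2 + ρ ^ 2 < 2 * ε * M := by
    have : ε ^ 2 + ρ ^ 2 = 2 * ε * ((ε ^ 2 + ρ ^ 2) / (2 * ε)) := by field_simp
    rw [this]
    gcongr
    linarith [abs_nonneg ρ]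
  -- A tent at each height `±c` that pulls the circle left by its full radius `M`. At those heights
  -- the curve satisfies `(x + M)² + c² = M²`, hence `x < 0`, and it misses the slits.
  set u : ℝ → ℝ := fun y => -M * max 0 (1 - |(|y| - c)| / ε) with hu
  have hul : LipschitzWith (Real.toNNReal (M / ε)) u := by
    refine LipschitzWith.of_dist_le_mul fun x y => ?_
    rw [Real.coe_toNNReal _ (by positivity), Real.dist_eq, Real.dist_eq, hu]
    simp only
    rw [← mul_sub, abs_mul, abs_neg, abs_of_pos hM, div_mul_eq_mul_div, mul_div_assoc]
    gcongr
    rw [max_comm 0, max_comm 0]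
    refine (abs_max_sub_max_le_abs (1 - |(|x| - c)| / ε) (1 - |(|y| - c)| / ε) 0).trans ?_
    rw [sub_sub_sub_cancel_left, ← sub_div, abs_div, abs_of_pos hε]
    refine div_le_div_of_nonneg_right ?_ hε.le
    refine (abs_abs_sub_abs_le (|y| - c) (|x| - c)).trans ?_
    rw [sub_sub_sub_cancel_right, abs_sub_comm x y]
    exact abs_abs_sub_abs_le y x
  refine ⟨shearedCircle M u, ⟨⟨shearedCircle_closed, shearedCircle_injOn hM,
    exists_lipschitz_shearedCircle hul⟩, fun w hw => encloses_shearedCircle hM hul ?_⟩, ?_⟩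
  · have hwρ : w.re ^ 2 + w.im ^ 2 ≤ ρ ^ 2 := by
      have h1 : ‖w‖ ^ 2 ≤ ρ ^ 2 := pow_le_pow_left₀ (norm_nonneg _) (hρ w hw) 2
      rw [← Complex.normSq_eq_norm_sq, Complex.normSq_apply] at h1
      linarith
    have hρM : ρ ^ 2 < M ^ 2 := sq_lt_sq.2 (by rwa [abs_of_pos hM])
    by_cases hfar : |(|w.im| - c)| < ε
    · have hre := hsep w hw hfar
      have hu0 : u w.im ≤ 0 := by
        simp only [hu]; exact mul_nonpos_of_nonpos_of_nonneg (by linarith) (le_max_left _ _)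
      have hu1 : -M ≤ u w.im := by
        have : max 0 (1 - |(|w.im| - c)| / ε) ≤ 1 :=
          max_le zero_le_one (by linarith [div_nonneg (abs_nonneg (|w.im| - c)) hε.le])
        simp only [hu]; nlinarith
      -- A nonnegative sheared abscissa is at most `M - ε`, because `u ≥ -M` and `w.re < -ε`. A
      -- negative one is smaller in modulus than `w.re`, because `u ≤ 0`.
      rcases le_total 0 (w.re - u w.im) with hd | hd
      · have hd2 : w.re - u w.im ≤ M - ε := by linarith
        nlinarith
      · nlinarith
    · have : u w.im = 0 := by
        have h1 : 1 - |(|w.im| - c)| / ε ≤ 0 := by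
          rw [sub_nonpos, one_le_div hε]; linarith
        simp only [hu, max_eq_left h1, mul_zero]
      rw [this, sub_zero]; linarith
  · intro t _ hmem
    obtain ⟨h1, h2⟩ := hmem
    have he := shearedCircle_eq (M := M) (u := u) t
    have hu1 : ∀ y, |y| = c → u y = -M := fun y hy => by simp [hu, hy]
    rw [hu1 _ h2] at he
    have h3 : (shearedCircle M u t).im ^ 2 = c ^ 2 := by rw [← sq_abs, h2]
    nlinarith [pow_pos hc0 2]

/-- A curve in the slit plane does not wind around the points of the slits. -/
lemma windingNumber_eq_zero_of_notMem_Omega {h : ℝ} {γ : ℝ → ℂ} (hγ : IsClosedLipschitz γ)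
    (hγΩ : MapsTo γ (Icc 0 1) (Omega h)) {w : ℂ} (hw : w ∉ Omega h) : windingNumber γ w = 0 := by
  -- The horizontal ray to the right of a point of a slit stays in the slit.
  refine windingNumber_eq_zero_of_ray hγ one_ne_zero fun x hx hmem => ?_
  rw [Omega, notMem_compl_iff] at hw
  refine hγΩ.image_subset hmem ⟨?_, ?_⟩
  · simpa using add_nonneg hw.1 hx
  · simpa using hw.2

/-- Cauchy's integral formula in the slit plane. -/
lemma contourInt_cauchy_Omega {h : ℝ} {γ : ℝ → ℂ} (hγ : IsClosedLipschitz γ)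
    (hγΩ : MapsTo γ (Icc 0 1) (Omega h)) {F : ℂ → ℂ} (hF : DifferentiableOn ℂ F (Omega h)) {s : ℂ}
    (hs : s ∈ Omega h) (hsγ : Encloses γ s) :
    contourInt γ (fun w => F w * (w - s)⁻¹) = 2 * Real.pi * Complex.I * F s := by
  rw [cauchy_integral_formula hγ (isOpen_Omega h) hγΩ hF (ν := 0)
    (fun w hw => windingNumber_eq_zero_of_notMem_Omega hγ hγΩ hw) (by simp) hs hsγ.1, hsγ.2]
  ring

end

section

open Set Filter Topology MeasureTheory Polynomial
open scoped NNReal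

/-! ### Zeros and poles of the symbol -/

/-- An entire function with a zero of finite order is divisible by the corresponding power. -/
lemma exists_entire_factor {E : ℂ → ℂ} (hE : Differentiable ℂ E) {τ : ℂ}
    (hτ : analyticOrderAt E τ ≠ ⊤) : ∃ E' : ℂ → ℂ, Differentiable ℂ E' ∧ E' τ ≠ 0 ∧
      ∀ s, E s = (s - τ) ^ analyticOrderNatAt E τ * E' s := by
  obtain ⟨g, hg, hg0, hEg⟩ := (hE.analyticAt τ).analyticOrderAt_ne_top.1 hτ
  set m := analyticOrderNatAt E τ
  refine ⟨Function.update (fun s => E s / (s - τ) ^ m) τ (g τ), fun s => ?_, by simpa, fun s => ?_⟩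
  · rcases eq_or_ne s τ with rfl | hne
    · refine hg.differentiableAt.congr_of_eventuallyEq ?_
      filter_upwards [hEg] with z hz
      rcases eq_or_ne z s with rfl | hzs
      · simp
      · rw [Function.update_of_ne hzs, hz, smul_eq_mul,
          mul_div_cancel_left₀ _ (pow_ne_zero _ (sub_ne_zero.2 hzs))]
    · have h1 : DifferentiableAt ℂ (fun s => E s / (s - τ) ^ m) s :=
        (hE s).fun_div (by fun_prop) (pow_ne_zero _ (sub_ne_zero.2 hne))
      refine h1.congr_of_eventuallyEq ?_
      filter_upwards [isOpen_ne.mem_nhds hne] with z hz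
      rw [Function.update_of_ne hz]
  · rcases eq_or_ne s τ with rfl | hne
    · simpa using hEg.self_of_nhds
    · rw [Function.update_of_ne hne, mul_div_cancel₀ _ (pow_ne_zero _ (sub_ne_zero.2 hne))]

/-- The polynomial with zeros of orders `m τ` at the points `τ` of `Z`. -/
noncomputable def zeroPoly (Z : Finset ℂ) (m : ℂ → ℕ) : ℂ[X] := ∏ τ ∈ Z, (X - C τ) ^ m τ

lemma eval_zeroPoly (Z : Finset ℂ) (m : ℂ → ℕ) (s : ℂ) :
    (zeroPoly Z m).eval s = ∏ τ ∈ Z, (s - τ) ^ m τ := by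
  simp [zeroPoly, eval_prod]

lemma eval_zeroPoly_ne_zero {Z : Finset ℂ} {m : ℂ → ℕ} {s : ℂ} (hs : s ∉ Z) :
    (zeroPoly Z m).eval s ≠ 0 := by
  rw [eval_zeroPoly]
  exact Finset.prod_ne_zero_iff.2 fun τ hτ =>
    pow_ne_zero _ (sub_ne_zero.2 fun h0 => hs (h0 ▸ hτ))

/-- Points are split off one at a time; the polynomial for the earlier points does not vanish at the
new one, so the order there is unchanged in the quotient. -/
lemma exists_entire_factor_finset {E : ℂ → ℂ} (hE : Differentiable ℂ E)
    (hord : ∀ τ, analyticOrderAt E τ ≠ ⊤) (Z : Finset ℂ) :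
    ∃ E' : ℂ → ℂ, Differentiable ℂ E' ∧ (∀ τ ∈ Z, E' τ ≠ 0) ∧
      ∀ s, E s = (zeroPoly Z (analyticOrderNatAt E)).eval s * E' s := by
  classical
  induction Z using Finset.induction_on with
  | empty => exact ⟨E, hE, by simp, by simp [zeroPoly]⟩
  | insert a Z ha ih =>
    obtain ⟨E₁, hE₁, hne₁, hfac₁⟩ := ih
    set T := fun s => (zeroPoly Z (analyticOrderNatAt E)).eval s with hT
    have hTa : T a ≠ 0 := eval_zeroPoly_ne_zero ha
    have hTan : AnalyticAt ℂ T a :=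
      (Polynomial.differentiable _).analyticAt a
    have hprod : E = T * E₁ := funext hfac₁
    have hTord : analyticOrderAt T a = 0 := hTan.analyticOrderAt_eq_zero.2 hTa
    have hadd := analyticOrderAt_mul hTan (hE₁.analyticAt a)
    rw [← hprod, hTord, zero_add] at hadd
    have hord₁ : analyticOrderAt E₁ a ≠ ⊤ := hadd ▸ hord a
    obtain ⟨E₂, hE₂, hne₂, hfac₂⟩ := exists_entire_factor hE₁ hord₁
    have hnat : analyticOrderNatAt E a = analyticOrderNatAt E₁ a := by
      simp only [analyticOrderNatAt, hadd]
    refine ⟨E₂, hE₂, fun τ hτ => ?_, fun s => ?_⟩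
    · rcases Finset.mem_insert.1 hτ with rfl | hτ
      · exact hne₂
      · have := hne₁ τ hτ
        rw [hfac₂] at this
        exact right_ne_zero_of_mul this
    · rw [hfac₁ s, hfac₂ s, eval_zeroPoly, eval_zeroPoly, Finset.prod_insert ha, hnat]
      ring

/-- The entire function `(u - 1) ζ(u)`. -/
noncomputable def zetaNumerator : ℂ → ℂ := Function.update (fun u => (u - 1) * riemannZeta u) 1 1

lemma differentiable_zetaNumerator : Differentiable ℂ zetaNumerator := by
  rw [← differentiableOn_univ, ← Complex.differentiableOn_compl_singleton_and_continuousAt_iff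
    (c := 1) univ_mem]
  refine ⟨fun u hu => ?_, ?_⟩
  · have hu1 : u ≠ 1 := by simpa using hu
    have h1 : DifferentiableAt ℂ (fun u => (u - 1) * riemannZeta u) u :=
      DifferentiableAt.fun_mul (by fun_prop) (differentiableAt_riemannZeta hu1)
    refine (h1.congr_of_eventuallyEq ?_).differentiableWithinAt
    filter_upwards [isOpen_ne.mem_nhds hu1] with z hz
    rw [zetaNumerator, Function.update_of_ne hz]
  -- The value `1` is the residue of `ζ` at its pole, so the singularity is removed.
  · rw [zetaNumerator, continuousAt_update_same]
    exact riemannZeta_residue_one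

/-- The polynomial `s² + h - 1` that cancels the poles of `ζ(s² + h)`. -/
noncomputable def polePoly (h : ℝ) (s : ℂ) : ℂ := s ^ 2 + h - 1

/-- The entire function `(s² + h - 1) ζ(s² + h)`. -/
noncomputable def entireSymbol (h : ℝ) (s : ℂ) : ℂ := zetaNumerator (s ^ 2 + h)

lemma differentiable_polePoly (h : ℝ) : Differentiable ℂ (polePoly h) := by
  unfold polePoly; fun_prop

lemma differentiable_entireSymbol (h : ℝ) : Differentiable ℂ (entireSymbol h) :=
  differentiable_zetaNumerator.comp (by fun_prop)

lemma entireSymbol_eq {h : ℝ} {s : ℂ} (hs : polePoly h s ≠ 0) :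
    entireSymbol h s = polePoly h s * zetaSymbol h s := by
  have h1 : s ^ 2 + (h : ℂ) ≠ 1 := fun h0 => hs (by rw [polePoly, h0, sub_self])
  rw [entireSymbol, zetaNumerator, Function.update_of_ne h1, polePoly, zetaSymbol]

lemma entireSymbol_of_polePoly_eq_zero {h : ℝ} {s : ℂ} (hs : polePoly h s = 0) :
    entireSymbol h s = 1 := by
  have h1 : s ^ 2 + (h : ℂ) = 1 := sub_eq_zero.1 hs
  rw [entireSymbol, zetaNumerator, h1, Function.update_self]

/-- The default value `riemannZeta 1` is nonzero, so no pole of the symbol is counted as a zero. -/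
lemma polePoly_ne_zero_of_zero {h : ℝ} {s : ℂ} (hs : zetaSymbol h s = 0) : polePoly h s ≠ 0 := by
  intro h0
  have h1 : s ^ 2 + (h : ℂ) = 1 := sub_eq_zero.1 h0
  rw [zetaSymbol, h1] at hs
  exact riemannZeta_one_ne_zero hs

lemma entireSymbol_eq_zero_iff {h : ℝ} {s : ℂ} : entireSymbol h s = 0 ↔ zetaSymbol h s = 0 := by
  by_cases hs : polePoly h s = 0
  · rw [entireSymbol_of_polePoly_eq_zero hs]
    exact ⟨fun h0 => (one_ne_zero h0).elim, fun h0 => (polePoly_ne_zero_of_zero h0 hs).elim⟩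
  · rw [entireSymbol_eq hs, mul_eq_zero, or_iff_right hs]

lemma finite_polePoly_zeros (h : ℝ) : {s : ℂ | polePoly h s = 0}.Finite := by
  have hp : (X ^ 2 + C ((h : ℂ) - 1) : ℂ[X]) ≠ 0 := (monic_X_pow_add_C _ two_ne_zero).ne_zero
  refine (X ^ 2 + C ((h : ℂ) - 1) : ℂ[X]).roots.toFinset.finite_toSet.subset fun s hs => ?_
  simp only [Finset.mem_coe, Multiset.mem_toFinset, mem_roots hp, IsRoot.def, eval_add, eval_pow,
    eval_X, eval_C]
  rw [mem_ofPred_eq, polePoly] at hs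
  linear_combination hs

lemma polePoly_ne_zero_of_mem_Omega {h : ℝ} (hh : 1 < h) {s : ℂ} (hs : s ∈ Omega h) :
    polePoly h s ≠ 0 := by
  intro h0
  have hre := congrArg Complex.re h0
  have him := congrArg Complex.im h0
  simp only [polePoly, pow_two, Complex.sub_re, Complex.add_re, Complex.mul_re, Complex.ofReal_re,
    Complex.one_re, Complex.zero_re, Complex.sub_im, Complex.add_im, Complex.mul_im,
    Complex.ofReal_im, Complex.one_im, Complex.zero_im] at hre him
  have h1 : s.re = 0 := by
    rcases mul_eq_zero.1 (by linarith : s.re * s.im = 0) with h1 | h1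
    · exact h1
    · rw [h1] at hre; nlinarith [mul_self_nonneg s.re]
  refine hs ⟨h1.ge, ?_⟩
  rw [← Real.sqrt_sq_eq_abs]
  congr 1
  rw [h1] at hre
  linarith

/-- On the slits `Re (s² + h) = (Re s)² + 1 ≥ 1`, where `ζ` has no zeros. -/
lemma mem_Omega_of_zero {h : ℝ} (hh : 1 < h) {s : ℂ} (hs : zetaSymbol h s = 0) :
    s ∈ Omega h := by
  rintro ⟨hre, him⟩
  refine riemannZeta_ne_zero_of_one_le_re (s := s ^ 2 + h) ?_ hs
  have h1 : s.im * s.im = h - 1 := by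
    rw [← abs_mul_abs_self, him, Real.mul_self_sqrt (by linarith)]
  simp only [pow_two, Complex.add_re, Complex.mul_re, Complex.ofReal_re]
  nlinarith

lemma differentiableAt_zetaSymbol {h : ℝ} {s : ℂ} (hs : polePoly h s ≠ 0) :
    DifferentiableAt ℂ (zetaSymbol h) s := by
  have h1 : s ^ 2 + (h : ℂ) ≠ 1 := fun h0 => hs (by rw [polePoly, h0, sub_self])
  exact (differentiableAt_riemannZeta h1).comp s (by fun_prop)

lemma differentiableOn_zetaSymbol {h : ℝ} (hh : 1 < h) :
    DifferentiableOn ℂ (zetaSymbol h) (Omega h) := fun _ hs =>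
  (differentiableAt_zetaSymbol (polePoly_ne_zero_of_mem_Omega hh hs)).differentiableWithinAt

/-- The symbol has finitely many zeros in every disc. -/
lemma finite_zeros (h R : ℝ) : {s : ℂ | ‖s‖ ≤ R ∧ zetaSymbol h s = 0}.Finite := by
  have hK : IsCompact ((fun s : ℂ => s ^ 2 + (h : ℂ)) '' Metric.closedBall 0 R) :=
    (isCompact_closedBall _ _).image (by fun_prop)
  have hfib : ∀ u : ℂ, {s : ℂ | s ^ 2 + (h : ℂ) = u}.Finite := fun u => by
    have hp : (X ^ 2 + C ((h : ℂ) - u) : ℂ[X]) ≠ 0 := (monic_X_pow_add_C _ two_ne_zero).ne_zero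
    refine (X ^ 2 + C ((h : ℂ) - u) : ℂ[X]).roots.toFinset.finite_toSet.subset fun s hs => ?_
    simp only [Finset.mem_coe, Multiset.mem_toFinset, mem_roots hp, IsRoot.def, eval_add, eval_pow,
      eval_X, eval_C]
    rw [mem_ofPred_eq] at hs
    linear_combination hs
  refine (hK.inter_riemannZetaZeros_finite.biUnion fun u _ => hfib u).subset fun s hs => ?_
  refine mem_iUnion₂.2 ⟨s ^ 2 + h, ⟨⟨s, by simpa using hs.1, rfl⟩, hs.2⟩, rfl⟩

lemma analyticOrderAt_entireSymbol_ne_top (h : ℝ) (τ : ℂ) :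
    analyticOrderAt (entireSymbol h) τ ≠ ⊤ := by
  rw [Ne, analyticOrderAt_eq_top]
  intro hev
  obtain ⟨ε, hε, hball⟩ := Metric.eventually_nhds_iff_ball.1 hev
  have hinf : (Metric.ball τ (min ε 1)).Infinite :=
    infinite_of_mem_nhds τ (Metric.ball_mem_nhds τ (by positivity))
  refine hinf ((finite_zeros h (‖τ‖ + 1)).subset fun s hs => ⟨?_, ?_⟩)
  · have h1 : ‖s - τ‖ < 1 := by
      rw [← dist_eq_norm]; exact hs.trans_le (min_le_right _ _)
    linarith [norm_sub_norm_le s τ]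
  · exact entireSymbol_eq_zero_iff.1 (hball s (Metric.ball_subset_ball (min_le_left _ _) hs))

lemma analyticOrderNatAt_entireSymbol {h : ℝ} {τ : ℂ} (hτ : polePoly h τ ≠ 0) :
    analyticOrderNatAt (entireSymbol h) τ = analyticOrderNatAt (zetaSymbol h) τ := by
  have hev : ∀ᶠ s in 𝓝 τ, polePoly h s ≠ 0 :=
    (differentiable_polePoly h).continuous.continuousAt.eventually_ne hτ
  have hQ : AnalyticAt ℂ (zetaSymbol h) τ :=
    DifferentiableOn.analyticAt (s := {s | polePoly h s ≠ 0})
      (fun s hs => (differentiableAt_zetaSymbol hs).differentiableWithinAt) hev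
  have h1 : entireSymbol h =ᶠ[𝓝 τ] polePoly h * zetaSymbol h := by
    filter_upwards [hev] with s hs
    exact entireSymbol_eq hs
  have hP := (differentiable_polePoly h).analyticAt τ
  rw [analyticOrderNatAt, analyticOrderAt_congr h1, analyticOrderAt_mul hP hQ,
    hP.analyticOrderAt_eq_zero.2 hτ, zero_add, analyticOrderNatAt]

/-- Splitting off finitely many zeros of the symbol. -/
lemma exists_symbol_factor {h : ℝ} {Z : Finset ℂ} (hZ : ∀ τ ∈ Z, zetaSymbol h τ = 0) :
    ∃ E : ℂ → ℂ, Differentiable ℂ E ∧ (∀ τ ∈ Z, E τ ≠ 0) ∧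
      (∀ s, E s = 0 → zetaSymbol h s = 0) ∧
      ∀ s, polePoly h s ≠ 0 → polePoly h s * zetaSymbol h s =
        (zeroPoly Z (analyticOrderNatAt (zetaSymbol h))).eval s * E s := by
  obtain ⟨E, hE, hne, hfac⟩ := exists_entire_factor_finset (differentiable_entireSymbol h)
    (analyticOrderAt_entireSymbol_ne_top h) Z
  refine ⟨E, hE, hne, fun s hs => entireSymbol_eq_zero_iff.1 (by rw [hfac, hs, mul_zero]),
    fun s hs => ?_⟩
  rw [← entireSymbol_eq hs, hfac s, eval_zeroPoly, eval_zeroPoly]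
  congr 1
  exact Finset.prod_congr rfl fun τ hτ => by
    rw [analyticOrderNatAt_entireSymbol (polePoly_ne_zero_of_zero (hZ τ hτ))]

/-! ### Hermite interpolation of exponentials -/

/-- The Taylor remainder of the exponential function is divisible by the power. -/
lemma exists_exp_taylor (τ z : ℂ) (m : ℕ) : ∃ q : ℂ → ℂ, Differentiable ℂ q ∧
    ∀ s, Complex.exp (s * z) = Complex.exp (τ * z) *
      (∑ k ∈ Finset.range m, z ^ k / k.factorial * (s - τ) ^ k) + (s - τ) ^ m * q s := by
  obtain ⟨F, hF, hfac⟩ := AnalyticAt.exists_eq_sum_add_pow_mul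
    (f := fun v : ℂ => Complex.exp (z * v)) (by fun_prop) m
  have hder : ∀ i, iteratedDeriv i (fun v : ℂ => Complex.exp (z * v)) 0 = z ^ i := fun i => by
    rw [iteratedDeriv_cexp_const_mul]; simp
  have hFd : Differentiable ℂ F := by
    intro v
    rcases eq_or_ne v 0 with rfl | hv
    · exact hF.differentiableAt
    · have h1 : DifferentiableAt ℂ (fun v : ℂ => (Complex.exp (z * v) -
          ∑ i ∈ Finset.range m, (v ^ i / i.factorial) • z ^ i) / v ^ m) v :=
        DifferentiableAt.fun_div (by fun_prop) (by fun_prop) (pow_ne_zero _ hv)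
      refine h1.congr_of_eventuallyEq ?_
      filter_upwards [isOpen_ne.mem_nhds hv] with y hy
      have h2 := hfac y
      simp only [hder] at h2
      rw [h2, add_sub_cancel_left, smul_eq_mul, mul_div_cancel_left₀ _ (pow_ne_zero _ hy)]
  refine ⟨fun s => Complex.exp (τ * z) * F (s - τ), (hFd.comp (by fun_prop)).const_mul _,
    fun s => ?_⟩
  have h3 := hfac (s - τ)
  simp only [hder, smul_eq_mul] at h3
  rw [show s * z = τ * z + z * (s - τ) by ring, Complex.exp_add, h3, mul_add]
  congr 1
  · congr 1
    exact Finset.sum_congr rfl fun k _ => by ring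
  · ring

/-- Hermite interpolation of exponentials. -/
lemma exists_hermite (Z : Finset ℂ) (m : ℂ → ℕ) : ∃ b : ℂ → ℕ → ℂ[X], ∀ z : ℂ, ∃ q : ℂ → ℂ,
    Differentiable ℂ q ∧ ∀ s, Complex.exp (s * z) =
      (∑ τ ∈ Z, Complex.exp (τ * z) *
        ∑ k ∈ Finset.range (m τ), z ^ k / k.factorial * (b τ k).eval s) +
      (zeroPoly Z m).eval s * q s := by
  classical
  rcases Z.eq_empty_or_nonempty with rfl | hne
  · exact ⟨fun _ _ => 0, fun z => ⟨fun s => Complex.exp (s * z), by fun_prop, by simp [zeroPoly]⟩⟩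
  have hcop : Pairwise (Function.onFun IsCoprime fun i : Z => (X - C (i : ℂ)) ^ m i) := by
    intro i j hij
    exact (Polynomial.pairwise_coprime_X_sub_C Subtype.val_injective hij).pow
  -- A Bézout identity writes `1` as a sum of multiples of the cofactors `∏_{σ ≠ τ} (X - σ)^{m σ}`.
  -- Multiplying the summand of `τ` by the Taylor expansion of the exponential at `τ` leaves
  -- remainders divisible by the whole product, and the interpolating polynomials do not depend on
  -- `z`.
  obtain ⟨μ, hμ⟩ := (exists_sum_eq_one_iff_pairwise_coprime (s := fun τ : ℂ => (X - C τ) ^ m τ)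
    hne).2 hcop
  refine ⟨fun τ k => μ τ * (∏ σ ∈ Z \ {τ}, (X - C σ) ^ m σ) * (X - C τ) ^ k, fun z => ?_⟩
  choose q hq hfac using fun τ => exists_exp_taylor τ z (m τ)
  refine ⟨fun s => ∑ τ ∈ Z, (μ τ).eval s * q τ s, ?_, fun s => ?_⟩
  · exact Differentiable.fun_sum fun τ _ => (Polynomial.differentiable _).mul (hq τ)
  · have h1 := congrArg (Polynomial.eval s) hμ
    rw [eval_finsetSum, eval_one] at h1
    rw [← one_mul (Complex.exp (s * z)), ← h1, Finset.sum_mul, Finset.mul_sum,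
      ← Finset.sum_add_distrib]
    refine Finset.sum_congr rfl fun τ hτ => ?_
    have h2 : (zeroPoly Z m).eval s = (∏ σ ∈ Z \ {τ}, (X - C σ) ^ m σ).eval s * (s - τ) ^ m τ := by
      rw [zeroPoly, ← Finset.sdiff_union_of_subset (Finset.singleton_subset_iff.2 hτ),
        Finset.prod_union Finset.sdiff_disjoint]
      simp [Finset.sdiff_union_of_subset (Finset.singleton_subset_iff.2 hτ)]
    rw [h2, hfac τ s, mul_add]
    simp only [eval_mul, eval_pow, eval_sub, eval_X, eval_C, Finset.mul_sum]
    congr 1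
    · refine Finset.sum_congr rfl fun k _ => ?_
      ring
    · ring

/-- A functional that annihilates the multiples of `∏ (s - τ) ^ m τ` is an exponential polynomial on
exponentials. -/
lemma IsFunctionalOn.exists_exponential_polynomial {S : Set ℂ} {Λ : (ℂ → ℂ) → ℂ}
    (h : IsFunctionalOn S Λ) (Z : Finset ℂ) (m : ℂ → ℕ)
    (h0 : ∀ q : ℂ → ℂ, Differentiable ℂ q → Λ (fun s => (zeroPoly Z m).eval s * q s) = 0) :
    ∃ p : ℂ → ℂ[X], (∀ τ ∈ Z, (p τ).degree < (m τ : ℕ)) ∧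
      ∀ z, Λ (fun s => Complex.exp (s * z)) = ∑ τ ∈ Z, (p τ).eval z * Complex.exp (τ * z) := by
  obtain ⟨b, hb⟩ := exists_hermite Z m
  refine ⟨fun τ => ∑ k ∈ Finset.range (m τ),
    C (Λ (fun s => (b τ k).eval s) / k.factorial) * X ^ k, fun τ _ => ?_, fun z => ?_⟩
  · rw [degree_lt_iff_coeff_zero]
    intro n hn
    rw [finsetSum_coeff]
    refine Finset.sum_eq_zero fun k hk => ?_
    rw [coeff_C_mul_X_pow, if_neg]
    have := Finset.mem_range.1 hk
    omega
  · obtain ⟨q, hq, hfac⟩ := hb z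
    have hbc : ∀ τ k, ContinuousOn (fun s => (b τ k).eval s) S :=
      fun τ k => (b τ k).continuous.continuousOn
    have hin : ∀ τ, ContinuousOn (fun s => ∑ k ∈ Finset.range (m τ),
        z ^ k / k.factorial * (b τ k).eval s) S := fun τ =>
      continuousOn_finsetSum _ fun k _ => (hbc τ k).const_mul _
    have hqc : ContinuousOn (fun s => (zeroPoly Z m).eval s * q s) S :=
      ((zeroPoly Z m).continuous.mul hq.continuous).continuousOn
    rw [show (fun s => Complex.exp (s * z)) = _ from funext hfac,
      h.add _ _ (continuousOn_finsetSum _ fun τ _ => (hin τ).const_mul _) hqc, h0 q hq, add_zero,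
      h.sum Z fun τ _ => (hin τ).const_mul _]
    refine Finset.sum_congr rfl fun τ _ => ?_
    rw [h.smul _ _ (hin τ), h.sum _ fun k _ => (hbc τ k).const_mul _, mul_comm, eval_finsetSum]
    congr 1
    refine Finset.sum_congr rfl fun k _ => ?_
    rw [h.smul _ _ (hbc τ k)]
    simp only [eval_mul, eval_C, eval_pow, eval_X]
    ring

/-! ### Residues, sources and principal parts -/

/-- The residues of `e^{sz} / (s - τ) ^ (k + 1)`. -/
lemma contourInt_exp_mul_inv_pow {γ : ℝ → ℂ} (h : IsClosedLipschitz γ) {τ : ℂ}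
    (hτ : τ ∉ γ '' Icc 0 1) (z : ℂ) (k : ℕ) :
    contourInt γ (fun s => Complex.exp (s * z) * ((s - τ)⁻¹) ^ (k + 1)) =
      2 * Real.pi * Complex.I * windingNumber γ τ *
        (z ^ k / k.factorial * Complex.exp (τ * z)) := by
  have hinv := continuousOn_inv_sub hτ
  have hF := h.isFunctionalOn
  induction k with
  | zero =>
    have h1 := cauchy_integral_formula h isOpen_univ (mapsTo_univ _ _)
      (F := fun s => Complex.exp (s * z)) (by fun_prop) (ν := 0) (by simp) (by simp)
      (mem_univ τ) hτ
    simp only [zero_add, pow_one, h1]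
    simp
    ring
  | succ k ih =>
    -- The integral of the derivative of `e^{sz} (s - τ)^{-(k+1)}` vanishes; this is the recursion
    -- that raises the pole order.
    have h2 : contourInt γ (fun s => z * (Complex.exp (s * z) * ((s - τ)⁻¹) ^ (k + 1)) -
        (k + 1) * (Complex.exp (s * z) * ((s - τ)⁻¹) ^ (k + 1 + 1))) = 0 := by
      refine h.contourInt_deriv (U := {τ}ᶜ)
        (F := fun s => Complex.exp (s * z) * ((s - τ)⁻¹) ^ (k + 1)) isOpen_compl_singleton
        (fun t ht h0 => hτ ⟨t, ht, h0⟩) fun s hs => ?_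
      have hne : s - τ ≠ 0 := sub_ne_zero.2 hs
      have h3 : HasDerivAt (fun s => Complex.exp (s * z)) (Complex.exp (s * z) * (1 * z)) s :=
        ((hasDerivAt_id' s).mul_const z).cexp
      have h4 : HasDerivAt (fun s => ((s - τ)⁻¹) ^ (k + 1))
          (((k + 1 : ℕ) : ℂ) * ((s - τ)⁻¹) ^ k * (-1 / (s - τ) ^ 2)) s :=
        (((hasDerivAt_id' s).sub_const τ).fun_inv hne).fun_pow (k + 1)
      refine (h3.fun_mul h4).congr_deriv ?_
      rw [show (-1 / (s - τ) ^ 2 : ℂ) = -((s - τ)⁻¹) ^ 2 by rw [inv_pow, neg_div, one_div]]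
      push_cast
      ring
    have hc : ∀ k : ℕ, ContinuousOn (fun s => Complex.exp (s * z) * ((s - τ)⁻¹) ^ k)
        (γ '' Icc 0 1) := fun k => ContinuousOn.fun_mul (by fun_prop) (hinv.pow k)
    rw [hF.sub ((hc _).const_mul _) ((hc _).const_mul _), hF.smul _ _ (hc _), hF.smul _ _ (hc _),
      ih] at h2
    have hk : (k : ℂ) + 1 ≠ 0 := by exact_mod_cast Nat.succ_ne_zero k
    have hk' : (k.factorial : ℂ) ≠ 0 := by exact_mod_cast Nat.factorial_ne_zero k
    refine mul_left_cancel₀ hk ?_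
    rw [← sub_eq_zero.1 h2, Nat.factorial_succ]
    push_cast
    field_simp
    ring

/-- The data of a source: a functional `J` on a compact subset of the slit plane on which the symbol
has no zero. -/
structure IsSource (h r : ℝ) (κ : Set ℂ) (J : (ℂ → ℂ) → ℂ) : Prop where
  one_lt : 1 < h
  pos : 0 < r
  compact : IsCompact κ
  subset : κ ⊆ Omega h
  norm_le : ∀ w ∈ κ, ‖w‖ ≤ r
  ne_zero : ∀ w ∈ κ, zetaSymbol h w ≠ 0
  functional : IsFunctionalOn κ J
  commutes : CommutesWithContours κ J

namespace IsSource

variable {h r : ℝ} {κ : Set ℂ} {J : (ℂ → ℂ) → ℂ}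

lemma continuousOn_inv (H : IsSource h r κ J) :
    ContinuousOn (fun w => (zetaSymbol h w)⁻¹) κ :=
  ((differentiableOn_zetaSymbol H.one_lt).continuousOn.mono H.subset).inv₀ H.ne_zero

lemma weighted (H : IsSource h r κ J) :
    IsFunctionalOn κ (fun F => J (fun w => F w * (zetaSymbol h w)⁻¹)) :=
  H.functional.mul_weight H.compact H.continuousOn_inv

lemma continuousOn_kernel {γ : ℝ → ℂ} (hdisj : ∀ w ∈ κ, w ∉ γ '' Icc 0 1) :
    ContinuousOn (Function.uncurry fun s w : ℂ => (s - w)⁻¹) ((γ '' Icc 0 1) ×ˢ κ) := by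
  refine ContinuousOn.inv₀ (f := fun p : ℂ × ℂ => p.1 - p.2) (by fun_prop) ?_
  rintro ⟨s, w⟩ ⟨hs, hw⟩ h0
  have h1 : s = w := sub_eq_zero.1 h0
  exact hdisj w hw (h1 ▸ hs)

/-- Contour integrals of Cauchy transforms. -/
lemma contourInt_cauchyTransform (H : IsSource h r κ J) {γ : ℝ → ℂ} (hγ : IsClosedLipschitz γ)
    (hdisj : ∀ w ∈ κ, w ∉ γ '' Icc 0 1) {A v : ℂ → ℂ} (hA : ContinuousOn A (γ '' Icc 0 1))
    (hv : ContinuousOn v κ) (hAκ : ContinuousOn A κ)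
    (hcau : ∀ w ∈ κ, contourInt γ (fun s => A s * (s - w)⁻¹) = 2 * Real.pi * Complex.I * A w) :
    contourInt γ (fun s => A s * J (fun w => (s - w)⁻¹ * v w)) =
      2 * Real.pi * Complex.I * J (fun w => A w * v w) := by
  have hker := continuousOn_kernel hdisj
  have hK : ContinuousOn (Function.uncurry fun s w => A s * ((s - w)⁻¹ * v w))
      ((γ '' Icc 0 1) ×ˢ κ) :=
    (hA.comp continuousOn_fst fun p hp => hp.1).mul
      (hker.mul (hv.comp continuousOn_snd fun p hp => hp.2))
  have e1 : contourInt γ (fun s => A s * J (fun w => (s - w)⁻¹ * v w)) =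
      contourInt γ (fun s => J (fun w => A s * ((s - w)⁻¹ * v w))) :=
    contourInt_congr fun s hs => by
      rw [H.functional.smul (A s) _ ((continuousOn_slice_right hker hs).fun_mul hv)]
  rw [e1, H.commutes γ hγ _ hK, ← H.functional.smul _ _ (hAκ.fun_mul hv)]
  refine (H.functional.congr ((hAκ.fun_mul hv).const_mul _) fun w hw => ?_).symm
  have e2 : ∀ s, A s * ((s - w)⁻¹ * v w) = A s * (s - w)⁻¹ * v w := fun s => by ring
  simp only [e2]
  rw [hγ.isFunctionalOn.mul_const (hA.fun_mul (continuousOn_slice_left hker hw)), hcau w hw]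
  ring

end IsSource

/-- The Borel transform of `∑ p_τ(z) e^{τz}`. -/
noncomputable def principalPart (Z : Finset ℂ) (m : ℂ → ℕ) (p : ℂ → ℂ[X]) (s : ℂ) : ℂ :=
  ∑ τ ∈ Z, ∑ k ∈ Finset.range (m τ), (p τ).coeff k * k.factorial * ((s - τ)⁻¹) ^ (k + 1)

section principalPart

variable {Z : Finset ℂ} {m : ℂ → ℕ} {p : ℂ → ℂ[X]}

lemma differentiableAt_inv_sub_pow {s τ : ℂ} (hs : s ≠ τ) (k : ℕ) :
    DifferentiableAt ℂ (fun s => ((s - τ)⁻¹) ^ k) s :=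
  (DifferentiableAt.fun_inv (differentiableAt_id.sub_const τ) (sub_ne_zero.2 hs)).fun_pow k

lemma differentiableOn_principalPart : DifferentiableOn ℂ (principalPart Z m p) (Z : Set ℂ)ᶜ := by
  intro s hs
  refine (DifferentiableAt.fun_sum fun τ hτ => DifferentiableAt.fun_sum fun k _ =>
    (differentiableAt_inv_sub_pow (fun h0 => hs ?_) _).const_mul _).differentiableWithinAt
  rw [h0]; exact hτ

lemma tendsto_principalPart : Tendsto (principalPart Z m p) (cocompact ℂ) (𝓝 0) := by
  have h1 : ∀ τ : ℂ, Tendsto (fun s : ℂ => (s - τ)⁻¹) (cocompact ℂ) (𝓝 0) := fun τ =>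
    tendsto_inv₀_cobounded.comp (by
      rw [← Metric.cobounded_eq_cocompact]
      exact tendsto_sub_const_cobounded τ)
  have h2 : Tendsto (principalPart Z m p) (cocompact ℂ)
      (𝓝 (∑ τ ∈ Z, ∑ k ∈ Finset.range (m τ), (p τ).coeff k * k.factorial * 0 ^ (k + 1))) :=
    tendsto_finsetSum _ fun τ _ => tendsto_finsetSum _ fun k _ => ((h1 τ).pow (k + 1)).const_mul _
  simpa using h2

lemma contourInt_mul_principalPart {γ : ℝ → ℂ} (hγ : IsClosedLipschitz γ)
    (hZ : ∀ τ ∈ Z, τ ∉ γ '' Icc 0 1) {A : ℂ → ℂ} (hA : ContinuousOn A (γ '' Icc 0 1)) :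
    contourInt γ (fun s => A s * principalPart Z m p s) =
      ∑ τ ∈ Z, ∑ k ∈ Finset.range (m τ), (p τ).coeff k * k.factorial *
        contourInt γ (fun s => A s * ((s - τ)⁻¹) ^ (k + 1)) := by
  have hF := hγ.isFunctionalOn
  have hc : ∀ τ ∈ Z, ∀ k : ℕ, ContinuousOn (fun s => A s * ((s - τ)⁻¹) ^ (k + 1)) (γ '' Icc 0 1) :=
    fun τ hτ k => hA.fun_mul ((continuousOn_inv_sub (hZ τ hτ)).pow _)
  have e : (fun s => A s * principalPart Z m p s) = fun s => ∑ τ ∈ Z, ∑ k ∈ Finset.range (m τ),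
      (p τ).coeff k * k.factorial * (A s * ((s - τ)⁻¹) ^ (k + 1)) := by
    ext s
    simp only [principalPart, Finset.mul_sum]
    exact Finset.sum_congr rfl fun τ _ => Finset.sum_congr rfl fun k _ => by ring
  rw [e, hF.sum Z fun τ hτ => continuousOn_finsetSum _ fun k _ => (hc τ hτ k).const_mul _]
  refine Finset.sum_congr rfl fun τ hτ => ?_
  rw [hF.sum _ fun k _ => (hc τ hτ k).const_mul _]
  exact Finset.sum_congr rfl fun k _ => hF.smul _ _ (hc τ hτ k)

lemma contourInt_exp_mul_principalPart {γ : ℝ → ℂ} (hγ : IsClosedLipschitz γ)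
    (hZ : ∀ τ ∈ Z, Encloses γ τ) (hp : ∀ τ ∈ Z, (p τ).degree < (m τ : ℕ)) (z : ℂ) :
    contourInt γ (fun s => Complex.exp (s * z) * principalPart Z m p s) =
      2 * Real.pi * Complex.I * ∑ τ ∈ Z, (p τ).eval z * Complex.exp (τ * z) := by
  rw [contourInt_mul_principalPart hγ (fun τ hτ => (hZ τ hτ).1) (by fun_prop), Finset.mul_sum]
  refine Finset.sum_congr rfl fun τ hτ => ?_
  have he : (p τ).eval z = ∑ k ∈ Finset.range (m τ), (p τ).coeff k * z ^ k := by
    by_cases h0 : p τ = 0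
    · simp [h0]
    · exact eval_eq_sum_range' ((natDegree_lt_iff_degree_lt h0).2 (hp τ hτ)) z
  rw [he, Finset.sum_mul, Finset.mul_sum]
  refine Finset.sum_congr rfl fun k _ => ?_
  have hk' : (k.factorial : ℂ) ≠ 0 := by exact_mod_cast Nat.factorial_ne_zero k
  rw [contourInt_exp_mul_inv_pow hγ (hZ τ hτ).1, (hZ τ hτ).2]
  field_simp

/-- Cauchy's formula for the exterior of the curve: the principal part is holomorphic off `Z` and
vanishes at infinity, which is the case `ν = 1` of `cauchy_integral_formula`. -/
lemma contourInt_inv_mul_principalPart {γ : ℝ → ℂ} (hγ : IsClosedLipschitz γ)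
    (hZ : ∀ τ ∈ Z, Encloses γ τ) {z : ℂ} (hz : Excludes γ z) :
    contourInt γ (fun s => (z - s)⁻¹ * principalPart Z m p s) =
      2 * Real.pi * Complex.I * principalPart Z m p z := by
  have hsub : MapsTo γ (Icc 0 1) (Z : Set ℂ)ᶜ :=
    fun t ht hmem => (hZ (γ t) hmem).1 (mem_image_of_mem _ ht)
  have hzZ : z ∈ (Z : Set ℂ)ᶜ := fun hmem => by
    have h1 := (hZ z hmem).2
    rw [hz.2] at h1
    exact zero_ne_one h1
  have hcont : ContinuousOn (fun s => principalPart Z m p s * (s - z)⁻¹) (γ '' Icc 0 1) :=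
    (differentiableOn_principalPart.continuousOn.mono hsub.image_subset).mul
      (continuousOn_inv_sub hz.1)
  have h1 := cauchy_integral_formula hγ Z.finite_toSet.isClosed.isOpen_compl hsub
    (differentiableOn_principalPart (m := m) (p := p)) (ν := 1)
    (fun w hw => (hZ w (notMem_compl_iff.1 hw)).2) (by simpa using tendsto_principalPart) hzZ hz.1
  have h2 := hγ.isFunctionalOn.smul (-1) _ hcont
  rw [h1, hz.2] at h2
  calc _ = contourInt γ (fun s => -1 * (principalPart Z m p s * (s - z)⁻¹)) := by
        congr 1; ext s
        rw [← neg_sub s z, inv_neg]; ring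
    _ = _ := by rw [h2]; ring

end principalPart

/-- Cauchy's theorem is the integral formula for `F w * (w - a)` at a point `a` off the curve, where
this function vanishes. A far negative number serves as `a`. -/
lemma contourInt_eq_zero_Omega {h : ℝ} {γ : ℝ → ℂ} (hγ : IsClosedLipschitz γ)
    (hγΩ : MapsTo γ (Icc 0 1) (Omega h)) {F : ℂ → ℂ} (hF : DifferentiableOn ℂ F (Omega h)) :
    contourInt γ F = 0 := by
  obtain ⟨ρ, hρ0, hρ⟩ := exists_norm_bound_image hγ
  set a : ℂ := -((ρ + 1 : ℝ) : ℂ) with ha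
  have han : ρ < ‖a‖ := by
    rw [ha, norm_neg, Complex.norm_real, Real.norm_of_nonneg (by linarith)]; linarith
  have haγ : a ∉ γ '' Icc 0 1 := fun hmem => (hρ a hmem).not_gt han
  have haΩ : a ∈ Omega h := fun hmem => by
    have := hmem.1
    rw [ha, Complex.neg_re, Complex.ofReal_re] at this
    linarith
  have h1 := cauchy_integral_formula hγ (isOpen_Omega h) hγΩ (F := fun w => F w * (w - a))
    (hF.fun_mul (by fun_prop)) (ν := 0)
    (fun w hw => windingNumber_eq_zero_of_notMem_Omega hγ hγΩ hw) (by simp) haΩ haγ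
  rw [sub_self, mul_zero, mul_zero, mul_zero] at h1
  rw [← h1]
  refine contourInt_congr fun w hw => ?_
  have hne : w - a ≠ 0 := sub_ne_zero.2 fun h0 => haγ (h0 ▸ hw)
  field_simp

/-- The symbol annihilates the exponential polynomials attached to its zeros. -/
lemma contourInt_symbol_mul_inv_pow {h : ℝ} (hh : 1 < h) {γ : ℝ → ℂ} (hγ : IsClosedLipschitz γ)
    (hγΩ : MapsTo γ (Icc 0 1) (Omega h)) {τ : ℂ} (hτ : zetaSymbol h τ = 0)
    (hτγ : τ ∉ γ '' Icc 0 1) {k : ℕ} (hk : k < analyticOrderNatAt (zetaSymbol h) τ) (z : ℂ) :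
    contourInt γ (fun s => Complex.exp (s * z) * zetaSymbol h s * ((s - τ)⁻¹) ^ (k + 1)) = 0 := by
  obtain ⟨E, hE, -, -, hfac⟩ := exists_symbol_factor (h := h) (Z := {τ}) (by simpa using hτ)
  set m := analyticOrderNatAt (zetaSymbol h) τ with hm
  -- The pole order `k + 1` is at most the order of the zero, so on the curve the integrand agrees
  -- with a function holomorphic on the slit plane.
  rw [← contourInt_eq_zero_Omega hγ hγΩ
    (F := fun s => Complex.exp (s * z) * ((s - τ) ^ (m - (k + 1)) * E s / polePoly h s))]
  · refine contourInt_congr fun s hs => ?_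
    have hsΩ := hγΩ.image_subset hs
    have hne : s - τ ≠ 0 := sub_ne_zero.2 fun h0 => hτγ (h0 ▸ hs)
    have hN := polePoly_ne_zero_of_mem_Omega hh hsΩ
    have h1 := hfac s hN
    rw [eval_zeroPoly, Finset.prod_singleton, ← hm] at h1
    have h2 : (s - τ) ^ m = (s - τ) ^ (m - (k + 1)) * (s - τ) ^ (k + 1) := by
      rw [← pow_add]; congr 1; omega
    rw [h2] at h1
    have h3 : zetaSymbol h s = (s - τ) ^ (m - (k + 1)) * (s - τ) ^ (k + 1) * E s / polePoly h s := by
      rw [eq_div_iff hN, mul_comm, h1]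
    rw [h3, inv_pow]
    field_simp
  · intro s hs
    exact (DifferentiableAt.fun_mul (by fun_prop) (DifferentiableAt.fun_div
      (DifferentiableAt.fun_mul (by fun_prop) (hE s)) (differentiable_polePoly h s)
      (polePoly_ne_zero_of_mem_Omega hh hs))).differentiableWithinAt

/-! ### Existence of solutions -/

namespace IsSource

variable {h r R : ℝ} {κ : Set ℂ} {J : (ℂ → ℂ) → ℂ} {Z : Finset ℂ} {p : ℂ → ℂ[X]}

/-- The proposed solution, as a functional applied to exponentials. -/
lemma exists_functional (H : IsSource h r κ J) (hrR : r ≤ R) (hZ : ∀ τ ∈ Z, ‖τ‖ ≤ R) {m : ℂ → ℕ}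
    (hp : ∀ τ ∈ Z, (p τ).degree < (m τ : ℕ)) {M : ℝ} (hM : R < M) :
    ∃ (S : Set ℂ) (Λ : (ℂ → ℂ) → ℂ), IsCompact S ∧ (∀ w ∈ S, ‖w‖ ≤ M) ∧ IsFunctionalOn S Λ ∧
      (∀ z, Λ (fun s => Complex.exp (s * z)) =
        J (fun s => Complex.exp (s * z) * (zetaSymbol h s)⁻¹) +
          ∑ τ ∈ Z, (p τ).eval z * Complex.exp (τ * z)) ∧
      ∀ z, M < ‖z‖ → Λ (fun w => (z - w)⁻¹) =
        J (fun w => (z - w)⁻¹ * (zetaSymbol h w)⁻¹) + principalPart Z m p z := by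
  -- A circle of radius `M` turns the exponential polynomial into a functional as well. Since `M >
  -- R` is arbitrary, the resulting growth bounds give type at most `R`.
  obtain ⟨γ, hγ, hγM, hγe⟩ := exists_circle (H.pos.trans_le hrR |>.trans hM)
  have hγZ : ∀ τ ∈ Z, Encloses γ τ := fun τ hτ => hγe τ ((hZ τ hτ).trans_lt hM)
  have hPc : ContinuousOn (principalPart Z m p) (γ '' Icc 0 1) :=
    (differentiableOn_principalPart.continuousOn).mono fun w hw hmem => (hγZ w hmem).1 hw
  refine ⟨κ ∪ γ '' Icc 0 1, fun F => J (fun w => F w * (zetaSymbol h w)⁻¹) +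
    (2 * Real.pi * Complex.I)⁻¹ * contourInt γ (fun w => F w * principalPart Z m p w),
    H.compact.union hγ.isCompact_image, ?_, ?_, fun z => ?_, fun z hz => ?_⟩
  · rintro w (hw | hw)
    · exact ((H.norm_le w hw).trans hrR).trans hM.le
    · exact (hγM w hw).le
  · exact (H.weighted.mono subset_union_left).add_functional
      (((hγ.isFunctionalOn.mul_weight hγ.isCompact_image hPc).const_mul _).mono subset_union_right)
  · beta_reduce
    rw [contourInt_exp_mul_principalPart hγ hγZ hp, inv_mul_cancel_left₀ two_pi_I_ne_zero]
  · beta_reduce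
    rw [contourInt_inv_mul_principalPart hγ hγZ ⟨fun hmem => hz.ne (hγM z hmem).symm,
      windingNumber_eq_zero_of_norm_lt hγ (fun w hw => (hγM w hw).le) hz⟩,
      inv_mul_cancel_left₀ two_pi_I_ne_zero]

/-- The proposed solutions solve the equation and have the right type. -/
theorem isSolution (H : IsSource h r κ J) (hrR : r ≤ R)
    (hZ : ∀ τ ∈ Z, ‖τ‖ ≤ R ∧ zetaSymbol h τ = 0)
    (hp : ∀ τ ∈ Z, (p τ).degree < (analyticOrderNatAt (zetaSymbol h) τ : ℕ)) {f : ℂ → ℂ}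
    (hf : ∀ z, f z = J (fun s => Complex.exp (s * z) * (zetaSymbol h s)⁻¹) +
      ∑ τ ∈ Z, (p τ).eval z * Complex.exp (τ * z)) :
    IsSolution h (fun z => J (fun s => Complex.exp (s * z))) f ∧ expType f ≤ R := by
  have hh := H.one_lt
  set m := analyticOrderNatAt (zetaSymbol h) with hm
  have hfun := fun M (hM : R < M) => H.exists_functional hrR (fun τ hτ => (hZ τ hτ).1) hp hM
  have hbd : ∀ M, R < M → ∃ C > 0, ∀ z, ‖f z‖ ≤ C * Real.exp (M * ‖z‖) := by
    intro M hM
    obtain ⟨S, Λ, -, hS, hΛ, hexp, -⟩ := hfun M hM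
    obtain ⟨C, hC, hb⟩ := hΛ.exists_norm_exp_le hS
    exact ⟨C, hC, fun z => by rw [hf, ← hexp]; exact hb z⟩
  have hR0 : 0 < R := H.pos.trans_le hrR
  have htype : expType f ≤ R := le_of_forall_gt_imp_ge_of_dense fun M hM =>
    csInf_le ⟨0, fun τ hτ => hτ.1.le⟩ ⟨hR0.trans hM, hbd M hM⟩
  obtain ⟨S, Λ, hSc, hS, hΛ, hexp, hcau⟩ := hfun (R + 1) (by linarith)
  have hfΛ : f = fun z => Λ fun s => Complex.exp (s * z) := funext fun z => by rw [hf, hexp]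
  have hfexp : IsEntireExpType f :=
    ⟨hfΛ ▸ hΛ.differentiable_exp hSc, R + 1, by linarith, hbd _ (by linarith)⟩
  set K : Set ℂ := κ ∪ Z with hK
  have hKc : IsCompact K := H.compact.union Z.finite_toSet.isCompact
  have hKΩ : K ⊆ Omega h :=
    union_subset H.subset fun τ hτ => mem_Omega_of_zero hh (hZ τ hτ).2
  set B : ℂ → ℂ := fun s => J (fun w => (s - w)⁻¹ * (zetaSymbol h w)⁻¹) + principalPart Z m p s
    with hB
  have hBorel : IsBorelTransform f K B := by
    refine ⟨fun s hs => ?_, R + 1, fun z hz => ?_⟩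
    · have h1 := H.weighted.differentiableAt_cauchy H.compact.isClosed
        (fun hmem => hs (Or.inl hmem))
      have h2 := (differentiableOn_principalPart (m := m) (p := p)).differentiableAt
        (Z.finite_toSet.isClosed.isOpen_compl.mem_nhds (fun hmem => hs (Or.inr hmem)))
      exact (h1.fun_add h2).differentiableWithinAt
    · have h1 := hΛ.hasSum_cauchy hS hz
      rw [hcau z hz] at h1
      refine h1.congr_fun fun n => ?_
      rw [hfΛ, hΛ.iteratedDeriv_exp_zero hSc]
  obtain ⟨γ, hγK, hγΩ⟩ := exists_memH1_Omega hh hKc hKΩ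
  have hγ := hγK.1.isClosedLipschitz
  have hQ := differentiableOn_zetaSymbol hh
  refine ⟨⟨⟨hfexp, K, B, hKc, hKΩ, hBorel⟩, K, B, γ, hKc, hKΩ, hBorel, hγK, hγΩ, fun z => ?_⟩,
    htype⟩
  -- Against `A` the Cauchy transform returns `J (A / ζ(s² + h))`, which is the source, and the
  -- principal part integrates to zero.
  set A : ℂ → ℂ := fun s => Complex.exp (s * z) * zetaSymbol h s with hA
  have hAd : DifferentiableOn ℂ A (Omega h) := DifferentiableOn.fun_mul (by fun_prop) hQ
  have hdisj : ∀ w ∈ κ, w ∉ γ '' Icc 0 1 := fun w hw => (hγK.2 w (Or.inl hw)).1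
  have hdisj' : ∀ w ∈ Z, w ∉ γ '' Icc 0 1 := fun w hw => (hγK.2 w (Or.inr hw)).1
  have hAγ : ContinuousOn A (γ '' Icc 0 1) := hAd.continuousOn.mono hγΩ.image_subset
  have e1 := H.contourInt_cauchyTransform hγ hdisj hAγ H.continuousOn_inv
    (hAd.continuousOn.mono H.subset) fun w hw =>
      contourInt_cauchy_Omega hγ hγΩ hAd (H.subset hw) (hγK.2 w (Or.inl hw))
  have e2 : contourInt γ (fun s => A s * principalPart Z m p s) = 0 := by
    rw [contourInt_mul_principalPart hγ hdisj' hAγ]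
    refine Finset.sum_eq_zero fun τ hτ => Finset.sum_eq_zero fun k hk => ?_
    rw [contourInt_symbol_mul_inv_pow hh hγ hγΩ (hZ τ hτ).2 (hdisj' τ hτ)
      (Finset.mem_range.1 hk), mul_zero]
  have hc1 : ContinuousOn (fun s => A s * J (fun w => (s - w)⁻¹ * (zetaSymbol h w)⁻¹))
      (γ '' Icc 0 1) := hAγ.fun_mul fun s hs =>
    (H.weighted.differentiableAt_cauchy H.compact.isClosed
      fun hmem => hdisj s hmem hs).continuousAt.continuousWithinAt
  have hc2 : ContinuousOn (fun s => A s * principalPart Z m p s) (γ '' Icc 0 1) :=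
    hAγ.fun_mul (differentiableOn_principalPart.continuousOn.mono
      fun s hs hmem => hdisj' s hmem hs)
  have e3 : contourInt γ (fun s => Complex.exp (s * z) * zetaSymbol h s * B s) =
      contourInt γ (fun s => A s * J (fun w => (s - w)⁻¹ * (zetaSymbol h w)⁻¹)) +
        contourInt γ (fun s => A s * principalPart Z m p s) := by
    rw [← hγ.isFunctionalOn.add _ _ hc1 hc2]
    congr 1; ext s
    simp only [hA, hB]; ring
  rw [e3, e1, e2, add_zero, inv_mul_cancel_left₀ two_pi_I_ne_zero]
  refine H.functional.congr (by fun_prop) fun w hw => ?_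
  rw [hA, mul_inv_cancel_right₀ (H.ne_zero w hw)]

end IsSource

/-! ### Uniqueness: every solution has the stated form -/

/-- A function of exponential type is recovered from its Borel transform. -/
lemma IsBorelTransform.eq_contourInt {f B : ℂ → ℂ} {K : Set ℂ} {γ : ℝ → ℂ}
    (hB : IsBorelTransform f K B) (hf : Differentiable ℂ f) (hK : IsCompact K)
    (hγK : MemH1 K γ) (z : ℂ) :
    f z = (2 * Real.pi * Complex.I)⁻¹ * contourInt γ (fun w => Complex.exp (w * z) * B w) := by
  obtain ⟨hBd, ρ, hρ⟩ := hB
  have hγ := hγK.1.isClosedLipschitz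
  have hγU : MapsTo γ (Icc 0 1) Kᶜ := fun t ht hmem => (hγK.2 _ hmem).1 (mem_image_of_mem _ ht)
  have hBc : ContinuousOn B (γ '' Icc 0 1) := hBd.continuousOn.mono hγU.image_subset
  have hΛ : IsFunctionalOn (γ '' Icc 0 1)
      (fun F => (2 * Real.pi * Complex.I)⁻¹ * contourInt γ (fun w => F w * B w)) :=
    (hγ.isFunctionalOn.mul_weight hγ.isCompact_image hBc).const_mul _
  obtain ⟨ρ', -, hρ'⟩ := exists_norm_bound_image hγ
  have hcau : ∀ z, max ρ ρ' < ‖z‖ →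
      (2 * Real.pi * Complex.I)⁻¹ * contourInt γ (fun w => (z - w)⁻¹ * B w) = B z := by
    intro z hz
    have hw := windingNumber_eq_zero_of_norm_lt hγ hρ' ((le_max_right _ _).trans_lt hz)
    have hzγ : z ∉ γ '' Icc 0 1 := fun hmem =>
      ((hρ' z hmem).trans (le_max_right ρ ρ')).not_gt hz
    have hzK : z ∈ Kᶜ := fun hmem => by
      have h1 := (hγK.2 z hmem).2
      rw [hw] at h1
      exact zero_ne_one h1
    have h1 := cauchy_integral_formula hγ hK.isClosed.isOpen_compl hγU hBd (ν := 1)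
      (fun w hw => (hγK.2 w (notMem_compl_iff.1 hw)).2)
      (by simpa using tendsto_cocompact_zero_of_hasSum hρ) hzK hzγ
    have h2 := hγ.isFunctionalOn.smul (-1) _ (hBc.fun_mul (continuousOn_inv_sub hzγ))
    rw [h1, hw] at h2
    have h3 : (fun w => (z - w)⁻¹ * B w) = fun w => -1 * (B w * (w - z)⁻¹) := by
      ext w
      rw [← neg_sub w z, inv_neg]; ring
    rw [h3, h2, inv_mul_eq_iff_eq_mul₀ two_pi_I_ne_zero]
    ring
  -- Both sides are entire with the same Borel transform near infinity, hence with the same Taylor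
  -- coefficients.
  have heq := eq_of_iteratedDeriv_eq hf (hΛ.differentiable_exp hγ.isCompact_image) fun n => by
    rw [hΛ.iteratedDeriv_exp_zero hγ.isCompact_image]
    refine coeff_eq_of_hasSum (ρ := max ρ ρ') (B := B)
      (a := fun n => iteratedDeriv n f 0)
      (b := fun n => (2 * Real.pi * Complex.I)⁻¹ * contourInt γ (fun w => w ^ n * B w))
      (fun z hz => hρ z ((le_max_left _ _).trans_lt hz)) (fun z hz => ?_) n
    have h1 := hΛ.hasSum_cauchy hρ' ((le_max_right _ _).trans_lt hz)
    rwa [hcau z hz] at h1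
  exact congrFun heq z

namespace IsFunctionalOn

variable {S : Set ℂ} {Λ : (ℂ → ℂ) → ℂ}

lemma exists_norm_moment_le (h : IsFunctionalOn S Λ) {σ C : ℝ}
    (hC : ∀ n : ℕ, ‖Λ fun w => w ^ n‖ ≤ C * σ ^ n) (P : ℂ[X]) :
    ∃ C', ∀ n : ℕ, ‖Λ fun w => P.eval w * w ^ n‖ ≤ C' * σ ^ n := by
  induction P using Polynomial.induction_on' with
  | add P Q hP hQ =>
    obtain ⟨C₁, h₁⟩ := hP
    obtain ⟨C₂, h₂⟩ := hQ
    refine ⟨C₁ + C₂, fun n => ?_⟩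
    have h3 := h.add (fun w => P.eval w * w ^ n) (fun w => Q.eval w * w ^ n)
      (P.continuous.mul (by fun_prop)).continuousOn (Q.continuous.mul (by fun_prop)).continuousOn
    simp only [eval_add, add_mul]
    rw [h3]
    exact (norm_add_le _ _).trans (add_le_add (h₁ n) (h₂ n))
  | monomial k a =>
    refine ⟨‖a‖ * (C * σ ^ k), fun n => ?_⟩
    have h3 : (fun w : ℂ => (monomial k a).eval w * w ^ n) = fun w => a * w ^ (k + n) := by
      ext w; rw [eval_monomial]; ring
    rw [h3, h.smul _ _ (by fun_prop), norm_mul]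
    refine (mul_le_mul_of_nonneg_left (hC (k + n)) (norm_nonneg a)).trans (le_of_eq ?_)
    ring

/-- A root of modulus larger than the growth rate of the moments can be removed. -/
lemma eq_zero_of_sub_mul (h : IsFunctionalOn S Λ) {σ C : ℝ} (hσ : 0 < σ)
    (hC : ∀ n : ℕ, ‖Λ fun w => w ^ n‖ ≤ C * σ ^ n) {τ : ℂ} (hτ : σ < ‖τ‖) (P : ℂ[X])
    (h0 : ∀ n : ℕ, Λ (fun w => ((X - Polynomial.C τ) * P).eval w * w ^ n) = 0) (n : ℕ) :
    Λ (fun w => P.eval w * w ^ n) = 0 := by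
  obtain ⟨C', hC'⟩ := h.exists_norm_moment_le hC P
  have hc : ∀ n : ℕ, ContinuousOn (fun w => P.eval w * w ^ n) S := fun n =>
    (P.continuous.mul (by fun_prop)).continuousOn
  -- The hypothesis makes the moments of `P` geometric with ratio `τ`, which exceeds the rate `σ` in
  -- modulus, so they vanish.
  have hstep : ∀ n : ℕ, Λ (fun w => P.eval w * w ^ (n + 1)) =
      τ * Λ (fun w => P.eval w * w ^ n) := fun n => by
    rw [← h.smul _ _ (hc n), ← sub_eq_zero, ← h.sub (hc _) ((hc n).const_mul _), ← h0 n]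
    congr 1; ext w
    simp only [eval_mul, eval_sub, eval_X, eval_C]
    ring
  have hpow : ∀ k : ℕ, Λ (fun w => P.eval w * w ^ (n + k)) =
      τ ^ k * Λ (fun w => P.eval w * w ^ n) := fun k => by
    induction k with
    | zero => simp
    | succ k ih => rw [← add_assoc, hstep, ih]; ring
  have hτ0 : 0 < ‖τ‖ := hσ.trans hτ
  have hlim : Tendsto (fun k : ℕ => C' * σ ^ n * (σ / ‖τ‖) ^ k) atTop (𝓝 (C' * σ ^ n * 0)) :=
    (tendsto_pow_atTop_nhds_zero_of_lt_one (by positivity) ((div_lt_one hτ0).2 hτ)).const_mul _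
  rw [mul_zero] at hlim
  refine norm_le_zero_iff.1 (ge_of_tendsto' hlim fun k => ?_)
  have h1 := hC' (n + k)
  rw [hpow, norm_mul, norm_pow] at h1
  rw [div_pow, ← mul_div_assoc, le_div_iff₀ (by positivity)]
  calc _ = ‖τ‖ ^ k * ‖Λ fun w => P.eval w * w ^ n‖ := mul_comm _ _
    _ ≤ _ := h1
    _ = _ := by ring

/-- Factors with a root outside the disc are removed one at a time, each with its own growth rate
between `R` and `|τ|`. -/
lemma eq_zero_of_zeroPoly_mul (h : IsFunctionalOn S Λ) {R : ℝ} (hR : 0 < R)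
    (hC : ∀ σ, R < σ → ∃ C, ∀ n : ℕ, ‖Λ fun w => w ^ n‖ ≤ C * σ ^ n) (m : ℂ → ℕ) (W : Finset ℂ)
    (hW : ∀ τ ∈ W, R < ‖τ‖) (P : ℂ[X])
    (h0 : ∀ n : ℕ, Λ (fun w => (zeroPoly W m * P).eval w * w ^ n) = 0) (n : ℕ) :
    Λ (fun w => P.eval w * w ^ n) = 0 := by
  classical
  induction W using Finset.induction_on with
  | empty => simpa [zeroPoly] using h0 n
  | insert τ W hτ ih =>
    refine ih (fun τ hτ => hW τ (Finset.mem_insert_of_mem hτ)) ?_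
    obtain ⟨σ, hσR, hστ⟩ := exists_between (hW τ (Finset.mem_insert_self τ W))
    obtain ⟨C, hC⟩ := hC σ hσR
    have key : ∀ k : ℕ, (∀ n : ℕ,
        Λ (fun w => ((X - Polynomial.C τ) ^ k * (zeroPoly W m * P)).eval w * w ^ n) = 0) →
        ∀ n : ℕ, Λ (fun w => (zeroPoly W m * P).eval w * w ^ n) = 0 := by
      intro k
      induction k with
      | zero => intro hk; simpa using hk
      | succ k ih =>
        intro hk
        refine ih (h.eq_zero_of_sub_mul (hR.trans hσR) hC hστ _ fun n => ?_)
        rw [← hk n]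
        congr 1; ext w
        rw [← mul_assoc, ← pow_succ']
    refine key (m τ) fun n => ?_
    rw [← h0 n]
    congr 1; ext w
    rw [zeroPoly, zeroPoly, Finset.prod_insert hτ, mul_assoc]

end IsFunctionalOn

namespace IsSource

variable {h r R : ℝ} {κ : Set ℂ} {J : (ℂ → ℂ) → ℂ} {Z : Finset ℂ}

/-- Every solution of type at most `R` has the proposed form. -/
theorem exists_formula (H : IsSource h r κ J) (hrR : r ≤ R)
    (hZ : ∀ τ, τ ∈ Z ↔ ‖τ‖ ≤ R ∧ zetaSymbol h τ = 0) {f : ℂ → ℂ}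
    (hf : IsSolution h (fun z => J (fun s => Complex.exp (s * z))) f) (hfR : expType f ≤ R) :
    ∃ p : ℂ → ℂ[X], (∀ τ ∈ Z, (p τ).degree < (analyticOrderNatAt (zetaSymbol h) τ : ℕ)) ∧
      ∀ z, f z = J (fun s => Complex.exp (s * z) * (zetaSymbol h s)⁻¹) +
        ∑ τ ∈ Z, (p τ).eval z * Complex.exp (τ * z) := by
  classical
  have hh := H.one_lt
  have hR0 : 0 < R := H.pos.trans_le hrR
  obtain ⟨⟨⟨hfd, hfτ⟩, -⟩, K, B, γ, hK, -, hB, hγK, hγΩ, hact⟩ := hf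
  have hγ := hγK.1.isClosedLipschitz
  have hfB := hB.eq_contourInt hfd hK hγK
  have hBc : ContinuousOn B (γ '' Icc 0 1) := hB.1.continuousOn.mono
    (MapsTo.image_subset fun t ht hmem => (hγK.2 _ hmem).1 (mem_image_of_mem _ ht))
  have hQc : ContinuousOn (zetaSymbol h) (γ '' Icc 0 1) :=
    (differentiableOn_zetaSymbol hh).continuousOn.mono hγΩ.image_subset
  set S := γ '' Icc 0 1 ∪ κ with hS
  have hSc : IsCompact S := hγ.isCompact_image.union H.compact
  have hSΩ : S ⊆ Omega h := union_subset hγΩ.image_subset H.subset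
  set m := analyticOrderNatAt (zetaSymbol h) with hm
  -- `Λ` represents `f` minus the integral over `κ`. `Λ'` is `Λ` with the symbol as an extra factor,
  -- and the equation says that it kills exponentials.
  set Λ : (ℂ → ℂ) → ℂ := fun F => (2 * Real.pi * Complex.I)⁻¹ * contourInt γ (fun w => F w * B w) -
    J (fun w => F w * (zetaSymbol h w)⁻¹) with hΛdef
  set Λ' : (ℂ → ℂ) → ℂ := fun F => (2 * Real.pi * Complex.I)⁻¹ *
    contourInt γ (fun w => F w * (zetaSymbol h w * B w)) - J F with hΛ'def
  have hΛ : IsFunctionalOn S Λ :=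
    (((hγ.isFunctionalOn.mul_weight hγ.isCompact_image hBc).const_mul _).mono
      subset_union_left).sub_functional (H.weighted.mono subset_union_right)
  have hΛ' : IsFunctionalOn S Λ' :=
    (((hγ.isFunctionalOn.mul_weight hγ.isCompact_image (hQc.fun_mul hBc)).const_mul _).mono
      subset_union_left).sub_functional (H.functional.mono subset_union_right)
  have hexp : ∀ z, Λ (fun s => Complex.exp (s * z)) =
      f z - J (fun s => Complex.exp (s * z) * (zetaSymbol h s)⁻¹) := fun z => by
    rw [hfB z]
  have hexp' : (fun z => Λ' (fun s => Complex.exp (s * z))) = fun _ => 0 := by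
    ext z
    simp only [hΛ'def]
    refine sub_eq_zero.2 (Eq.trans ?_ (hact z).symm)
    congr 2; ext s; ring
  have hmom' : ∀ n : ℕ, Λ' (fun w => w ^ n) = 0 := fun n => by
    rw [← hΛ'.iteratedDeriv_exp_zero hSc, hexp']
    simp
  obtain ⟨ρ₀, hρ₀⟩ := hSc.isBounded.exists_norm_le
  set ρ := max ρ₀ R with hρdef
  have hρ : ∀ w ∈ S, ‖w‖ ≤ ρ := fun w hw => (hρ₀ w hw).trans (le_max_left _ _)
  -- All zeros in a disc larger than the support `S`, so that the cofactor `E` has no zero in the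
  -- open disc and `polePoly h / E` is holomorphic there.
  set Y := (finite_zeros h (ρ + 1)).toFinset with hY
  have hYmem : ∀ τ, τ ∈ Y ↔ ‖τ‖ ≤ ρ + 1 ∧ zetaSymbol h τ = 0 := fun τ => by
    rw [hY, Finite.mem_toFinset, mem_ofPred_eq]
  have hZY : Z ⊆ Y := fun τ hτ => by
    rw [hYmem]
    have := (hZ τ).1 hτ
    exact ⟨by linarith [this.1, le_max_right ρ₀ R], this.2⟩
  obtain ⟨E, hE, hEY, hEZ, hfac⟩ := exists_symbol_factor (h := h) fun τ hτ => ((hYmem τ).1 hτ).2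
  have hEne : ∀ s ∈ Metric.ball (0 : ℂ) (ρ + 1), E s ≠ 0 := fun s hs h0 =>
    hEY s ((hYmem s).2 ⟨(mem_ball_zero_iff.1 hs).le, hEZ s h0⟩) h0
  have hSball : S ⊆ Metric.ball (0 : ℂ) (ρ + 1) := fun w hw =>
    mem_ball_zero_iff.2 ((hρ w hw).trans_lt (lt_add_one ρ))
  have hA : DifferentiableOn ℂ (fun s => polePoly h s / E s) (Metric.ball 0 (ρ + 1)) :=
    fun s hs => ((differentiable_polePoly h s).fun_div (hE s) (hEne s hs)).differentiableWithinAt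
  have hT : ∀ s ∈ S, (zeroPoly Y m).eval s = polePoly h s / E s * zetaSymbol h s := fun s hs => by
    have h1 := hfac s (polePoly_ne_zero_of_mem_Omega hh (hSΩ hs))
    have h2 := hEne s (hSball hs)
    rw [div_mul_eq_mul_div, h1, mul_div_cancel_right₀ _ h2]
  -- On `S` the polynomial of `Y` is the symbol times `polePoly h / E`, so this moment of `Λ` is a
  -- value of `Λ'` on a function holomorphic on the disc.
  have hΛY : ∀ n : ℕ, Λ (fun w => (zeroPoly Y m).eval w * w ^ n) = 0 := fun n => by
    have hFd : DifferentiableOn ℂ (fun s => s ^ n * (polePoly h s / E s))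
        (Metric.ball 0 (ρ + 1)) := DifferentiableOn.fun_mul (by fun_prop) hA
    rw [← hΛ'.eq_zero_of_monomials hρ (lt_add_one ρ) hmom' hFd]
    have e1 : contourInt γ (fun w => (zeroPoly Y m).eval w * w ^ n * B w) =
        contourInt γ (fun w => w ^ n * (polePoly h w / E w) * (zetaSymbol h w * B w)) :=
      contourInt_congr fun s hs => by rw [hT s (Or.inl hs)]; ring
    have e2 : J (fun w => (zeroPoly Y m).eval w * w ^ n * (zetaSymbol h w)⁻¹) =
        J (fun w => w ^ n * (polePoly h w / E w)) :=
      (H.functional.congr (hFd.continuousOn.mono (subset_union_right.trans hSball))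
        fun s hs => by
          rw [hT s (Or.inr hs)]
          have := H.ne_zero s hs
          field_simp).symm
    simp only [hΛdef, hΛ'def]
    rw [e1, e2]
  -- The hypothesis on the type enters here: any `σ > R` lies above an admissible exponent `τ` of
  -- `f` and above `r`, and Cauchy estimates bound the moments.
  have hgrowth : ∀ σ, R < σ → ∃ C, ∀ n : ℕ, ‖Λ fun w => w ^ n‖ ≤ C * σ ^ n := by
    intro σ hσ
    obtain ⟨C₁, -, hC₁⟩ := H.weighted.exists_norm_exp_le H.norm_le
    obtain ⟨τ, hτ, -, C₂, hC₂pos, hC₂⟩ : ∃ τ < σ, 0 < τ ∧ ∃ C > 0, ∀ z, ‖f z‖ ≤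
        C * Real.exp (τ * ‖z‖) := by
      obtain ⟨τ, hτ, hlt⟩ := exists_lt_of_csInf_lt (by
        obtain ⟨τ, hτ, hb⟩ := hfτ
        exact ⟨τ, hτ, hb⟩) (hfR.trans_lt hσ)
      exact ⟨τ, hlt, hτ⟩
    set M := max τ r with hM
    have hb : ∀ z, ‖Λ fun w => Complex.exp (w * z)‖ ≤ (C₂ + |C₁|) * Real.exp (M * ‖z‖) := by
      intro z
      rw [hexp, add_mul]
      refine (norm_sub_le _ _).trans (add_le_add ((hC₂ z).trans ?_) ((hC₁ z).trans ?_))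
      · gcongr
        exact le_max_left _ _
      · gcongr
        · exact le_abs_self _
        · exact le_max_right _ _
    obtain ⟨C', hC'⟩ := exists_norm_iteratedDeriv_le (hΛ.differentiable_exp hSc)
      (H.pos.trans_le (le_max_right τ r)) (max_lt hτ (hrR.trans_lt hσ)) hb
    refine ⟨C', fun n => ?_⟩
    rw [← hΛ.iteratedDeriv_exp_zero hSc]
    exact hC' n
  have hΛZ := hΛ.eq_zero_of_zeroPoly_mul hR0 hgrowth m (Y \ Z) (fun τ hτ => by
    rw [Finset.mem_sdiff, hYmem, hZ] at hτ
    by_contra! hle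
    exact hτ.2 ⟨hle, hτ.1.2⟩) (zeroPoly Z m) fun n => by
      rw [← hΛY n, zeroPoly, zeroPoly, zeroPoly, Finset.prod_sdiff hZY]
  have hwt := hΛ.mul_weight hSc (zeroPoly Z m).continuous.continuousOn
  obtain ⟨p, hp, hpexp⟩ := hΛ.exists_exponential_polynomial Z m fun q hq => by
    have h1 := hwt.eq_zero_of_monomials hρ (lt_add_one ρ) (fun n => by
      rw [← hΛZ n]
      congr 1; ext w; ring) (hq.differentiableOn (s := Metric.ball 0 (ρ + 1)))
    rw [← h1]
    congr 1; ext w; ring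
  exact ⟨p, hp, fun z => by rw [← hpexp z, hexp z]; ring⟩

end IsSource

/-! ### The solution given by the Borel transform of the source -/

/-- A simple curve visits finitely many points in a null set of times. This handles curves through
the poles of the symbol, where `1 / zetaSymbol h` takes a default value instead of its limit `0`. -/
lemma contourInt_congr_of_finite {γ : ℝ → ℂ} (hγ : IsSimpleClosedCurve γ) {N : Set ℂ}
    (hN : N.Finite) {F G : ℂ → ℂ} (hFG : ∀ s ∈ γ '' Icc 0 1, s ∉ N → F s = G s) :
    contourInt γ F = contourInt γ G := by
  have hfin : {t ∈ Ico (0 : ℝ) 1 | γ t ∈ N}.Finite :=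
    Finite.of_injOn (fun t ht => ht.2) (hγ.simple.mono fun t ht => ht.1) hN
  refine intervalIntegral.integral_congr_ae ?_
  have h0 : volume ({t ∈ Ico (0 : ℝ) 1 | γ t ∈ N} ∪ {1}) = 0 :=
    (hfin.union (finite_singleton 1)).measure_zero _
  filter_upwards [compl_mem_ae_iff.2 h0] with t ht ht'
  rw [uIoc_of_le zero_le_one] at ht'
  simp only [mem_compl_iff, mem_union, not_or, mem_singleton_iff] at ht
  have ht1 : t < 1 := lt_of_le_of_ne ht'.2 ht.2
  rw [hFG (γ t) (mem_image_of_mem _ ⟨ht'.1.le, ht'.2⟩) fun hmem => ht.1 ⟨⟨ht'.1.le, ht1⟩, hmem⟩]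

namespace IsSource

variable {h r : ℝ} {κ : Set ℂ} {J : (ℂ → ℂ) → ℂ} {Z : Finset ℂ}

/-- The solution obtained from the Borel transform of the source has the proposed form. -/
theorem exists_formula_contourInt (H : IsSource h r κ J)
    (hZ : ∀ τ, τ ∈ Z ↔ ‖τ‖ ≤ r ∧ zetaSymbol h τ = 0) {γ : ℝ → ℂ} (hγκ : MemH1 κ γ)
    (hin : ∀ τ ∈ Z, Encloses γ τ)
    (hout : ∀ τ, zetaSymbol h τ = 0 → r < ‖τ‖ → Excludes γ τ) :
    ∃ p : ℂ → ℂ[X], (∀ τ ∈ Z, (p τ).degree < (analyticOrderNatAt (zetaSymbol h) τ : ℕ)) ∧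
      ∀ z, (2 * Real.pi * Complex.I)⁻¹ * contourInt γ (fun s => Complex.exp (s * z) *
          J (fun w => (s - w)⁻¹) / zetaSymbol h s) =
        J (fun s => Complex.exp (s * z) * (zetaSymbol h s)⁻¹) +
          ∑ τ ∈ Z, (p τ).eval z * Complex.exp (τ * z) := by
  have hh := H.one_lt
  have hγ := hγκ.1.isClosedLipschitz
  have hdisj : ∀ w ∈ κ, w ∉ γ '' Icc 0 1 := fun w hw => (hγκ.2 w hw).1
  set m := analyticOrderNatAt (zetaSymbol h) with hm
  obtain ⟨E, hE, hEY, hEZ, hfac⟩ := exists_symbol_factor (h := h) fun τ hτ => ((hZ τ).1 hτ).2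
  have hEout : ∀ s, E s = 0 → Excludes γ s := fun s hs =>
    hout s (hEZ s hs) (by
      by_contra! hle
      exact hEY s ((hZ s).2 ⟨hle, hEZ s hs⟩) hs)
  have hEγ : ∀ s ∈ γ '' Icc 0 1, E s ≠ 0 := fun s hs h0 => (hEout s h0).1 hs
  have hTγ : ∀ s ∈ γ '' Icc 0 1, (zeroPoly Z m).eval s ≠ 0 := fun s hs =>
    eval_zeroPoly_ne_zero fun hmem => (hin s hmem).1 hs
  have hTc := (zeroPoly Z m).continuous
  -- The curve need not lie in the slit plane: away from the poles of the symbol, its reciprocal is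
  -- `polePoly h / (zeroPoly Z m * E)`, which is meromorphic on the whole plane.
  set A₀ : ℂ → ℂ := fun s => polePoly h s / E s with hA₀
  set V : ℂ → ℂ := fun s => A₀ s / (zeroPoly Z m).eval s with hV
  set c : ℂ → ℂ := fun s => J (fun w => (s - w)⁻¹) with hc
  have hcc : ContinuousOn c (γ '' Icc 0 1) := fun s hs =>
    (H.functional.differentiableAt_cauchy H.compact.isClosed
      fun hmem => hdisj s hmem hs).continuousAt.continuousWithinAt
  have hA₀d : DifferentiableOn ℂ A₀ {s | E s ≠ 0} := fun s hs =>
    ((differentiable_polePoly h s).fun_div (hE s) hs).differentiableWithinAt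
  have hVc : ContinuousOn V (γ '' Icc 0 1) :=
    (hA₀d.continuousOn.mono hEγ).div hTc.continuousOn hTγ
  have hκE : ∀ w ∈ κ, E w ≠ 0 := fun w hw h0 => H.ne_zero w hw (hEZ w h0)
  set S := γ '' Icc 0 1 ∪ κ with hS
  have hΛ : IsFunctionalOn S (fun F => (2 * Real.pi * Complex.I)⁻¹ *
      contourInt γ (fun w => F w * (c w * V w)) - J (fun w => F w * (zetaSymbol h w)⁻¹)) :=
    (((hγ.isFunctionalOn.mul_weight hγ.isCompact_image (hcc.fun_mul hVc)).const_mul _).mono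
      subset_union_left).sub_functional (H.weighted.mono subset_union_right)
  obtain ⟨p, hp, hpexp⟩ := hΛ.exists_exponential_polynomial Z m fun q hq => by
    have hAd : DifferentiableOn ℂ (fun s => q s * A₀ s) {s | E s ≠ 0} :=
      hq.differentiableOn.fun_mul hA₀d
    have hU : IsOpen {s | E s ≠ 0} := isOpen_ne_fun hE.continuous continuous_const
    -- Multiplication by the polynomial of `Z` leaves only zeros of `E` as poles, and the curve does
    -- not wind around these; so the contour integral reduces to `J` and the difference vanishes.
    have h1 := H.contourInt_cauchyTransform hγ hdisj (hAd.continuousOn.mono hEγ)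
      (v := fun _ => 1) continuousOn_const (hAd.continuousOn.mono hκE) fun w hw => by
        rw [cauchy_integral_formula hγ hU (mapsTo_iff_image_subset.2 hEγ) hAd (ν := 0)
          (fun w hw => (hEout w (not_not.1 hw)).2) (by simp) (hκE w hw) (hdisj w hw),
          (hγκ.2 w hw).2]
        ring
    simp only [mul_one] at h1
    have e1 : contourInt γ (fun w => (zeroPoly Z m).eval w * q w * (c w * V w)) =
        contourInt γ (fun s => q s * A₀ s * c s) := contourInt_congr fun s hs => by
      have := hTγ s hs
      simp only [hV]
      field_simp
    have e2 : J (fun w => (zeroPoly Z m).eval w * q w * (zetaSymbol h w)⁻¹) =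
        J (fun w => q w * A₀ w) :=
      (H.functional.congr (hAd.continuousOn.mono hκE) fun s hs => by
        have h2 := hfac s (polePoly_ne_zero_of_mem_Omega hh (H.subset hs))
        have h3 := hκE s hs
        have h4 := H.ne_zero s hs
        simp only [hA₀]
        field_simp
        rw [mul_assoc, h2]
        ring).symm
    rw [e1, e2, h1, inv_mul_cancel_left₀ two_pi_I_ne_zero, sub_self]
  refine ⟨p, hp, fun z => ?_⟩
  rw [← hpexp z, add_sub_cancel]
  congr 1
  refine contourInt_congr_of_finite hγκ.1 (finite_polePoly_zeros h) fun s hs hsN => ?_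
  have h1 := hfac s hsN
  have h2 := hEγ s hs
  have h3 := hTγ s hs
  have h4 : zetaSymbol h s ≠ 0 := fun h0 => by
    rw [h0, mul_zero] at h1
    exact mul_ne_zero h3 h2 h1.symm
  have h5 : V s = (zetaSymbol h s)⁻¹ := by
    simp only [hV, hA₀]
    rw [div_div, div_eq_iff (mul_ne_zero h2 h3), mul_comm (E s), ← h1]
    field_simp
  rw [h5, ← mul_assoc, div_eq_mul_inv]

end IsSource

/-! ### The theorem -/

lemma isSource_kappaInt {h δ ψ r : ℝ} (hh : 1 < h) {g : ℝ → ℂ} (hδ : 0 < δ) (hδr : δ < r)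
    (hψ : 0 ≤ ψ) {G : ℝ → ℝ → ℂ} (hG : IsLaplaceTransform g δ ψ G) (hΩ : kappa δ ψ r ⊆ Omega h)
    (hκ : ∀ s ∈ kappa δ ψ r, zetaSymbol h s ≠ 0) :
    IsSource h r (kappa δ ψ r) (kappaInt δ ψ r G) where
  one_lt := hh
  pos := hδ.trans hδr
  compact := isCompact_kappa δ ψ r
  subset := hΩ
  norm_le _ hs := norm_le_of_mem_kappa hδ hδr hs
  ne_zero := hκ
  functional := (kappaInt_functional hδr.le hψ hG.boundary).1
  commutes := (kappaInt_functional hδr.le hψ hG.boundary).2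

end

end ZetaNonlocal

theorem mainTheorem6 (h : ℝ) (hh : 1 < h) (g : ℝ → ℂ) (δ ψ r : ℝ) (hδ : 0 < δ) (hδr : δ < r)
    (hψ : Real.pi / 2 < ψ) (hψπ : ψ ≤ Real.pi) (G : ℝ → ℝ → ℂ)
    (hG : ZetaNonlocal.IsLaplaceTransform g δ ψ G)
    (hΩ : ZetaNonlocal.kappa δ ψ r ⊆ ZetaNonlocal.Omega h)
    (hκ : ∀ s ∈ ZetaNonlocal.kappa δ ψ r, ZetaNonlocal.zetaSymbol h s ≠ 0) :
    ∃ Z : ℝ → Finset ℂ,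
      (∀ R τ, τ ∈ Z R ↔ ‖τ‖ ≤ R ∧ ZetaNonlocal.zetaSymbol h τ = 0) ∧
      (∀ R, r ≤ R → ∀ f : ℂ → ℂ,
        (ZetaNonlocal.IsSolution h (ZetaNonlocal.truncatedSource δ ψ r G) f ∧
            ZetaNonlocal.expType f ≤ R) ↔
          ∃ p : ℂ → Polynomial ℂ,
            (∀ τ ∈ Z R, (p τ).degree < (analyticOrderNatAt (ZetaNonlocal.zetaSymbol h) τ : ℕ)) ∧
            ∀ z, f z = ZetaNonlocal.solutionFormula h δ ψ r G (Z R) p z) ∧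
      (∀ γ : ℝ → ℂ, ZetaNonlocal.MemH1 (ZetaNonlocal.kappa δ ψ r) γ →
        (∀ τ ∈ Z r, ZetaNonlocal.Encloses γ τ) →
        (∀ τ, ZetaNonlocal.zetaSymbol h τ = 0 → r < ‖τ‖ → ZetaNonlocal.Excludes γ τ) →
        ZetaNonlocal.IsSolution h (ZetaNonlocal.truncatedSource δ ψ r G)
            (fun z => (2 * Real.pi * Complex.I)⁻¹ *
              ZetaNonlocal.contourInt γ (fun s => Complex.exp (s * z) *
                ZetaNonlocal.cauchyTransform δ ψ r G s / ZetaNonlocal.zetaSymbol h s)) ∧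
          ∃ p : ℂ → Polynomial ℂ,
            (∀ τ ∈ Z r, (p τ).degree < (analyticOrderNatAt (ZetaNonlocal.zetaSymbol h) τ : ℕ)) ∧
            ∀ z, (2 * Real.pi * Complex.I)⁻¹ *
                ZetaNonlocal.contourInt γ (fun s => Complex.exp (s * z) *
                  ZetaNonlocal.cauchyTransform δ ψ r G s / ZetaNonlocal.zetaSymbol h s) =
              ZetaNonlocal.solutionFormula h δ ψ r G (Z r) p z) := by
  have H := ZetaNonlocal.isSource_kappaInt hh hδ hδr (Real.pi_div_two_pos.trans hψ).le hG hΩ hκ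
  have hsf : ∀ Z p z, ZetaNonlocal.solutionFormula h δ ψ r G Z p z =
      ZetaNonlocal.kappaInt δ ψ r G (fun s => Complex.exp (s * z) *
        (ZetaNonlocal.zetaSymbol h s)⁻¹) + ∑ τ ∈ Z, (p τ).eval z * Complex.exp (τ * z) :=
    fun Z p z => by simp only [ZetaNonlocal.solutionFormula, div_eq_mul_inv]
  have hZ : ∀ R τ, τ ∈ (ZetaNonlocal.finite_zeros h R).toFinset ↔
      ‖τ‖ ≤ R ∧ ZetaNonlocal.zetaSymbol h τ = 0 := fun R τ => by
    rw [Set.Finite.mem_toFinset, Set.mem_ofPred_eq]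
  refine ⟨fun R => (ZetaNonlocal.finite_zeros h R).toFinset, hZ, fun R hR f => ⟨?_, ?_⟩,
    fun γ hγ hin hout => ?_⟩
  · rintro ⟨hf, hfR⟩
    obtain ⟨p, hp, hpf⟩ := H.exists_formula hR (hZ R) hf hfR
    exact ⟨p, hp, fun z => by rw [hpf, hsf]⟩
  · rintro ⟨p, hp, hpf⟩
    exact H.isSolution hR (fun τ hτ => (hZ R τ).1 hτ) hp fun z => by rw [hpf, hsf]
  -- Once the contour integral is known to have the form in (1), the existence part shows that it is
  -- a solution.
  · obtain ⟨p, hp, hpf⟩ := H.exists_formula_contourInt (hZ r) hγ hin hout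
    exact ⟨(H.isSolution le_rfl (fun τ hτ => (hZ r τ).1 hτ) hp hpf).1, p, hp,
      fun z => by rw [hsf]; exact hpf z⟩
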